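/- **Theorem (abstract quasi-optimality).** *Setting.* Let $d\in\{2,3\}$, let $\Omega\subset\mathbb R^d$ be a bounded Lipschitz domain with boundary $\Gamma$, partitioned into a family $\mathscr P$ of pairwise disjoint Lipschitz subdomains with $\bigcup_{P\in\mathscr P}\overline P=\overline\Omega$; let $0\le t\le 1$, $k_0>0$, $s_{\max}\in\mathbb N_0$. All functions are complex valued. $(\cdot,\cdot)$ and $\langle\cdot,\cdot\rangle$ are the inner products of $L^2(\Omega)$, $L^2(\Gamma)$ (antilinear in the second argument) and the corresponding duality pairings. Let $H^{1,t}:=\{u\in H^1(\Omega): u|_\Gamma\in H^t(\Gamma)\}$ with $$\|u\|_{1,t,k}^2:=k^2\|u\|_{0,\Omega}^2+k^{1-2t}|u|_{t,\Gamma}^2+\|\nabla u\|_{0,\Omega}^2 .$$ $H^s(\mathscr P)$, $s\ge0$, is the broken Sobolev space of functions on $\Omega$ that are $H^s$ on each $P\in\mathscr P$; $H^{r}(\Gamma)$, $r\ge 1/2$, is the space of traces of $H^{r+1/2}(\Omega)$ with the quotient norm. For an open set $\omega$, $\mathcal A(M,\gamma,\omega)$ is the set of $v\in L^2(\omega)$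 with $\|\nabla^n v\|_{0,\omega}\le M\gamma^n\max\{n,k\}^n$ for all $n\in\mathbb N_0$; $\mathcal A(M,\gamma,\mathscr P)$ is the set of $v\in L^2(\Omega)$ with $v|_P\in\mathcal A(M,\gamma,P)$ for all $P\in\mathscr P$; for a tubular neighborhood $T=\{x:\operatorname{dist}(x,\Gamma)<\delta\}$, $\delta>0$, of $\Gamma$, $\mathcal A(M,\gamma,T,\Gamma)$ is the set of traces on $\Gamma$ of functions in $\mathcal A(M,\gamma,T\cap\Omega)$ (always $M,\gamma\ge0$). For each $k\ge k_0$ let $a=a_k$ be a sesquilinear form on $H^{1,t}$, and let $T^\pm_{k,\Omega}:H^{1,t}\to (H^{1,t})'$ and $T^\pm_{k,\Gamma}:H^t(\Gamma)\to H^{-t}(\Gamma)$ be linear (with antiduals as targets). Put $b_k^\pm(u,v):=a(u,v)-(T^\pm_{k,\Omega}u,v)-\langle T^\pm_{k,\Gamma}u,v\rangle$, and write $u=S_k^\pm(f,g)$ if $u\in H^{1,t}$ and $b^\pm_k(u,v)=(f,v)+\langle g,v\rangle$ for all $v\in H^{1,t}$. Assume the following for all $k\ge k_0$, where constants with an index $k$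 may depend on $k$ and all others do not. **(WP)** (1) $|b_k^-(u,v)|\le C^-_{\mathrm{cont},k}\|u\|_{1,t,k}\|v\|_{1,t,k}$, with $C^-_{\mathrm{cont},k}\ge0$. (2) For all $f\in L^2(\Omega)$, $g\in L^2(\Gamma)$ there is a unique $S_k^-(f,g)$, and $\|S_k^-(f,g)\|_{1,t,k}\le C^-_{\mathrm{sol},k}(\|f\|_{0,\Omega}+k^{1/2}\|g\|_{0,\Gamma})$. (3) For each tubular neighborhood $T$ of $\Gamma$ there are $\gamma_0\ge0$, a nondecreasing $\vartheta:[\gamma_0,\infty)\to\mathbb R$ with $\vartheta(\gamma)\ge\gamma$, and $C^-_{\mathrm{ana},k}$ such that for all $\gamma\ge\gamma_0$, $f\in\mathcal A(M_f,\gamma,\mathscr P)$ and $g\in\mathcal A(M_g,\gamma,T,\Gamma)$ one has $S_k^-(f,g)\in\mathcal A(M_u,\vartheta(\gamma),\mathscr P)$ for some $M_u\le C^-_{\mathrm{ana},k}C^-_{\mathrm{sol},k}k^{-1}(M_f+kM_g)$. (4) There are linear splittings $T^-_{k,\Omega}=R^-_{k,\Omega}+A^-_{k,\Omega}$, $T^-_{k,\Gamma}=R^-_{k,\Gamma}+A^-_{k,\Gamma}$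 with $|(R^-_{k,\Omega}u,v)|+|\langle R^-_{k,\Gamma}u,v\rangle|\le C\|u\|_{1,t,k}\|v\|_{1,t,k}$, and there are $C^-_{A,k}$, $\gamma_A^-$ and a tubular neighborhood $T^-$ of $\Gamma$ such that for all $u\in H^{1,t}$: $A^-_{k,\Omega}u\in\mathcal A(M_u,\gamma_A^-,\mathscr P)$ and $A^-_{k,\Gamma}(u|_\Gamma)\in\mathcal A(M_v,\gamma_A^-,T^-,\Gamma)$ with $M_u,\,kM_v\le C^-_{A,k}\|u\|_{1,t,k}$. (5) $|a(u,v)|\le C\|u\|_{1,t,k}\|v\|_{1,t,k}$. **(AP)** (1) There are $C^+_{\mathrm{coer}}>0$ and $\sigma\in\mathbb C$, $|\sigma|=1$, with $\operatorname{Re}(\sigma b_k^+(u,u))\ge C^+_{\mathrm{coer}}\|u\|_{1,t,k}^2$ for all $u\in H^{1,t}$. (2) For each $0\le s\le s_{\max}$, $f\in H^s(\mathscr P)$, $g\in H^{s+1/2}(\Gamma)$: $\|S_k^+(f,g)\|_{s+2,\mathscr P}\le C^+_{\mathrm{shift},s}\,(k^s\|f\|_{0,\Omega}+\|f\|_{s,\mathscr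 P}+k^{s+1/2}\|g\|_{0,\Gamma}+\|g\|_{s+1/2,\Gamma})$. (3) With $T^\Delta:=T^--T^+$ there are linear splittings $T^\Delta_{k,\Omega}=R^\Delta_{k,\Omega}+A^\Delta_{k,\Omega}$, $T^\Delta_{k,\Gamma}=R^\Delta_{k,\Gamma}+A^\Delta_{k,\Gamma}$ such that for $0\le s\le s_{\max}$ $$\|R^\Delta_{k,\Omega}u\|_{s,\mathscr P}\le C_s(k^2\|u\|_{s,\mathscr P}+k\|u\|_{s+1,\mathscr P}),\qquad \|R^\Delta_{k,\Gamma}v\|_{s+1/2,\Gamma}\le C_s(k^{3/2}\|v\|_{s,\Gamma}+k\|v\|_{s+1/2,\Gamma})$$ for $u\in H^{1,t}\cap H^{s+1}(\mathscr P)$ and $v\in H^t(\Gamma)\cap H^{s+1/2}(\Gamma)$, and there are $C^\Delta_{A,k}$, $\gamma^\Delta_A$ and a tubular neighborhood $T^\Delta_*$ of $\Gamma$ for which $A^\Delta_{k,\Omega}$, $A^\Delta_{k,\Gamma}$ have the properties of $A^-_{k,\Omega}$, $A^-_{k,\Gamma}$ in (WP)(4). **(Symmetry)** $b_k^\pm(v,u)=b_k^\pm(\overline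 u,\overline v)$ for all $u,v\in H^{1,t}$. Let $T:=T^-\cap T^\Delta_*$, let $\gamma_0$ and $\vartheta$ be those of (WP)(3) for this $T$, and let $\gamma_A^-,\gamma_A^\Delta\ge\gamma_0$. For a subspace $V_h\subset H^{1,t}$ put $$\eta_F(m):=\sup\Big\{\inf_{v_h\in V_h}\|S_k^-(f,g)-v_h\|_{1,t,k}:\ \|f\|_{m-1,\mathscr P}+\|g\|_{m-1/2,\Gamma}=1\Big\},$$ $$\eta_A(\gamma):=\sup\Big\{\inf_{v_h\in V_h}\|S_k^-(f,g)-v_h\|_{1,t,k}:\ f\in\mathcal A(M_f,\gamma,\mathscr P),\ g\in\mathcal A(M_g,\gamma,T,\Gamma),\ M_f+kM_g=1\Big\}.$$ *Claim.* There are constants $\mu>0$ and $C>0$, independent of $k$, $V_h$, $s$, $f$, $g$, such that the following holds for every $k\ge k_0$ and every finite-dimensional subspace $V_h\subset H^{1,t}$ that is closed under complex conjugation. If $$k\,\eta_F(1)+C^\Delta_{A,k}\,\eta_A(\vartheta(\gamma_A^\Delta))\le\frac\mu2\qquad\text{and}\qquad C^-_{\mathrm{cont},k}\,C^-_{A,k}\,\eta_A(\vartheta(\gamma_A^-))\le1,$$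 then for all $s\in[0,s_{\max}]$, $f\in H^s(\mathscr P)$, $g\in H^{s+1/2}(\Gamma)$ there is a unique $u_h\in V_h$ with $$b_k^-(u_h,v_h)=(f,v_h)+\langle g,v_h\rangle\qquad\forall v_h\in V_h,$$ and $u:=S_k^-(f,g)$ satisfies $$\|u-u_h\|_{1,t,k}\le C\inf_{v_h\in V_h}\|u-v_h\|_{1,t,k}.$$ -/

import Mathlib

open MeasureTheory Filter Topology Set
open scoped ENNReal NNReal ContDiff

noncomputable section

namespace Helmholtz

/-! ### Geometry -/

/-- The ambient space `ℝ^d` with its Euclidean structure. -/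
abbrev E (d : ℕ) : Type := EuclideanSpace ℝ (Fin d)

variable {d : ℕ}

/-- A bounded open set whose boundary is, near each of its points and in suitable rotated
coordinates, the graph of a Lipschitz function with the set on one side of the graph.
The direction `e` is the vertical one; the height function `h` is only evaluated at the
horizontal part `y - ⟪e, y⟫ e` of a point. -/
structure IsLipschitzDomain (Ω : Set (E d)) : Prop where
  isOpen : IsOpen Ω
  isBounded : Bornology.IsBounded Ω
  graph : ∀ x ∈ frontier Ω, ∃ r : ℝ, 0 < r ∧ ∃ e : E d, ‖e‖ = 1 ∧
    ∃ (L : ℝ≥0) (h : E d → ℝ), LipschitzWith L h ∧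
      ∀ y ∈ Metric.ball x r, (y ∈ Ω ↔ h (y - inner ℝ e y • e) < inner ℝ e y)

/-- A partition of `Ω` into non-overlapping Lipschitz subdomains. -/
structure IsLipschitzPartition (Ω : Set (E d)) (Pc : Set (Set (E d))) : Prop where
  lipschitz : ∀ P ∈ Pc, IsLipschitzDomain P
  subset : ∀ P ∈ Pc, P ⊆ Ω
  disjoint : Pc.PairwiseDisjoint id
  cover : ⋃ P ∈ Pc, closure P = closure Ω

/-- Lebesgue measure on a set `U`. -/
abbrev vol (U : Set (E d)) : Measure (E d) := volume.restrict U

/-- Surface measure on the boundary of `Ω`. -/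
abbrev surf (Ω : Set (E d)) : Measure (E d) :=
  (Measure.euclideanHausdorffMeasure (d - 1) : Measure (E d)).restrict (frontier Ω)

/-- `L²(Ω)`, complex valued. -/
abbrev L2 (Ω : Set (E d)) : Type := Lp ℂ 2 (vol Ω)

/-- `L²(Γ)`, `Γ = ∂Ω`, complex valued. -/
abbrev L2Bdry (Ω : Set (E d)) : Type := Lp ℂ 2 (surf Ω)

/-- The tubular neighborhood of `Γ = ∂Ω` of width `δ`. -/
abbrev tube (Ω : Set (E d)) (δ : ℝ) : Set (E d) := Metric.thickening δ (frontier Ω)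

/-- The `i`-th coordinate vector. -/
abbrev basisVec (i : Fin d) : E d := EuclideanSpace.single i (1 : ℝ)

/-! ### Weak derivatives and Sobolev norms -/

/-- `w` is the weak derivative `∂_{α 0} ⋯ ∂_{α (n-1)} u` on the open set `U`. -/
def IsWeakDeriv (U : Set (E d)) {n : ℕ} (α : Fin n → Fin d) (u w : E d → ℂ) : Prop :=
  ∀ φ : E d → ℝ, ContDiff ℝ ∞ φ → HasCompactSupport φ → tsupport φ ⊆ U →
    ∫ x in U, (iteratedFDeriv ℝ n φ x fun j => basisVec (α j)) • u x
      = (-1 : ℂ) ^ n * ∫ x in U, φ x • w x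

/-- `w` is the family of all weak derivatives of `u` of order `n`, and they are in `L²(U)`. -/
def IsWeakJet (U : Set (E d)) (n : ℕ) (u : E d → ℂ) (w : (Fin n → Fin d) → E d → ℂ) : Prop :=
  ∀ α, MemLp (w α) 2 (vol U) ∧ IsWeakDeriv U α u (w α)

/-- `‖∇^n u‖_{0,U}`, and `∞` if some weak derivative of order `n` is not in `L²(U)`. The sum over
all words `α` of length `n` equals the sum over multi-indices with the weights `n! / α!`. -/
def gradNorm (U : Set (E d)) (n : ℕ) (u : E d → ℂ) : ℝ≥0∞ :=
  ⨅ (w : (Fin n → Fin d) → E d → ℂ) (_ : IsWeakJet U n u w),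
    (∑ α, eLpNorm (w α) 2 (vol U) ^ 2) ^ (1 / 2 : ℝ)

/-- The Sobolev–Slobodeckij seminorm of order `θ ∈ (0,1)` with respect to an `m`-dimensional
measure `ν`: the square root of `∬ |u x - u y|² / |x - y|^(m + 2 θ)`. -/
def slobodeckij (ν : Measure (E d)) (m θ : ℝ) (u : E d → ℂ) : ℝ≥0∞ :=
  eLpNorm (fun p : E d × E d => (‖p.1 - p.2‖ ^ (-(m / 2 + θ)) : ℝ) • (u p.1 - u p.2)) 2 (ν.prod ν)

/-- The Slobodeckij seminorm of order `θ` of the derivatives of order `n`. -/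
def gradSlobodeckij (U : Set (E d)) (n : ℕ) (θ : ℝ) (u : E d → ℂ) : ℝ≥0∞ :=
  ⨅ (w : (Fin n → Fin d) → E d → ℂ) (_ : IsWeakJet U n u w),
    (∑ α, slobodeckij (vol U) d θ (w α) ^ 2) ^ (1 / 2 : ℝ)

open Classical in
/-- The norm of `H^s(U)`, `s ≥ 0` real; it is `∞` outside `H^s(U)`. -/
def sobolevNorm (s : ℝ) (U : Set (E d)) (u : E d → ℂ) : ℝ≥0∞ :=
  (∑ j ∈ Finset.range (⌊s⌋₊ + 1), gradNorm U j u ^ 2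
    + if Int.fract s = 0 then 0 else gradSlobodeckij U ⌊s⌋₊ (Int.fract s) u ^ 2) ^ (1 / 2 : ℝ)

/-- The norm of the broken space `H^s(𝒫)`; it is `∞` outside `H^s(𝒫)`. -/
def brokenNorm (s : ℝ) (Pc : Set (Set (E d))) (u : E d → ℂ) : ℝ≥0∞ :=
  (∑' P : Pc, sobolevNorm s (P : Set (E d)) u ^ 2) ^ (1 / 2 : ℝ)

/-! ### Traces and Sobolev norms on the boundary -/

/-- Functions smooth on all of `ℝ^d` approximate `u` in `L²(U)`, its gradient `w` in `L²(U)`, and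
`g` in `L²(∂Ω)`. For `U = Ω` Lipschitz this says that `u ∈ H¹(Ω)` has the trace `g`. -/
def IsTraceWith (Ω U : Set (E d)) (u : E d → ℂ) (w : Fin d → E d → ℂ) (g : E d → ℂ) : Prop :=
  ∃ φ : ℕ → E d → ℂ, (∀ n, ContDiff ℝ ∞ (φ n)) ∧
    Tendsto (fun n => eLpNorm (φ n - u) 2 (vol U)) atTop (𝓝 0) ∧
    (∀ i, Tendsto (fun n => eLpNorm (fun x => fderiv ℝ (φ n) x (basisVec i) - w i x) 2 (vol U))
      atTop (𝓝 0)) ∧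
    Tendsto (fun n => eLpNorm (φ n - g) 2 (surf Ω)) atTop (𝓝 0)

/-- `g` is the (interior) trace on `∂Ω` of the function `u`, which is `H¹` on `U`. -/
def IsTrace (Ω U : Set (E d)) (u g : E d → ℂ) : Prop :=
  MemLp u 2 (vol U) ∧
    ∃ w : Fin d → E d → ℂ, (∀ i, MemLp (w i) 2 (vol U)) ∧ IsTraceWith Ω U u w g

/-- The tangential partial derivative of `φ` at a point `x` of `Γ = ∂Ω`: the `i`-th component of
the orthogonal projection of the gradient onto the tangent space of `Γ` at `x`. -/
def tangDeriv (Ω : Set (E d)) (φ : E d → ℂ) (i : Fin d) (x : E d) : ℂ :=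
  fderiv ℝ φ x ((Submodule.span ℝ (tangentConeAt ℝ (frontier Ω) x)).starProjection (basisVec i))

/-- `w` is the weak tangential gradient of `g` on `Γ = ∂Ω`, through approximation by smooth
functions. (Measurability of the tangential derivatives is automatic for Lipschitz `Ω`.) -/
def IsTangGrad (Ω : Set (E d)) (g : E d → ℂ) (w : Fin d → E d → ℂ) : Prop :=
  (∀ i, MemLp (w i) 2 (surf Ω)) ∧
  ∃ φ : ℕ → E d → ℂ, (∀ n, ContDiff ℝ ∞ (φ n)) ∧
    (∀ n i, AEStronglyMeasurable (tangDeriv Ω (φ n) i) (surf Ω)) ∧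
    Tendsto (fun n => eLpNorm (φ n - g) 2 (surf Ω)) atTop (𝓝 0) ∧
    ∀ i, Tendsto (fun n => eLpNorm (tangDeriv Ω (φ n) i - w i) 2 (surf Ω)) atTop (𝓝 0)

open Classical in
/-- The seminorm `|g|_{t,Γ}` for `0 ≤ t ≤ 1`: the `L²(Γ)` norm for `t = 0`, the Slobodeckij
seminorm for `0 < t < 1`, the `L²(Γ)` norm of the tangential gradient for `t = 1`. -/
def bdrySeminorm (Ω : Set (E d)) (t : ℝ) (g : E d → ℂ) : ℝ≥0∞ :=
  if t = 0 then eLpNorm g 2 (surf Ω)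
  else if t < 1 then slobodeckij (surf Ω) ((d : ℝ) - 1) t g
  else ⨅ (w : Fin d → E d → ℂ) (_ : IsTangGrad Ω g w),
    (∑ i, eLpNorm (w i) 2 (surf Ω) ^ 2) ^ (1 / 2 : ℝ)

open Classical in
/-- The norm `‖g‖_{r,Γ}` of `H^r(Γ)`, `r ≥ 0` real; it is `∞` outside `H^r(Γ)`.
For `r ≥ 1/2` it is the quotient norm of the trace space of `H^{r+1/2}(Ω)`. -/
def bdryNorm (Ω : Set (E d)) (r : ℝ) (g : E d → ℂ) : ℝ≥0∞ :=
  if r = 0 then eLpNorm g 2 (surf Ω)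
  else if r < 1 / 2 then
    (eLpNorm g 2 (surf Ω) ^ 2 + bdrySeminorm Ω r g ^ 2) ^ (1 / 2 : ℝ)
  else ⨅ (u : E d → ℂ) (_ : IsTrace Ω Ω u g), sobolevNorm (r + 1 / 2) Ω u

/-! ### Analyticity classes -/

/-- `‖∇^n v‖_{0,U} ≤ M γ^n max(n,k)^n` for all `n`. -/
def AnaBound (k M γ : ℝ) (U : Set (E d)) (v : E d → ℂ) : Prop :=
  MemLp v 2 (vol U) ∧ ∀ n : ℕ, gradNorm U n v ≤ ENNReal.ofReal (M * γ ^ n * max (n : ℝ) k ^ n)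

/-- Piecewise analytic functions on `Ω`. -/
def AnaPiecewise (k M γ : ℝ) (Pc : Set (Set (E d))) (v : E d → ℂ) : Prop :=
  ∀ P ∈ Pc, AnaBound k M γ P v

/-- Traces on `Γ` of functions `V` analytic on the part inside `Ω` of the tube of width `δ`;
the trace depends on `V` near `Γ` only. -/
def AnaBdry (k M γ : ℝ) (Ω : Set (E d)) (δ : ℝ) (g : E d → ℂ) : Prop :=
  ∃ V : E d → ℂ, AnaBound k M γ (tube Ω δ ∩ Ω) V ∧
    ∃ ρ : ℝ, 0 < ρ ∧ IsTrace Ω (tube Ω ρ ∩ (tube Ω δ ∩ Ω)) V g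

/-! ### Helper facts: linearity of the above notions -/

lemma memLp_smul_test {U : Set (E d)} {ψ : E d → ℝ} (hψ : Continuous ψ)
    (hc : HasCompactSupport ψ) {u : E d → ℂ} (hu : MemLp u 2 (vol U)) :
    Integrable (fun x => ψ x • u x) (vol U) := by
  have h1 : MemLp ψ 2 (vol U) := (hψ.memLp_of_hasCompactSupport hc).restrict U
  have h2 : MemLp (ψ • u) 1 (vol U) := hu.smul h1
  exact memLp_one_iff_integrable.1 h2

lemma integrable_deriv_test {U : Set (E d)} {n : ℕ} (α : Fin n → Fin d) {φ : E d → ℝ}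
    (hφ : ContDiff ℝ ∞ φ) (hc : HasCompactSupport φ) {u : E d → ℂ} (hu : MemLp u 2 (vol U)) :
    Integrable (fun x => (iteratedFDeriv ℝ n φ x fun j => basisVec (α j)) • u x) (vol U) := by
  refine memLp_smul_test ?_ ?_ hu
  · have h := hφ.continuous_iteratedFDeriv (m := n) (by exact_mod_cast le_top)
    exact (ContinuousMultilinearMap.apply ℝ (fun _ : Fin n => E d) ℝ
      (fun j => basisVec (α j))).continuous.comp h
  · exact (hc.iteratedFDeriv (𝕜 := ℝ) n).comp_left
      (g := fun m : ContinuousMultilinearMap ℝ (fun _ : Fin n => E d) ℝ =>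
        m fun j => basisVec (α j)) rfl

lemma IsWeakDeriv.lin {U : Set (E d)} {n : ℕ} {α : Fin n → Fin d} {u v w z : E d → ℂ} (a : ℂ)
    (hu : MemLp u 2 (vol U)) (hv : MemLp v 2 (vol U)) (hw : MemLp w 2 (vol U))
    (hz : MemLp z 2 (vol U)) (h1 : IsWeakDeriv U α u w) (h2 : IsWeakDeriv U α v z)
    {u' w' : E d → ℂ} (hu' : u' =ᵐ[vol U] fun x => a * u x + v x)
    (hw' : w' =ᵐ[vol U] fun x => a * w x + z x) : IsWeakDeriv U α u' w' := by
  intro φ hφ hc hs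
  have key : ∀ (ψ : E d → ℝ) (p q p' : E d → ℂ), (p' =ᵐ[vol U] fun x => a * p x + q x) →
      Integrable (fun x => ψ x • p x) (vol U) → Integrable (fun x => ψ x • q x) (vol U) →
      ∫ x in U, ψ x • p' x = a * (∫ x in U, ψ x • p x) + ∫ x in U, ψ x • q x := by
    intro ψ p q p' hp hi hj
    rw [← integral_const_mul, ← integral_add (hi.const_mul a) hj]
    refine integral_congr_ae ?_
    filter_upwards [hp] with x hx
    simp only [hx, Complex.real_smul]
    ring
  rw [key _ u v u' hu' (integrable_deriv_test α hφ hc hu) (integrable_deriv_test α hφ hc hv),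
    key _ w z w' hw' (memLp_smul_test hφ.continuous hc hw) (memLp_smul_test hφ.continuous hc hz),
    h1 φ hφ hc hs, h2 φ hφ hc hs]
  ring

lemma IsWeakDeriv.conj {U : Set (E d)} {n : ℕ} {α : Fin n → Fin d} {u w : E d → ℂ}
    (h : IsWeakDeriv U α u w) {u' w' : E d → ℂ} (hu' : u' =ᵐ[vol U] fun x => star (u x))
    (hw' : w' =ᵐ[vol U] fun x => star (w x)) : IsWeakDeriv U α u' w' := by
  intro φ hφ hc hs
  have key : ∀ (ψ : E d → ℝ) (p p' : E d → ℂ), (p' =ᵐ[vol U] fun x => star (p x)) →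
      ∫ x in U, ψ x • p' x = star (∫ x in U, ψ x • p x) := by
    intro ψ p p' hp
    rw [Complex.star_def, ← integral_conj]
    refine integral_congr_ae ?_
    filter_upwards [hp] with x hx
    simp [hx]
  rw [key _ u u' hu', key _ w w' hw', h φ hφ hc hs]
  simp

lemma eLpNorm_star {α : Type*} [MeasurableSpace α] (μ : Measure α) (f f' : α → ℂ)
    (h : f' =ᵐ[μ] fun x => star (f x)) : eLpNorm f' 2 μ = eLpNorm f 2 μ := by
  refine eLpNorm_congr_norm_ae ?_
  filter_upwards [h] with x hx
  simp [hx]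

/-- `L²` limits respect linear combinations. -/
lemma tendsto_lin {α : Type*} [MeasurableSpace α] {μ : Measure α} (a : ℂ)
    {F G : ℕ → α → ℂ} {f g f' : α → ℂ} {H : ℕ → α → ℂ}
    (hF : ∀ n, AEStronglyMeasurable (F n) μ) (hG : ∀ n, AEStronglyMeasurable (G n) μ)
    (hf : AEStronglyMeasurable f μ) (hg : AEStronglyMeasurable g μ)
    (h1 : Tendsto (fun n => eLpNorm (F n - f) 2 μ) atTop (𝓝 0))
    (h2 : Tendsto (fun n => eLpNorm (G n - g) 2 μ) atTop (𝓝 0))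
    (hH : ∀ n, H n = fun x => a * F n x + G n x)
    (hf' : f' =ᵐ[μ] fun x => a * f x + g x) :
    Tendsto (fun n => eLpNorm (H n - f') 2 μ) atTop (𝓝 0) := by
  have h3 : Tendsto (fun n => ‖a‖ₑ * eLpNorm (F n - f) 2 μ + eLpNorm (G n - g) 2 μ) atTop
      (𝓝 0) := by
    simpa using (ENNReal.Tendsto.const_mul h1 (Or.inr enorm_ne_top)).add h2
  refine tendsto_of_tendsto_of_tendsto_of_le_of_le tendsto_const_nhds h3 (fun n => zero_le) ?_
  intro n
  have : eLpNorm (H n - f') 2 μ = eLpNorm (a • (F n - f) + (G n - g)) 2 μ := by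
    refine eLpNorm_congr_ae ?_
    filter_upwards [hf'] with x hx
    simp only [Pi.sub_apply, Pi.add_apply, Pi.smul_apply, hH, hx, smul_eq_mul]
    ring
  dsimp only
  rw [this]
  refine (eLpNorm_add_le (((hF n).sub hf).const_smul a) ((hG n).sub hg) (by norm_num)).trans ?_
  rw [eLpNorm_const_smul]

lemma tendsto_star {α : Type*} [MeasurableSpace α] {μ : Measure α}
    {F : ℕ → α → ℂ} {f f' : α → ℂ} {H : ℕ → α → ℂ}
    (h1 : Tendsto (fun n => eLpNorm (F n - f) 2 μ) atTop (𝓝 0))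
    (hH : ∀ n, H n = fun x => star (F n x)) (hf' : f' =ᵐ[μ] fun x => star (f x)) :
    Tendsto (fun n => eLpNorm (H n - f') 2 μ) atTop (𝓝 0) := by
  refine h1.congr fun n => (eLpNorm_star μ _ _ ?_).symm
  filter_upwards [hf'] with x hx
  simp [hH, hx]

lemma fderiv_lin {φ ψ : E d → ℂ} (hφ : ContDiff ℝ ∞ φ) (hψ : ContDiff ℝ ∞ ψ) (a : ℂ) (x v : E d) :
    fderiv ℝ (fun x => a * φ x + ψ x) x v = a * fderiv ℝ φ x v + fderiv ℝ ψ x v := by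
  have h1 : DifferentiableAt ℝ φ x := (hφ.differentiable (by simp)).differentiableAt
  have h2 : DifferentiableAt ℝ ψ x := (hψ.differentiable (by simp)).differentiableAt
  have h3 := ((h1.hasFDerivAt.const_mul a).add h2.hasFDerivAt).fderiv
  have h4 : (fun x => a * φ x + ψ x) = (fun x => a * φ x) + ψ := rfl
  rw [h4, h3]
  simp

lemma fderiv_star {φ : E d → ℂ} (hφ : ContDiff ℝ ∞ φ) (x v : E d) :
    fderiv ℝ (fun x => star (φ x)) x v = star (fderiv ℝ φ x v) := by
  have h1 : DifferentiableAt ℝ φ x := (hφ.differentiable (by simp)).differentiableAt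
  have h2 := (Complex.conjCLE.toContinuousLinearMap.hasFDerivAt.comp x h1.hasFDerivAt).fderiv
  have h3 : (fun x => star (φ x)) = Complex.conjCLE.toContinuousLinearMap ∘ φ := rfl
  rw [h3, h2]
  simp

lemma contDiff_star {φ : E d → ℂ} (hφ : ContDiff ℝ ∞ φ) :
    ContDiff ℝ ∞ (fun x => star (φ x)) :=
  Complex.conjCLE.contDiff.comp hφ

lemma IsTraceWith.lin {Ω U : Set (E d)} (a : ℂ) {u v u' g h g' : E d → ℂ} {w z w' : Fin d → E d → ℂ}
    (h1 : IsTraceWith Ω U u w g) (h2 : IsTraceWith Ω U v z h)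
    (mu : AEStronglyMeasurable u (vol U)) (mv : AEStronglyMeasurable v (vol U))
    (mw : ∀ i, AEStronglyMeasurable (w i) (vol U)) (mz : ∀ i, AEStronglyMeasurable (z i) (vol U))
    (mg : AEStronglyMeasurable g (surf Ω)) (mh : AEStronglyMeasurable h (surf Ω))
    (hu : u' =ᵐ[vol U] fun x => a * u x + v x)
    (hw : ∀ i, w' i =ᵐ[vol U] fun x => a * w i x + z i x)
    (hg : g' =ᵐ[surf Ω] fun x => a * g x + h x) : IsTraceWith Ω U u' w' g' := by
  obtain ⟨φ, sφ, a1, a2, a3⟩ := h1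
  obtain ⟨ψ, sψ, b1, b2, b3⟩ := h2
  have cd : ∀ {χ : E d → ℂ} (_ : ContDiff ℝ ∞ χ) (i : Fin d),
      Continuous fun x => fderiv ℝ χ x (basisVec i) := fun hχ i =>
    (hχ.continuous_fderiv (by simp)).clm_apply continuous_const
  refine ⟨fun n x => a * φ n x + ψ n x, fun n => (contDiff_const.mul (sφ n)).add (sψ n),
    tendsto_lin a (fun n => (sφ n).continuous.aestronglyMeasurable)
      (fun n => (sψ n).continuous.aestronglyMeasurable) mu mv a1 b1 (fun n => rfl) hu,
    fun i => ?_,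
    tendsto_lin a (fun n => (sφ n).continuous.aestronglyMeasurable)
      (fun n => (sψ n).continuous.aestronglyMeasurable) mg mh a3 b3 (fun n => rfl) hg⟩
  exact tendsto_lin a (F := fun n x => fderiv ℝ (φ n) x (basisVec i))
    (G := fun n x => fderiv ℝ (ψ n) x (basisVec i))
    (H := fun n x => fderiv ℝ (fun x => a * φ n x + ψ n x) x (basisVec i))
    (fun n => (cd (sφ n) i).aestronglyMeasurable)
    (fun n => (cd (sψ n) i).aestronglyMeasurable) (mw i) (mz i) (a2 i) (b2 i)
    (fun n => funext fun x => fderiv_lin (sφ n) (sψ n) a x _) (hw i)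

lemma IsTraceWith.conj {Ω U : Set (E d)} {u u' g g' : E d → ℂ} {w w' : Fin d → E d → ℂ}
    (h : IsTraceWith Ω U u w g) (hu : u' =ᵐ[vol U] fun x => star (u x))
    (hw : ∀ i, w' i =ᵐ[vol U] fun x => star (w i x))
    (hg : g' =ᵐ[surf Ω] fun x => star (g x)) : IsTraceWith Ω U u' w' g' := by
  obtain ⟨φ, sφ, a1, a2, a3⟩ := h
  refine ⟨fun n x => star (φ n x), fun n => contDiff_star (sφ n),
    tendsto_star a1 (fun n => rfl) hu, fun i => ?_, tendsto_star a3 (fun n => rfl) hg⟩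
  exact tendsto_star (F := fun n x => fderiv ℝ (φ n) x (basisVec i))
    (H := fun n x => fderiv ℝ (fun x => star (φ n x)) x (basisVec i)) (a2 i)
    (fun n => funext fun x => fderiv_star (sφ n) x _) (hw i)

lemma IsTangGrad.lin {Ω : Set (E d)} (a : ℂ) {g h g' : E d → ℂ} {w z : Fin d → E d → ℂ}
    (h1 : IsTangGrad Ω g w) (h2 : IsTangGrad Ω h z)
    (mg : AEStronglyMeasurable g (surf Ω)) (mh : AEStronglyMeasurable h (surf Ω))
    (hg : g' =ᵐ[surf Ω] fun x => a * g x + h x) :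
    IsTangGrad Ω g' (fun i x => a * w i x + z i x) := by
  obtain ⟨mw, φ, sφ, mφ, a1, a2⟩ := h1
  obtain ⟨mz, ψ, sψ, mψ, b1, b2⟩ := h2
  have e : ∀ n i, tangDeriv Ω (fun x => a * φ n x + ψ n x) i
      = fun x => a * tangDeriv Ω (φ n) i x + tangDeriv Ω (ψ n) i x := fun n i =>
    funext fun x => fderiv_lin (sφ n) (sψ n) a x _
  refine ⟨fun i => ((mw i).const_mul a).add (mz i), fun n x => a * φ n x + ψ n x,
    fun n => (contDiff_const.mul (sφ n)).add (sψ n), fun n i => ?_,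
    tendsto_lin a (fun n => (sφ n).continuous.aestronglyMeasurable)
      (fun n => (sψ n).continuous.aestronglyMeasurable) mg mh a1 b1 (fun n => rfl) hg,
    fun i => tendsto_lin a (fun n => mφ n i) (fun n => mψ n i) (mw i).1 (mz i).1 (a2 i) (b2 i)
      (fun n => e n i) ae_eq_rfl⟩
  rw [e]
  exact ((mφ n i).const_mul a).add (mψ n i)

lemma IsTangGrad.conj {Ω : Set (E d)} {g g' : E d → ℂ} {w : Fin d → E d → ℂ}
    (h : IsTangGrad Ω g w) (hg : g' =ᵐ[surf Ω] fun x => star (g x)) :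
    IsTangGrad Ω g' (fun i x => star (w i x)) := by
  obtain ⟨mw, φ, sφ, mφ, a1, a2⟩ := h
  have e : ∀ n i, tangDeriv Ω (fun x => star (φ n x)) i
      = fun x => star (tangDeriv Ω (φ n) i x) := fun n i =>
    funext fun x => fderiv_star (sφ n) x _
  refine ⟨fun i => (mw i).star, fun n x => star (φ n x), fun n => contDiff_star (sφ n),
    fun n i => ?_, tendsto_star a1 (fun n => rfl) hg,
    fun i => tendsto_star (a2 i) (fun n => e n i) ae_eq_rfl⟩
  rw [e]
  exact (mφ n i).star

lemma measurable_quotient {m θ : ℝ} {g : E d → ℂ} {ν : Measure (E d)}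
    (mg : AEStronglyMeasurable g ν) :
    AEStronglyMeasurable (fun p : E d × E d =>
      (‖p.1 - p.2‖ ^ (-(m / 2 + θ)) : ℝ) • (g p.1 - g p.2)) (ν.prod ν) := by
  have h1 : AEStronglyMeasurable (fun p : E d × E d => g p.1) (ν.prod ν) :=
    mg.comp_quasiMeasurePreserving Measure.quasiMeasurePreserving_fst
  have h2 : AEStronglyMeasurable (fun p : E d × E d => g p.2) (ν.prod ν) :=
    mg.comp_quasiMeasurePreserving Measure.quasiMeasurePreserving_snd
  have h3 : Measurable (fun p : E d × E d => (‖p.1 - p.2‖ ^ (-(m / 2 + θ)) : ℝ)) := by fun_prop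
  exact h3.aestronglyMeasurable.smul (h1.sub h2)

lemma slobodeckij_lin {ν : Measure (E d)} {m θ : ℝ} (a : ℂ) {g h g' : E d → ℂ}
    (mg : AEStronglyMeasurable g ν) (mh : AEStronglyMeasurable h ν)
    (hg : g' =ᵐ[ν] fun x => a * g x + h x)
    (f1 : slobodeckij ν m θ g < ⊤) (f2 : slobodeckij ν m θ h < ⊤) :
    slobodeckij ν m θ g' < ⊤ := by
  have e1 := (Measure.quasiMeasurePreserving_fst (μ := ν) (ν := ν)).ae_eq_comp hg
  have e2 := (Measure.quasiMeasurePreserving_snd (μ := ν) (ν := ν)).ae_eq_comp hg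
  have m1 : MemLp (fun p : E d × E d =>
      (‖p.1 - p.2‖ ^ (-(m / 2 + θ)) : ℝ) • (g p.1 - g p.2)) 2 (ν.prod ν) :=
    ⟨measurable_quotient mg, f1⟩
  have m2 : MemLp (fun p : E d × E d =>
      (‖p.1 - p.2‖ ^ (-(m / 2 + θ)) : ℝ) • (h p.1 - h p.2)) 2 (ν.prod ν) :=
    ⟨measurable_quotient mh, f2⟩
  refine lt_of_eq_of_lt (eLpNorm_congr_ae ?_) ((m1.const_mul a).add m2).2
  filter_upwards [e1, e2] with p h1 h2
  simp only [Function.comp] at h1 h2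
  simp only [h1, h2, Pi.add_apply, Complex.real_smul]
  ring

lemma slobodeckij_conj {ν : Measure (E d)} {m θ : ℝ} {g g' : E d → ℂ}
    (hg : g' =ᵐ[ν] fun x => star (g x)) : slobodeckij ν m θ g' = slobodeckij ν m θ g := by
  have e1 := (Measure.quasiMeasurePreserving_fst (μ := ν) (ν := ν)).ae_eq_comp hg
  have e2 := (Measure.quasiMeasurePreserving_snd (μ := ν) (ν := ν)).ae_eq_comp hg
  refine eLpNorm_star _ _ _ ?_
  filter_upwards [e1, e2] with p h1 h2
  simp only [Function.comp] at h1 h2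
  simp [h1, h2]

lemma sum_rpow_lt_top {ι : Type*} [Fintype ι] {F : ι → ℝ≥0∞} (h : ∀ i, F i < ⊤) :
    (∑ i, F i ^ 2) ^ (1 / 2 : ℝ) < ⊤ :=
  ENNReal.rpow_lt_top_of_nonneg (by norm_num)
    (ENNReal.sum_lt_top.2 fun i _ => ENNReal.pow_lt_top (h i)).ne

lemma bdrySeminorm_lin {Ω : Set (E d)} {t : ℝ} (a : ℂ) {g h g' : E d → ℂ}
    (mg : MemLp g 2 (surf Ω)) (mh : MemLp h 2 (surf Ω))
    (hg : g' =ᵐ[surf Ω] fun x => a * g x + h x)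
    (f1 : bdrySeminorm Ω t g < ⊤) (f2 : bdrySeminorm Ω t h < ⊤) :
    bdrySeminorm Ω t g' < ⊤ := by
  unfold bdrySeminorm at *
  split_ifs at * with h0 h1
  · rw [eLpNorm_congr_ae hg]
    exact ((mg.const_mul a).add mh).2
  · exact slobodeckij_lin a mg.1 mh.1 hg f1 f2
  · simp only [iInf_lt_iff] at f1 f2 ⊢
    obtain ⟨w, hw, -⟩ := f1
    obtain ⟨z, hz, -⟩ := f2
    have hwz := hw.lin a hz mg.1 mh.1 hg
    exact ⟨_, hwz, sum_rpow_lt_top fun i => (hwz.1 i).2⟩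

lemma bdrySeminorm_conj {Ω : Set (E d)} {t : ℝ} {g g' : E d → ℂ}
    (hg : g' =ᵐ[surf Ω] fun x => star (g x)) (f1 : bdrySeminorm Ω t g < ⊤) :
    bdrySeminorm Ω t g' < ⊤ := by
  unfold bdrySeminorm at *
  split_ifs at * with h0 h1
  · rwa [eLpNorm_star _ _ _ hg]
  · rwa [slobodeckij_conj hg]
  · simp only [iInf_lt_iff] at f1 ⊢
    obtain ⟨w, hw, -⟩ := f1
    have hw' := hw.conj hg
    exact ⟨_, hw', sum_rpow_lt_top fun i => (hw'.1 i).2⟩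

lemma bdrySeminorm_zero {Ω : Set (E d)} {t : ℝ} {g : E d → ℂ} (hg : g =ᵐ[surf Ω] 0) :
    bdrySeminorm Ω t g < ⊤ := by
  unfold bdrySeminorm
  split_ifs with h0 h1
  · simp [eLpNorm_congr_ae hg]
  · have e1 := (Measure.quasiMeasurePreserving_fst (μ := surf Ω) (ν := surf Ω)).ae_eq_comp hg
    have e2 := (Measure.quasiMeasurePreserving_snd (μ := surf Ω) (ν := surf Ω)).ae_eq_comp hg
    refine lt_of_eq_of_lt (eLpNorm_congr_ae (g := 0) ?_) (by simp)
    filter_upwards [e1, e2] with p h1 h2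
    simp only [Function.comp] at h1 h2
    simp [h1, h2]
  · simp only [iInf_lt_iff]
    have e : ∀ i, tangDeriv Ω (0 : E d → ℂ) i = 0 := fun i => funext fun x => by
      simp [tangDeriv]
    have hw : IsTangGrad Ω g (fun _ _ => 0) := by
      refine ⟨fun i => MemLp.zero, fun _ => 0, fun n => contDiff_const, fun n i => ?_, ?_,
        fun i => ?_⟩
      · rw [e]; exact aestronglyMeasurable_zero
      · have : ∀ n : ℕ, eLpNorm ((0 : E d → ℂ) - g) 2 (surf Ω) = 0 := fun n => by
          rw [eLpNorm_congr_ae (g := 0) (by filter_upwards [hg] with x hx; simp [hx])]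
          simp
        exact tendsto_const_nhds.congr fun n => (this n).symm
      · have h0 : ((0 : E d → ℂ) - fun _ => (0 : ℂ)) = 0 := by ext x; simp
        simp only [e, h0, eLpNorm_zero, tendsto_const_nhds]
    exact ⟨_, hw, sum_rpow_lt_top fun i => by simp⟩

/-! ### The energy space -/

/-- `H^t(Γ)`, `0 ≤ t ≤ 1`, as a subspace of `L²(Γ)`. -/
def HBdry (Ω : Set (E d)) (t : ℝ) : Submodule ℂ (L2Bdry Ω) where
  carrier := {g | bdrySeminorm Ω t g < ⊤}
  zero_mem' := bdrySeminorm_zero (Lp.coeFn_zero _ _ _)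
  add_mem' {g h} hg hh := bdrySeminorm_lin 1 (Lp.memLp g) (Lp.memLp h)
    (by filter_upwards [Lp.coeFn_add g h] with x hx; rw [hx, one_mul]; rfl) hg hh
  smul_mem' a g hg := bdrySeminorm_lin a (Lp.memLp g) (Lp.memLp 0)
    (by filter_upwards [Lp.coeFn_smul a g, Lp.coeFn_zero ℂ 2 (surf Ω)] with x hx h0
        rw [hx, h0, Pi.smul_apply, smul_eq_mul, Pi.zero_apply, add_zero]) hg (bdrySeminorm_zero (Lp.coeFn_zero _ _ _))

lemma isWeakDeriv_zero {U : Set (E d)} {n : ℕ} {α : Fin n → Fin d} {u w : E d → ℂ}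
    (hu : u =ᵐ[vol U] 0) (hw : w =ᵐ[vol U] 0) : IsWeakDeriv U α u w := by
  have h0 : IsWeakDeriv U α (fun _ => 0) (fun _ => 0) := fun φ _ _ _ => by simp
  refine h0.lin 0 (MemLp.zero) (MemLp.zero) (MemLp.zero) (MemLp.zero) h0 ?_ ?_
  · filter_upwards [hu] with x hx; simp [hx]
  · filter_upwards [hw] with x hx; simp [hx]

lemma isTraceWith_zero {Ω U : Set (E d)} {u g : E d → ℂ} {w : Fin d → E d → ℂ}
    (hu : u =ᵐ[vol U] 0) (hw : ∀ i, w i =ᵐ[vol U] 0) (hg : g =ᵐ[surf Ω] 0) :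
    IsTraceWith Ω U u w g := by
  have h0 : IsTraceWith Ω U (0 : E d → ℂ) (fun _ => 0) (0 : E d → ℂ) := by
    refine ⟨fun _ => 0, fun n => contDiff_const, ?_, fun i => ?_, ?_⟩ <;> simp
  refine h0.lin 0 h0 ?_ ?_ (fun i => ?_) (fun i => ?_) ?_ ?_ ?_ (fun i => ?_) ?_
  any_goals exact aestronglyMeasurable_zero
  · filter_upwards [hu] with x hx; simp [hx]
  · filter_upwards [hw i] with x hx; simp [hx]
  · filter_upwards [hg] with x hx; simp [hx]

/-- The energy space `H^{1,t}(Ω,Γ) = {u ∈ H¹(Ω) : u|_Γ ∈ H^t(Γ)}`. An element `u` is represented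
by the triple `(u, ∇u, u|_Γ)`; the last two components are determined by the first one. -/
def Energy (Ω : Set (E d)) (t : ℝ) : Submodule ℂ (L2 Ω × (Fin d → L2 Ω) × L2Bdry Ω) where
  carrier := {p | (∀ i, IsWeakDeriv Ω ![i] p.1 (p.2.1 i)) ∧
    IsTraceWith Ω Ω p.1 (fun i => p.2.1 i) p.2.2 ∧ p.2.2 ∈ HBdry Ω t}
  zero_mem' := by
    have h := Lp.coeFn_zero ℂ 2 (vol Ω)
    exact ⟨fun i => isWeakDeriv_zero h h,
      isTraceWith_zero h (fun i => h) (Lp.coeFn_zero ℂ 2 (surf Ω)), (HBdry Ω t).zero_mem⟩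
  add_mem' {p q} hp hq := by
    have h : ∀ f g : L2 Ω, ⇑(f + g) =ᵐ[vol Ω] fun x => (1 : ℂ) * f x + g x := fun f g => by
      filter_upwards [Lp.coeFn_add f g] with x hx; rw [hx, one_mul]; rfl
    have h' : ∀ f g : L2Bdry Ω, ⇑(f + g) =ᵐ[surf Ω] fun x => (1 : ℂ) * f x + g x := fun f g => by
      filter_upwards [Lp.coeFn_add f g] with x hx; rw [hx, one_mul]; rfl
    exact ⟨fun i => (hp.1 i).lin 1 (Lp.memLp _) (Lp.memLp _) (Lp.memLp _) (Lp.memLp _) (hq.1 i)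
        (h _ _) (h _ _),
      hp.2.1.lin 1 hq.2.1 (Lp.memLp _).1 (Lp.memLp _).1 (fun i => (Lp.memLp _).1)
        (fun i => (Lp.memLp _).1) (Lp.memLp _).1 (Lp.memLp _).1 (h _ _) (fun i => h _ _) (h' _ _),
      (HBdry Ω t).add_mem hp.2.2 hq.2.2⟩
  smul_mem' a p hp := by
    have h : ∀ f : L2 Ω, ⇑(a • f) =ᵐ[vol Ω] fun x => a * f x + (0 : E d → ℂ) x := fun f => by
      filter_upwards [Lp.coeFn_smul a f] with x hx; simp [hx]
    have h' : ∀ f : L2Bdry Ω, ⇑(a • f) =ᵐ[surf Ω] fun x => a * f x + (0 : E d → ℂ) x := fun f => by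
      filter_upwards [Lp.coeFn_smul a f] with x hx; simp [hx]
    refine ⟨fun i => (hp.1 i).lin a (Lp.memLp _) MemLp.zero (Lp.memLp _) MemLp.zero
        (isWeakDeriv_zero ae_eq_rfl ae_eq_rfl) (h _) (h _),
      hp.2.1.lin a (v := 0) (z := fun _ => 0) (h := 0)
        (isTraceWith_zero ae_eq_rfl (fun _ => ae_eq_rfl) ae_eq_rfl)
        (Lp.memLp _).1 aestronglyMeasurable_zero (fun i => (Lp.memLp _).1)
        (fun i => aestronglyMeasurable_zero) (Lp.memLp _).1 aestronglyMeasurable_zero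
        (h _) (fun i => h _) (h' _),
      (HBdry Ω t).smul_mem a hp.2.2⟩

variable {Ω : Set (E d)} {t : ℝ}

/-- The function `u ∈ L²(Ω)` itself. -/
def fn (u : Energy Ω t) : L2 Ω := u.1.1

/-- The partial derivatives of `u`. -/
def grad (u : Energy Ω t) (i : Fin d) : L2 Ω := u.1.2.1 i

/-- The trace `u ↦ u|_Γ`. -/
def tr : Energy Ω t →ₗ[ℂ] HBdry Ω t where
  toFun u := ⟨u.1.2.2, u.2.2.2⟩
  map_add' _ _ := rfl
  map_smul' _ _ := rfl

/-- The complex conjugate function `ū`. -/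
def conj (u : Energy Ω t) : Energy Ω t :=
  ⟨(star u.1.1, fun i => star (u.1.2.1 i), star u.1.2.2),
    fun i => (u.2.1 i).conj (Lp.coeFn_star _) (Lp.coeFn_star _),
    u.2.2.1.conj (Lp.coeFn_star _) (fun _ => Lp.coeFn_star _) (Lp.coeFn_star _),
    bdrySeminorm_conj (Lp.coeFn_star _) u.2.2.2⟩

/-- The norm `‖u‖_{1,t,k}`. -/
def energyNorm (k : ℝ) (u : Energy Ω t) : ℝ :=
  √(k ^ 2 * ‖fn u‖ ^ 2 + k ^ (1 - 2 * t) * (bdrySeminorm Ω t (tr u : L2Bdry Ω)).toReal ^ 2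
    + ∑ i, ‖grad u i‖ ^ 2)

/-! ### The two problems -/

/-- Linear operators from `V` to the antidual of `V`, equivalently sesquilinear forms
(antilinear in the second argument): `T u v` is the duality pairing `⟨T u, v⟩`. -/
abbrev AntidualOp (V : Type*) [AddCommGroup V] [Module ℂ V] : Type _ := V →ₗ[ℂ] V →ₗ⋆[ℂ] ℂ

/-- The functional `T u` on `H^{1,t}(Ω,Γ)` is represented by `f ∈ L²(Ω)`. -/
def RepVol (T : AntidualOp (Energy Ω t)) (u : Energy Ω t) (f : L2 Ω) : Prop :=
  ∀ v, T u v = inner ℂ (fn v) f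

/-- The functional `T g` on `H^t(Γ)` is represented by `h ∈ L²(Γ)`. -/
def RepBdry (T : AntidualOp (HBdry Ω t)) (g : HBdry Ω t) (h : L2Bdry Ω) : Prop :=
  ∀ v, T g v = inner ℂ (v : L2Bdry Ω) h

/-- The form `a` and the operators `T^∓` in the volume and on the boundary, as functions of the
wavenumber `k`. -/
structure Problem (Ω : Set (E d)) (t : ℝ) where
  a : ℝ → AntidualOp (Energy Ω t)
  TvolM : ℝ → AntidualOp (Energy Ω t)
  TbdryM : ℝ → AntidualOp (HBdry Ω t)
  TvolP : ℝ → AntidualOp (Energy Ω t)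
  TbdryP : ℝ → AntidualOp (HBdry Ω t)

namespace Problem

variable (p : Problem Ω t) (k : ℝ)

/-- The form `b_k^-` of the wave propagation problem. -/
def bM (u v : Energy Ω t) : ℂ := p.a k u v - p.TvolM k u v - p.TbdryM k (tr u) (tr v)

/-- The form `b_k^+` of the auxiliary problem. -/
def bP (u v : Energy Ω t) : ℂ := p.a k u v - p.TvolP k u v - p.TbdryP k (tr u) (tr v)

/-- `u = S_k^-(f,g)`. -/
def IsSolM (f : L2 Ω) (g : L2Bdry Ω) (u : Energy Ω t) : Prop :=
  ∀ v : Energy Ω t, p.bM k u v = inner ℂ (fn v) f + inner ℂ (tr v : L2Bdry Ω) g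

/-- `u = S_k^+(f,g)`. -/
def IsSolP (f : L2 Ω) (g : L2Bdry Ω) (u : Energy Ω t) : Prop :=
  ∀ v : Energy Ω t, p.bP k u v = inner ℂ (fn v) f + inner ℂ (tr v : L2Bdry Ω) g

/-- `u_h` is a Galerkin solution in `V_h`. -/
def IsGalerkin (Vh : Submodule ℂ (Energy Ω t)) (f : L2 Ω) (g : L2Bdry Ω)
    (uh : Energy Ω t) : Prop :=
  uh ∈ Vh ∧ ∀ v ∈ Vh, p.bM k uh v = inner ℂ (fn v) f + inner ℂ (tr v : L2Bdry Ω) g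

end Problem

/-- The named constants in the assumptions: functions of `k` where dependence on `k` is allowed.
The width `δ` stands for the tubular neighborhood of width `δ`. -/
structure Consts where
  /-- continuity of `b_k^-` -/
  cont : ℝ → ℝ
  /-- stability of the solution operator -/
  sol : ℝ → ℝ
  /-- analytic regularity, for each tubular neighborhood -/
  ana : ℝ → ℝ → ℝ
  /-- the analytic remainders `A_k^-` -/
  AM : ℝ → ℝ
  /-- the analytic remainders `A_k^Δ` -/
  AD : ℝ → ℝ
  /-- the lower bound `γ₀`, for each tubular neighborhood -/
  γ₀ : ℝ → ℝ
  /-- the shift `ϑ`, for each tubular neighborhood -/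
  shift : ℝ → ℝ → ℝ
  /-- `γ_A^-` -/
  γM : ℝ
  /-- `γ_A^Δ` -/
  γD : ℝ
  /-- the tubular neighborhood for `A_k^-` -/
  δM : ℝ
  /-- the tubular neighborhood for `A_k^Δ` -/
  δD : ℝ

/-- The assumptions on the wave propagation problem, for all wavenumbers `k ≥ k₀`. -/
structure WP (Pc : Set (Set (E d))) (k₀ : ℝ) (p : Problem Ω t) (c : Consts) : Prop where
  cont_nonneg : ∀ k, k₀ ≤ k → 0 ≤ c.cont k
  continuous : ∀ k, k₀ ≤ k → ∀ u v, ‖p.bM k u v‖ ≤ c.cont k * energyNorm k u * energyNorm k v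
  wellPosed : ∀ k, k₀ ≤ k → ∀ f g, ∃! u, p.IsSolM k f g u
  stable : ∀ k, k₀ ≤ k → ∀ f g u, p.IsSolM k f g u →
    energyNorm k u ≤ c.sol k * (‖f‖ + k ^ (1 / 2 : ℝ) * ‖g‖)
  γ₀_nonneg : ∀ δ, 0 < δ → 0 ≤ c.γ₀ δ
  shift_mono : ∀ δ, 0 < δ → MonotoneOn (c.shift δ) (Ici (c.γ₀ δ))
  le_shift : ∀ δ, 0 < δ → ∀ γ, c.γ₀ δ ≤ γ → γ ≤ c.shift δ γ
  analytic : ∀ δ, 0 < δ → ∀ k, k₀ ≤ k → ∀ γ, c.γ₀ δ ≤ γ →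
    ∀ (Mf Mg : ℝ) (f : L2 Ω) (g : L2Bdry Ω) (u : Energy Ω t), 0 ≤ Mf → 0 ≤ Mg →
      AnaPiecewise k Mf γ Pc f → AnaBdry k Mg γ Ω δ g → p.IsSolM k f g u →
      ∃ Mu : ℝ, 0 ≤ Mu ∧ Mu ≤ c.ana δ k * c.sol k * k⁻¹ * (Mf + k * Mg) ∧
        AnaPiecewise k Mu (c.shift δ γ) Pc (fn u)
  δM_pos : 0 < c.δM
  splitting : ∃ C : ℝ, ∀ k, k₀ ≤ k →
    ∃ (Rvol Avol : AntidualOp (Energy Ω t)) (Rbdry Abdry : AntidualOp (HBdry Ω t)),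
      p.TvolM k = Rvol + Avol ∧ p.TbdryM k = Rbdry + Abdry ∧
      (∀ u v, ‖Rvol u v‖ + ‖Rbdry (tr u) (tr v)‖ ≤ C * energyNorm k u * energyNorm k v) ∧
      ∀ u, ∃ (f : L2 Ω) (g : L2Bdry Ω) (Mu Mv : ℝ),
        RepVol Avol u f ∧ RepBdry Abdry (tr u) g ∧ 0 ≤ Mu ∧ 0 ≤ Mv ∧
        AnaPiecewise k Mu c.γM Pc f ∧ AnaBdry k Mv c.γM Ω c.δM g ∧
        Mu ≤ c.AM k * energyNorm k u ∧ k * Mv ≤ c.AM k * energyNorm k u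
  a_continuous : ∃ C : ℝ, ∀ k, k₀ ≤ k → ∀ u v, ‖p.a k u v‖ ≤ C * energyNorm k u * energyNorm k v

/-- The assumptions on the auxiliary problem, for all wavenumbers `k ≥ k₀`. -/
structure AP (Pc : Set (Set (E d))) (k₀ : ℝ) (p : Problem Ω t) (c : Consts) (smax : ℕ) :
    Prop where
  coercive : ∃ C : ℝ, 0 < C ∧ ∀ k, k₀ ≤ k → ∃ σ : ℂ, ‖σ‖ = 1 ∧
    ∀ u : Energy Ω t, C * energyNorm k u ^ 2 ≤ (σ * p.bP k u u).re
  shift : ∀ s : ℝ, 0 ≤ s → s ≤ smax → ∃ C : ℝ, 0 < C ∧ ∀ k, k₀ ≤ k →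
    ∀ (f : L2 Ω) (g : L2Bdry Ω) (u : Energy Ω t),
      brokenNorm s Pc f < ⊤ → bdryNorm Ω (s + 1 / 2) g < ⊤ → p.IsSolP k f g u →
      brokenNorm (s + 2) Pc (fn u) ≤ ENNReal.ofReal C *
        (ENNReal.ofReal (k ^ s * ‖f‖) + brokenNorm s Pc f
          + ENNReal.ofReal (k ^ (s + 1 / 2) * ‖g‖) + bdryNorm Ω (s + 1 / 2) g)
  δD_pos : 0 < c.δD
  splitting : ∃ C : ℝ → ℝ, ∀ k, k₀ ≤ k →
    ∃ (Rvol Avol : AntidualOp (Energy Ω t)) (Rbdry Abdry : AntidualOp (HBdry Ω t)),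
      p.TvolM k - p.TvolP k = Rvol + Avol ∧ p.TbdryM k - p.TbdryP k = Rbdry + Abdry ∧
      (∀ s : ℝ, 0 ≤ s → s ≤ smax → ∀ u : Energy Ω t, brokenNorm (s + 1) Pc (fn u) < ⊤ →
        ∃ f : L2 Ω, RepVol Rvol u f ∧
          brokenNorm s Pc f ≤ ENNReal.ofReal (C s) *
            (ENNReal.ofReal (k ^ 2) * brokenNorm s Pc (fn u)
              + ENNReal.ofReal k * brokenNorm (s + 1) Pc (fn u))) ∧
      (∀ s : ℝ, 0 ≤ s → s ≤ smax → ∀ v : HBdry Ω t,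
        bdryNorm Ω (s + 1 / 2) (v : L2Bdry Ω) < ⊤ →
        ∃ g : L2Bdry Ω, RepBdry Rbdry v g ∧
          bdryNorm Ω (s + 1 / 2) g ≤ ENNReal.ofReal (C s) *
            (ENNReal.ofReal (k ^ (3 / 2 : ℝ)) * bdryNorm Ω s (v : L2Bdry Ω)
              + ENNReal.ofReal k * bdryNorm Ω (s + 1 / 2) (v : L2Bdry Ω))) ∧
      ∀ u, ∃ (f : L2 Ω) (g : L2Bdry Ω) (Mu Mv : ℝ),
        RepVol Avol u f ∧ RepBdry Abdry (tr u) g ∧ 0 ≤ Mu ∧ 0 ≤ Mv ∧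
        AnaPiecewise k Mu c.γD Pc f ∧ AnaBdry k Mv c.γD Ω c.δD g ∧
        Mu ≤ c.AD k * energyNorm k u ∧ k * Mv ≤ c.AD k * energyNorm k u

/-- The symmetry of `b_k^-` and `b_k^+`. -/
def IsSymm (k₀ : ℝ) (p : Problem Ω t) : Prop :=
  ∀ k, k₀ ≤ k → ∀ u v : Energy Ω t,
    p.bM k v u = p.bM k (conj u) (conj v) ∧ p.bP k v u = p.bP k (conj u) (conj v)

/-! ### Approximation factors -/

/-- The distance `inf_{v_h ∈ V_h} ‖u - v_h‖_{1,t,k}`. -/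
def bestApprox (k : ℝ) (Vh : Submodule ℂ (Energy Ω t)) (u : Energy Ω t) : ℝ :=
  ⨅ v : Vh, energyNorm k (u - (v : Energy Ω t))

/-- The approximation factor `η_F(m)`, `m ≥ 1`. -/
def etaF (Pc : Set (Set (E d))) (p : Problem Ω t) (k : ℝ) (Vh : Submodule ℂ (Energy Ω t))
    (m : ℝ) : ℝ≥0∞ :=
  ⨆ (f : L2 Ω) (g : L2Bdry Ω) (u : Energy Ω t)
    (_ : brokenNorm (m - 1) Pc f + bdryNorm Ω (m - 1 / 2) g = 1) (_ : p.IsSolM k f g u),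
    ENNReal.ofReal (bestApprox k Vh u)

/-- The approximation factor `η_A(γ)` for the tubular neighborhood of width `δ`. -/
def etaA (Pc : Set (Set (E d))) (p : Problem Ω t) (k : ℝ) (Vh : Submodule ℂ (Energy Ω t))
    (δ γ : ℝ) : ℝ≥0∞ :=
  ⨆ (f : L2 Ω) (g : L2Bdry Ω) (u : Energy Ω t) (Mf : ℝ) (Mg : ℝ)
    (_ : 0 ≤ Mf ∧ 0 ≤ Mg ∧ Mf + k * Mg = 1)
    (_ : AnaPiecewise k Mf γ Pc f ∧ AnaBdry k Mg γ Ω δ g) (_ : p.IsSolM k f g u),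
    ENNReal.ofReal (bestApprox k Vh u)

end Helmholtz

end

noncomputable section

namespace Helmholtz

section

variable {d : ℕ}

/-! Let e = u - u_h and let w be the complex conjugate of e. Galerkin orthogonality says that b⁻(e,
v) = 0 for v in V_h; symmetry and the closure of V_h under conjugation turn this into b⁻(v, w) = 0
(`IsSymm.orthogonal`), so no separate dual problem is needed. Since b⁻(·, w) does not see V_h, any
bound |b⁻(x, w)| ≤ B‖x‖ improves to B times the distance of x from V_h (`norm_bM_le_bestApprox`).

This is used twice. The continuity constant of b⁻ may depend on k, but against w it can be replaced
by a uniform one (`WP.exists_bM_bound`): a and R⁻ are bounded uniformly, and A⁻x is analytic data,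
so its pairing with w equals b⁻(ψ, w) for ψ = S⁻(A⁻x), which orthogonality and the second smallness
condition bound by 2‖x‖‖w‖. Next, `quasiOptimality` writes b⁺(w, w) = b⁻(w, w) + b⁻(ψ₁, w) + b⁻(ψ₂,
w), where ψ₁ and ψ₂ solve the b⁻ problem with data R^Δ w and A^Δ w. Coercivity bounds the left side
below by a multiple of ‖w‖², and each term on the right is at most C‖w‖ times a distance from V_h.
For w that distance is at most the one of u; for ψ₁ and ψ₂ it is a multiple of ‖w‖ that the
approximation factors make small, and the first smallness condition absorbs it. Applied to zero
data, the estimate gives uniqueness of the Galerkin solution, hence existence in finite dimension.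

The remaining work makes the approximation factors applicable. They are suprema over normalized
data, so homogeneity is needed, together with the fact that data of size zero vanish
(`ofReal_bestApprox_le_etaF`, `ofReal_bestApprox_le_etaA`). Moreover the norms of R^Δ w must be
bounded by k‖w‖ (`exists_remainder_bound`). Both rest on a trace inequality √k ‖u‖_Γ ≤ C(k‖u‖ +
‖∇u‖) with C independent of k (`trace_ineq_weighted`), obtained by integrating along segments that
run from the boundary into Ω, and on the identification of the broken norms of orders 0 and 1 with
the global ones, which holds because Lipschitz boundaries are null sets. The energy norm enters
through homogeneity and conjugation invariance; its triangle inequality is never needed. -/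

/-! ### Lipschitz graphs -/

/-- The horizontal hyperplane orthogonal to `e`. -/
abbrev hplane (e : E d) : Submodule ℝ (E d) := (ℝ ∙ e)ᗮ

/-- The graph of the height function `h` over the hyperplane orthogonal to `e`. -/
def lipGraph (e : E d) (h : E d → ℝ) : Set (E d) :=
  {y | inner ℝ e y = h (y - inner ℝ e y • e)}

lemma inner_hplane (e : E d) (z : hplane e) : inner ℝ e (z : E d) = 0 :=
  Submodule.mem_orthogonal_singleton_iff_inner_right.1 z.2

lemma horizontal_mem {e : E d} (he : ‖e‖ = 1) (y : E d) : y - inner ℝ e y • e ∈ hplane e := by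
  rw [Submodule.mem_orthogonal_singleton_iff_inner_right, inner_sub_right, inner_smul_right,
    real_inner_self_eq_norm_sq, he]
  ring

lemma inner_add_smul_self {e : E d} (he : ‖e‖ = 1) (y : E d) (s : ℝ) :
    inner ℝ e (y + s • e) = inner ℝ e y + s := by
  rw [inner_add_right, inner_smul_right, real_inner_self_eq_norm_sq, he]
  ring

lemma horizontal_add_smul_self {e : E d} (he : ‖e‖ = 1) (y : E d) (s : ℝ) :
    y + s • e - inner ℝ e (y + s • e) • e = y - inner ℝ e y • e := by
  rw [inner_add_smul_self he, add_smul]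
  abel

/-- Fubini's theorem for the decomposition into a horizontal and a vertical part. -/
lemma lintegral_vertical {e : E d} (he : ‖e‖ = 1) {F : E d → ℝ≥0∞} (hF : Measurable F) :
    ∫⁻ z : hplane e, ∫⁻ s : ℝ, F (z + s • e) = ∫⁻ x, F x := by
  -- The orthogonal splitting along `e` preserves measure, and ‖e‖ = 1 makes s ↦ s • e an isometric
  -- parametrization of the line.
  have h1 := ((ℝ ∙ e).measurePreserving_measurableEquivProd (0 : E d)).symm
  rw [InnerProductSpace.euclideanHausdorffMeasure_eq_volume] at h1
  have h2 := (LinearIsometryEquiv.toSpanUnitSingleton e he).measurePreserving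
  have h3 := h1.comp (h2.prod (MeasurePreserving.id (volume : Measure (hplane e))))
  rw [← h3.lintegral_comp hF, lintegral_prod_symm]
  · refine lintegral_congr fun z => lintegral_congr fun s => ?_
    congr 1
    simp [add_comm]
  · exact (hF.comp h3.measurable).aemeasurable

lemma finrank_hplane {e : E d} (he : ‖e‖ = 1) : Module.finrank ℝ (hplane e) = d - 1 := by
  have h0 : e ≠ 0 := by rintro rfl; simp at he
  have := (ℝ ∙ e).finrank_add_finrank_orthogonal
  rw [finrank_span_singleton h0, finrank_euclideanSpace_fin] at this
  change 1 + Module.finrank ℝ (hplane e) = d at this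
  omega

/-- The surface measure of a Lipschitz graph is bounded by the Lebesgue measure of its
projection. -/
lemma restrict_lipGraph_le {e : E d} (he : ‖e‖ = 1) {L : ℝ≥0} {h : E d → ℝ}
    (hh : LipschitzWith L h) :
    ∃ C : ℝ≥0, (Measure.euclideanHausdorffMeasure (d - 1) : Measure (E d)).restrict (lipGraph e h)
      ≤ C • (volume : Measure (hplane e)).map (fun z : hplane e => (z : E d) + h z • e) := by
  have hlip : LipschitzWith (1 + L) (fun z : hplane e => (z : E d) + h z • e) := by
    refine LipschitzWith.add (isometry_subtype_coe.lipschitz) ?_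
    refine LipschitzWith.of_dist_le_mul fun x y => ?_
    rw [dist_eq_norm, ← sub_smul, norm_smul, he, mul_one, ← dist_eq_norm]
    exact hh.dist_le_mul _ _
  -- The graph map is (1 + L)-Lipschitz, and the (d - 1)-dimensional Hausdorff measure scales with
  -- the power d - 1.
  refine ⟨(1 + L) ^ (d - 1), Measure.le_iff.2 fun A hA => ?_⟩
  set Φ := (fun z : hplane e => (z : E d) + h z • e) with hΦ
  have hsub : A ∩ lipGraph e h ⊆ Φ '' (Φ ⁻¹' A) := by
    rintro y ⟨hyA, hy⟩
    have : Φ ⟨_, horizontal_mem he y⟩ = y := by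
      simp only [hΦ]
      rw [← show inner ℝ e y = h (y - inner ℝ e y • e) from hy]
      abel
    exact ⟨⟨_, horizontal_mem he y⟩, by simpa [this] using hyA, this⟩
  have hm : Measurable Φ := hlip.continuous.measurable
  rw [Measure.restrict_apply hA, Measure.smul_apply, Measure.map_apply hm hA]
  refine (measure_mono hsub).trans ?_
  have h1 := hlip.hausdorffMeasure_image_le (d := ((d - 1 : ℕ) : ℝ)) (by positivity) (Φ ⁻¹' A)
  -- With both sides in the same normalization of the Hausdorff measure, the normalizing factor is
  -- common to them.
  have h2 : (volume : Measure (hplane e)) = Measure.euclideanHausdorffMeasure (d - 1) := by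
    rw [← finrank_hplane he, InnerProductSpace.euclideanHausdorffMeasure_eq_volume]
  rw [h2, Measure.euclideanHausdorffMeasure_def, Measure.euclideanHausdorffMeasure_def,
    Measure.smul_apply, Measure.smul_apply]
  rw [ENNReal.rpow_natCast] at h1
  simp only [ENNReal.smul_def, smul_eq_mul]
  calc _ ≤ _ := mul_le_mul_right h1 _
    _ = _ := by push_cast; ring

/-- Every vertical line meets the graph in a single point, so Fubini applies. -/
lemma volume_lipGraph {e : E d} (he : ‖e‖ = 1) {h : E d → ℝ} (hh : Continuous h) :
    volume (lipGraph e h) = 0 := by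
  have hm : MeasurableSet (lipGraph e h) :=
    (isClosed_eq (by fun_prop) (by fun_prop)).measurableSet
  rw [← lintegral_indicator_one hm, ← lintegral_vertical he (measurable_one.indicator hm)]
  refine (lintegral_eq_zero_iff' ?_).2 ?_ |>.trans rfl
  · have : Measurable fun q : hplane e × ℝ =>
        (lipGraph e h).indicator (1 : E d → ℝ≥0∞) (q.1 + q.2 • e) :=
      (measurable_one.indicator hm).comp (by fun_prop)
    exact this.lintegral_prod_right'.aemeasurable
  refine Filter.Eventually.of_forall fun z => ?_
  refine (lintegral_eq_zero_iff ((measurable_one.indicator hm).comp (by fun_prop))).2 ?_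
  have : ∀ᵐ s : ℝ, s ≠ h z := by simp [ae_iff]
  filter_upwards [this] with s hs
  refine indicator_of_notMem (fun hmem => hs ?_) _
  have h1 := horizontal_add_smul_self he (z : E d) s
  have h2 := inner_add_smul_self he (z : E d) s
  simp only [lipGraph, mem_ofPred_eq] at hmem
  rw [h1, h2, inner_hplane] at hmem
  simpa using hmem

/-- Integrals over segments issuing from a Lipschitz graph are bounded by volume integrals. -/
lemma lintegral_lipGraph_segment_le {e : E d} (he : ‖e‖ = 1) {L : ℝ≥0} {h : E d → ℝ}
    (hh : LipschitzWith L h) :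
    ∃ C : ℝ≥0, ∀ F : E d → ℝ≥0∞, Measurable F →
      ∫⁻ y in lipGraph e h, (∫⁻ s : ℝ, F (y + s • e)) ∂(Measure.euclideanHausdorffMeasure (d - 1))
        ≤ C * ∫⁻ x, F x := by
  obtain ⟨C, hC⟩ := restrict_lipGraph_le he hh
  have hhc := hh.continuous
  refine ⟨C, fun F hF => ?_⟩
  have hK : Measurable fun y : E d => ∫⁻ s : ℝ, F (y + s • e) := by
    have : Measurable fun q : E d × ℝ => F (q.1 + q.2 • e) := hF.comp (by fun_prop)
    exact this.lintegral_prod_right'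
  refine (lintegral_mono' hC le_rfl).trans ?_
  rw [lintegral_smul_measure, lintegral_map hK (by fun_prop), ← lintegral_vertical he hF]
  refine le_of_eq ?_
  rw [ENNReal.smul_def, smul_eq_mul]
  congr 1
  refine lintegral_congr fun z => ?_
  simp_rw [add_assoc, ← add_smul]
  -- The segment starts at height `h z`; the integral over the whole line does not see this shift.
  exact lintegral_add_left_eq_self (fun s : ℝ => F (z + s • e)) (h z)

/-! ### The boundary of a Lipschitz domain -/

/-- A frontier point is not in the open set, hence not above the graph. Nor is it strictly below:
that condition is open and excludes nearby points of `U`, whereas the point lies in the closure of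
`U`. -/
lemma frontier_subset_lipGraph {U : Set (E d)} (hU : IsOpen U) {x : E d} {r : ℝ} {e : E d}
    {h : E d → ℝ} (hh : Continuous h)
    (hgr : ∀ y ∈ Metric.ball x r, (y ∈ U ↔ h (y - inner ℝ e y • e) < inner ℝ e y)) :
    frontier U ∩ Metric.ball x r ⊆ lipGraph e h := by
  rintro y ⟨hyf, hyb⟩
  have hyU : y ∉ U := fun hy => by
    rw [hU.frontier_eq] at hyf
    exact hyf.2 hy
  have h1 : inner ℝ e y ≤ h (y - inner ℝ e y • e) := not_lt.1 fun hlt => hyU ((hgr y hyb).2 hlt)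
  refine le_antisymm h1 (not_lt.1 fun hlt => ?_)
  have hopen : IsOpen {z : E d | inner ℝ e z < h (z - inner ℝ e z • e)} :=
    isOpen_lt (by fun_prop) (by fun_prop)
  obtain ⟨z, ⟨hz1, hz2⟩, hzU⟩ := mem_closure_iff.1 (frontier_subset_closure hyf) _
    (hopen.inter Metric.isOpen_ball) ⟨hlt, hyb⟩
  exact absurd ((hgr z hz2).1 hzU) (not_lt.2 (le_of_lt hz1))

lemma IsLipschitzDomain.isCompact_frontier {U : Set (E d)} (hU : IsLipschitzDomain U) :
    IsCompact (frontier U) :=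
  hU.isBounded.isCompact_closure.of_isClosed_subset isClosed_frontier frontier_subset_closure

lemma IsLipschitzDomain.volume_frontier {U : Set (E d)} (hU : IsLipschitzDomain U) :
    volume (frontier U) = 0 := by
  refine hU.isCompact_frontier.measure_zero_of_nhdsWithin fun x hx => ?_
  obtain ⟨r, hr, e, he, L, h, hh, hgr⟩ := hU.graph x hx
  refine ⟨frontier U ∩ Metric.ball x r,
    inter_mem_nhdsWithin _ (Metric.ball_mem_nhds x hr), ?_⟩
  exact measure_mono_null (frontier_subset_lipGraph hU.isOpen hh.continuous hgr)
    (volume_lipGraph he hh.continuous)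

/-- Disjoint nonempty open sets in a separable space are countably many; the empty set may also be a
member, which costs one more element. -/
lemma IsLipschitzPartition.countable {Ω : Set (E d)} {Pc : Set (Set (E d))}
    (hPc : IsLipschitzPartition Ω Pc) : Pc.Countable := by
  have hc : {P ∈ Pc | P.Nonempty}.Countable :=
    PairwiseDisjoint.countable_of_isOpen (s := id) (hPc.disjoint.subset (sep_subset _ _))
      (fun P hP => (hPc.lipschitz P hP.1).isOpen) (fun P hP => hP.2)
  refine (hc.insert ∅).mono fun P hP => ?_
  rcases P.eq_empty_or_nonempty with h | h
  · exact Or.inl h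
  · exact Or.inr ⟨hP, h⟩

/-- The closures of the pieces cover, so a point of `Ω` in no piece lies on the frontier of one, and
there are countably many null frontiers. -/
lemma IsLipschitzPartition.volume_diff {Ω : Set (E d)} {Pc : Set (Set (E d))}
    (hPc : IsLipschitzPartition Ω Pc) : volume (Ω \ ⋃ P ∈ Pc, P) = 0 := by
  have hsub : Ω \ ⋃ P ∈ Pc, P ⊆ ⋃ P ∈ Pc, frontier P := by
    rintro x ⟨hx, hxP⟩
    have : x ∈ ⋃ P ∈ Pc, closure P := hPc.cover ▸ subset_closure hx
    simp only [mem_iUnion, exists_prop, not_exists, not_and] at this hxP ⊢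
    obtain ⟨P, hP, hxc⟩ := this
    refine ⟨P, hP, ?_⟩
    rw [(hPc.lipschitz P hP).isOpen.frontier_eq]
    exact ⟨hxc, hxP P hP⟩
  exact measure_mono_null hsub
    ((measure_biUnion_null_iff hPc.countable).2 fun P hP => (hPc.lipschitz P hP).volume_frontier)

end

section

variable {d : ℕ}

/-! ### The multiplicative trace inequality -/

lemma add_sq_le_two_mul (a b : ℝ≥0∞) : (a + b) ^ 2 ≤ 2 * a ^ 2 + 2 * b ^ 2 := by
  have h := ENNReal.rpow_add_le_mul_rpow_add_rpow a b (p := 2) (by norm_num)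
  have h2 : (2 : ℝ≥0∞) ^ ((2 : ℝ) - 1) = 2 := by norm_num
  rw [h2] at h
  simpa [mul_add, ENNReal.rpow_two] using h

lemma lintegral_sq_le {α : Type*} [MeasurableSpace α] {μ : Measure α} {f : α → ℝ≥0∞}
    (hf : AEMeasurable f μ) : (∫⁻ x, f x ∂μ) ^ 2 ≤ μ univ * ∫⁻ x, f x ^ 2 ∂μ := by
  have h := ENNReal.lintegral_mul_le_Lp_mul_Lq μ Real.HolderConjugate.two_two hf
    (aemeasurable_const (b := (1 : ℝ≥0∞)))
  simp only [Pi.mul_apply, mul_one, ENNReal.one_rpow, lintegral_const, one_mul] at h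
  calc (∫⁻ x, f x ∂μ) ^ 2 ≤ _ := pow_le_pow_left' h 2
    _ = _ := by
      rw [mul_pow, ← ENNReal.rpow_two, ← ENNReal.rpow_two, ← ENNReal.rpow_mul,
        ← ENNReal.rpow_mul]
      simp [mul_comm]

/-- The fundamental theorem of calculus bounds |ψ(0)| by |ψ(s)| plus the integral of |ψ'|. Squaring,
applying Cauchy–Schwarz, and integrating over s in (0, τ] gives the claim; the free length τ is
later tuned to the wavenumber. -/
lemma enorm_sq_le_segment {ψ : ℝ → ℂ} (hψ : ContDiff ℝ 1 ψ) {τ : ℝ} (hτ : 0 < τ) :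
    ENNReal.ofReal τ * ‖ψ 0‖ₑ ^ 2 ≤
      2 * ∫⁻ s in Ioc 0 τ, (‖ψ s‖ₑ ^ 2 + ENNReal.ofReal (τ ^ 2) * ‖deriv ψ s‖ₑ ^ 2) := by
  have hd : Continuous (deriv ψ) := hψ.continuous_deriv le_rfl
  have hvol : volume (Ioc 0 τ) = ENNReal.ofReal τ := by simp
  set J := ∫⁻ s in Ioc 0 τ, ‖deriv ψ s‖ₑ ^ 2 with hJ
  set I := ∫⁻ s in Ioc 0 τ, ‖deriv ψ s‖ₑ with hI
  have hIJ : I ^ 2 ≤ ENNReal.ofReal τ * J := by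
    have := lintegral_sq_le (μ := volume.restrict (Ioc 0 τ)) (f := fun s => ‖deriv ψ s‖ₑ)
      hd.enorm.measurable.aemeasurable
    simpa [hvol] using this
  have hpt : ∀ s ∈ Ioc 0 τ, ‖ψ 0‖ₑ ^ 2 ≤ 2 * ‖ψ s‖ₑ ^ 2 + 2 * (ENNReal.ofReal τ * J) := by
    intro s hs
    have hftc : ∫ r in (0)..s, deriv ψ r = ψ s - ψ 0 :=
      intervalIntegral.integral_deriv_eq_sub
        (fun r _ => (hψ.differentiable (by norm_num)).differentiableAt)
        (hd.intervalIntegrable _ _)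
    have h1 : ‖ψ s - ψ 0‖ₑ ≤ I := by
      rw [← hftc, intervalIntegral.integral_of_le hs.1.le]
      exact (enorm_integral_le_lintegral_enorm _).trans
        (lintegral_mono_set (Ioc_subset_Ioc_right hs.2))
    have h2 : ‖ψ 0‖ₑ ≤ ‖ψ s‖ₑ + I := by
      calc ‖ψ 0‖ₑ = ‖ψ s - (ψ s - ψ 0)‖ₑ := by congr 1; ring
        _ ≤ ‖ψ s‖ₑ + ‖ψ s - ψ 0‖ₑ := enorm_sub_le
        _ ≤ _ := by gcongr
    calc ‖ψ 0‖ₑ ^ 2 ≤ (‖ψ s‖ₑ + I) ^ 2 := by gcongr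
      _ ≤ 2 * ‖ψ s‖ₑ ^ 2 + 2 * I ^ 2 := add_sq_le_two_mul _ _
      _ ≤ _ := by gcongr
  have hm : Measurable fun s => ‖ψ s‖ₑ ^ 2 := hψ.continuous.enorm.measurable.pow_const 2
  calc ENNReal.ofReal τ * ‖ψ 0‖ₑ ^ 2 = ∫⁻ s in Ioc 0 τ, ‖ψ 0‖ₑ ^ 2 := by
        rw [setLIntegral_const, hvol, mul_comm]
    _ ≤ ∫⁻ s in Ioc 0 τ, (2 * ‖ψ s‖ₑ ^ 2 + 2 * (ENNReal.ofReal τ * J)) :=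
        setLIntegral_mono' measurableSet_Ioc hpt
    _ = 2 * (∫⁻ s in Ioc 0 τ, ‖ψ s‖ₑ ^ 2) + 2 * (ENNReal.ofReal (τ ^ 2) * J) := by
        rw [lintegral_add_left (hm.const_mul 2), lintegral_const_mul _ hm, setLIntegral_const,
          hvol, pow_two τ, ENNReal.ofReal_mul hτ.le]
        ring
    _ = _ := by
        rw [lintegral_add_left hm, lintegral_const_mul _ (hd.enorm.measurable.pow_const 2),
          mul_add]

/-- Short segments in the direction `e` from boundary points near `x` stay in `Ω` and in the tube.
The one-dimensional estimate holds on each of them, and integration over the graph turns the segment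
integrals into a volume integral. -/
lemma trace_ineq_local {Ω : Set (E d)} (hΩ : IsLipschitzDomain Ω) {ρ : ℝ} (hρ : 0 < ρ)
    {x : E d} (hx : x ∈ frontier Ω) :
    ∃ S ∈ 𝓝[frontier Ω] x, ∃ C : ℝ≥0, ∃ τ₀ : ℝ, 0 < τ₀ ∧ ∀ τ, 0 < τ → τ ≤ τ₀ →
      ∀ φ : E d → ℂ, ContDiff ℝ ∞ φ →
        ENNReal.ofReal τ * ∫⁻ y in S, ‖φ y‖ₑ ^ 2 ∂(surf Ω) ≤
          C * ∫⁻ y in tube Ω ρ ∩ Ω,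
            (‖φ y‖ₑ ^ 2 + ENNReal.ofReal (τ ^ 2) * ‖fderiv ℝ φ y‖ₑ ^ 2) := by
  obtain ⟨r, hr, e, he, L, h, hh, hgr⟩ := hΩ.graph x hx
  obtain ⟨C, hC⟩ := lintegral_lipGraph_segment_le he hh
  -- Since r / 2 + r / 3 < r, the segments stay in the ball where the graph describes `Ω`; since ρ /
  -- 2 < ρ, they stay in the tube.
  refine ⟨Metric.ball x (r / 2), mem_nhdsWithin_of_mem_nhds (Metric.ball_mem_nhds x (by positivity)),
    2 * C, min (r / 3) (ρ / 2), by positivity, fun τ hτ hτ₀ φ hφ => ?_⟩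
  set D := tube Ω ρ ∩ Ω with hD
  have hDm : MeasurableSet D := (Metric.isOpen_thickening.inter hΩ.isOpen).measurableSet
  set G : E d → ℝ≥0∞ := fun y => ‖φ y‖ₑ ^ 2 + ENNReal.ofReal (τ ^ 2) * ‖fderiv ℝ φ y‖ₑ ^ 2 with hG
  have hGm : Measurable G := by
    have h1 := hφ.continuous.enorm.measurable
    have h2 := (hφ.continuous_fderiv (by simp)).enorm.measurable
    exact (h1.pow_const 2).add ((h2.pow_const 2).const_mul _)
  have hset : Metric.ball x (r / 2) ∩ frontier Ω ⊆ lipGraph e h := fun y hy =>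
    frontier_subset_lipGraph hΩ.isOpen hh.continuous hgr
      ⟨hy.2, Metric.ball_subset_ball (by linarith) hy.1⟩
  have hmem : ∀ y ∈ Metric.ball x (r / 2) ∩ frontier Ω, ∀ s ∈ Ioc 0 τ, y + s • e ∈ D := by
    intro y hy s hs
    have hsr : s ≤ r / 3 := hs.2.trans (hτ₀.trans (min_le_left _ _))
    have hsρ : s ≤ ρ / 2 := hs.2.trans (hτ₀.trans (min_le_right _ _))
    have hdist : dist (y + s • e) y = s := by
      rw [dist_eq_norm, add_sub_cancel_left, norm_smul, he, mul_one, Real.norm_of_nonneg hs.1.le]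
    refine ⟨Metric.mem_thickening_iff.2 ⟨y, hy.2, by rw [hdist]; linarith⟩, ?_⟩
    have hball : y + s • e ∈ Metric.ball x r := by
      have h1 := hy.1
      rw [Metric.mem_ball] at h1 ⊢
      have := dist_triangle (y + s • e) y x
      linarith
    rw [hgr _ hball, horizontal_add_smul_self he, inner_add_smul_self he]
    have h2 : inner ℝ e y = h (y - inner ℝ e y • e) := hset hy
    linarith [hs.1]
  have hpt : ∀ y ∈ Metric.ball x (r / 2) ∩ frontier Ω,
      ENNReal.ofReal τ * ‖φ y‖ₑ ^ 2 ≤ 2 * ∫⁻ s : ℝ, D.indicator G (y + s • e) := by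
    intro y hy
    have hline : ContDiff ℝ 1 fun s : ℝ => y + s • e := by fun_prop
    have hψ : ContDiff ℝ 1 fun s : ℝ => φ (y + s • e) := (hφ.of_le (by simp)).comp hline
    have hderiv : ∀ s : ℝ, deriv (fun s : ℝ => φ (y + s • e)) s = fderiv ℝ φ (y + s • e) e := by
      intro s
      have h1 : HasDerivAt (fun s : ℝ => y + s • e) e s := by
        simpa using ((hasDerivAt_id s).smul_const e).const_add y
      exact (((hφ.differentiable (by simp)).differentiableAt).hasFDerivAt.comp_hasDerivAt s h1).deriv
    have h1 := enorm_sq_le_segment hψ hτ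
    simp only [zero_smul, add_zero] at h1
    refine h1.trans (mul_le_mul_right ?_ 2)
    -- Extending by the indicator of `D` to the whole line removes the dependence on τ from the
    -- domain of integration and prepares for Fubini.
    rw [← lintegral_indicator measurableSet_Ioc]
    refine lintegral_mono fun s => ?_
    by_cases hs : s ∈ Ioc 0 τ
    · rw [indicator_of_mem hs, indicator_of_mem (hmem y hy s hs), hderiv]
      simp only [hG]
      gcongr
      have := (fderiv ℝ φ (y + s • e)).le_opNorm e
      rw [he, mul_one] at this
      exact enorm_le_iff_norm_le.2 this
    · rw [indicator_of_notMem hs]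
      exact zero_le
  have hSm : MeasurableSet (Metric.ball x (r / 2) ∩ frontier Ω) :=
    measurableSet_ball.inter isClosed_frontier.measurableSet
  rw [surf, Measure.restrict_restrict measurableSet_ball]
  have hφm : Measurable fun y => ‖φ y‖ₑ ^ 2 := hφ.continuous.enorm.measurable.pow_const 2
  rw [← lintegral_const_mul _ hφm]
  have hKm : Measurable fun y : E d => ∫⁻ s : ℝ, D.indicator G (y + s • e) := by
    have : Measurable fun q : E d × ℝ => D.indicator G (q.1 + q.2 • e) :=
      (hGm.indicator hDm).comp (by fun_prop)
    exact this.lintegral_prod_right'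
  calc _ ≤ ∫⁻ y in Metric.ball x (r / 2) ∩ frontier Ω,
          (2 * ∫⁻ s : ℝ, D.indicator G (y + s • e))
            ∂(Measure.euclideanHausdorffMeasure (d - 1)) := setLIntegral_mono' hSm hpt
    _ ≤ ∫⁻ y in lipGraph e h, (2 * ∫⁻ s : ℝ, D.indicator G (y + s • e))
            ∂(Measure.euclideanHausdorffMeasure (d - 1)) := lintegral_mono_set hset
    _ ≤ 2 * (C * ∫⁻ x, D.indicator G x) := by
        rw [lintegral_const_mul _ hKm]
        gcongr
        exact hC _ (hGm.indicator hDm)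
    _ = _ := by
        rw [lintegral_indicator hDm]
        push_cast
        ring

/-- The multiplicative trace inequality for smooth functions, on the part inside `Ω` of any
tubular neighborhood of the boundary. -/
lemma trace_ineq {Ω : Set (E d)} (hΩ : IsLipschitzDomain Ω) {ρ : ℝ} (hρ : 0 < ρ) :
    ∃ C : ℝ≥0, ∃ τ₀ : ℝ, 0 < τ₀ ∧ ∀ τ, 0 < τ → τ ≤ τ₀ → ∀ φ : E d → ℂ, ContDiff ℝ ∞ φ →
      ENNReal.ofReal τ * ∫⁻ y, ‖φ y‖ₑ ^ 2 ∂(surf Ω) ≤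
        C * ∫⁻ y in tube Ω ρ ∩ Ω,
          (‖φ y‖ₑ ^ 2 + ENNReal.ofReal (τ ^ 2) * ‖fderiv ℝ φ y‖ₑ ^ 2) := by
  have key : ∃ C : ℝ≥0, ∃ τ₀ : ℝ, 0 < τ₀ ∧ ∀ τ, 0 < τ → τ ≤ τ₀ → ∀ φ : E d → ℂ,
      ContDiff ℝ ∞ φ →
      ENNReal.ofReal τ * ∫⁻ y in frontier Ω, ‖φ y‖ₑ ^ 2 ∂(surf Ω) ≤
        C * ∫⁻ y in tube Ω ρ ∩ Ω,
          (‖φ y‖ₑ ^ 2 + ENNReal.ofReal (τ ^ 2) * ‖fderiv ℝ φ y‖ₑ ^ 2) := by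
    -- Compactness passes from local to global: on a union the constants add up and the smaller of
    -- the two lengths is admissible.
    refine hΩ.isCompact_frontier.induction_on (p := fun S => ∃ C : ℝ≥0, ∃ τ₀ : ℝ, 0 < τ₀ ∧
      ∀ τ, 0 < τ → τ ≤ τ₀ → ∀ φ : E d → ℂ, ContDiff ℝ ∞ φ →
      ENNReal.ofReal τ * ∫⁻ y in S, ‖φ y‖ₑ ^ 2 ∂(surf Ω) ≤
        C * ∫⁻ y in tube Ω ρ ∩ Ω,
          (‖φ y‖ₑ ^ 2 + ENNReal.ofReal (τ ^ 2) * ‖fderiv ℝ φ y‖ₑ ^ 2)) ?_ ?_ ?_ ?_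
    · exact ⟨0, 1, one_pos, fun τ _ _ φ _ => by simp⟩
    · rintro S T hST ⟨C, τ₀, h0, h⟩
      exact ⟨C, τ₀, h0, fun τ h1 h2 φ hφ =>
        (mul_le_mul_right (lintegral_mono_set hST) _).trans (h τ h1 h2 φ hφ)⟩
    · rintro S T ⟨C, τ₀, h0, h⟩ ⟨C', τ₀', h0', h'⟩
      refine ⟨C + C', min τ₀ τ₀', lt_min h0 h0', fun τ h1 h2 φ hφ => ?_⟩
      refine (mul_le_mul_right (lintegral_union_le _ S T) _).trans ?_
      rw [mul_add]
      push_cast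
      rw [add_mul]
      exact add_le_add (h τ h1 (h2.trans (min_le_left _ _)) φ hφ)
        (h' τ h1 (h2.trans (min_le_right _ _)) φ hφ)
    · exact fun x hx => trace_ineq_local hΩ hρ hx
  simpa [surf, Measure.restrict_restrict isClosed_frontier.measurableSet] using key

end

section

variable {d : ℕ}

/-! ### The wavenumber-weighted trace inequality -/

lemma sq_rpow_half (x : ℝ≥0∞) : (x ^ 2) ^ (1 / 2 : ℝ) = x := by
  rw [← ENNReal.rpow_two, ← ENNReal.rpow_mul]
  norm_num

lemma rpow_half_sq (x : ℝ≥0∞) : (x ^ (1 / 2 : ℝ)) ^ 2 = x := by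
  rw [← ENNReal.rpow_two, ← ENNReal.rpow_mul]
  norm_num

lemma eLpNorm_two_sq {α F : Type*} [MeasurableSpace α] [NormedAddCommGroup F] (f : α → F)
    (μ : Measure α) : eLpNorm f 2 μ ^ 2 = ∫⁻ x, ‖f x‖ₑ ^ 2 ∂μ := by
  simpa using eLpNorm_nnreal_pow_eq_lintegral (f := f) (μ := μ) (p := 2) (by norm_num)

lemma enorm_fderiv_le_sum (φ : E d → ℂ) (x : E d) :
    ‖fderiv ℝ φ x‖ₑ ≤ ∑ i, ‖fderiv ℝ φ x (basisVec i)‖ₑ := by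
  have h : ‖fderiv ℝ φ x‖ ≤ ∑ i, ‖fderiv ℝ φ x (basisVec i)‖ := by
    refine ContinuousLinearMap.opNorm_le_bound _ (Finset.sum_nonneg fun i _ => norm_nonneg _)
      fun v => ?_
    have hv : v = ∑ i, v i • (basisVec i : E d) := by
      conv_lhs => rw [← (EuclideanSpace.basisFun (Fin d) ℝ).sum_repr v]
      simp
    conv_lhs => rw [hv]
    rw [map_sum, Finset.sum_mul]
    refine (norm_sum_le _ _).trans (Finset.sum_le_sum fun i _ => ?_)
    rw [map_smul, norm_smul, mul_comm]
    gcongr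
    exact PiLp.norm_apply_le v i
  calc ‖fderiv ℝ φ x‖ₑ = ENNReal.ofReal ‖fderiv ℝ φ x‖ := (ofReal_norm _).symm
    _ ≤ ENNReal.ofReal (∑ i, ‖fderiv ℝ φ x (basisVec i)‖) := ENNReal.ofReal_le_ofReal h
    _ = _ := by
      rw [ENNReal.ofReal_sum_of_nonneg fun i _ => norm_nonneg _]
      simp_rw [ofReal_norm]

lemma continuous_partial {φ : E d → ℂ} (hφ : ContDiff ℝ ∞ φ) (i : Fin d) :
    Continuous fun x => fderiv ℝ φ x (basisVec i) :=
  (hφ.continuous_fderiv (by simp)).clm_apply continuous_const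

lemma eLpNorm_fderiv_le_sum {φ : E d → ℂ} (hφ : ContDiff ℝ ∞ φ) (μ : Measure (E d)) :
    eLpNorm (fderiv ℝ φ) 2 μ ≤ ∑ i, eLpNorm (fun x => fderiv ℝ φ x (basisVec i)) 2 μ := by
  calc eLpNorm (fderiv ℝ φ) 2 μ
      ≤ eLpNorm (∑ i, fun x => ‖fderiv ℝ φ x (basisVec i)‖) 2 μ := by
        refine eLpNorm_mono_enorm fun x => (enorm_fderiv_le_sum φ x).trans (le_of_eq ?_)
        rw [Finset.sum_apply, ← ofReal_norm, Real.norm_of_nonneg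
          (Finset.sum_nonneg fun i _ => norm_nonneg _),
          ENNReal.ofReal_sum_of_nonneg fun i _ => norm_nonneg _]
        simp_rw [ofReal_norm]
    _ ≤ ∑ i, eLpNorm (fun x => ‖fderiv ℝ φ x (basisVec i)‖) 2 μ :=
        eLpNorm_sum_le (fun i _ => (continuous_partial hφ i).norm.aestronglyMeasurable) (by norm_num)
    _ = _ := by simp_rw [eLpNorm_norm]

/-- The wavenumber-weighted trace inequality for smooth functions. -/
lemma trace_ineq_smooth {Ω : Set (E d)} (hΩ : IsLipschitzDomain Ω) {ρ : ℝ} (hρ : 0 < ρ)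
    {k₀ : ℝ} (hk₀ : 0 < k₀) :
    ∃ C : ℝ≥0, ∀ k, k₀ ≤ k → ∀ φ : E d → ℂ, ContDiff ℝ ∞ φ →
      ENNReal.ofReal (√k) * eLpNorm φ 2 (surf Ω) ≤
        C * (ENNReal.ofReal k * eLpNorm φ 2 (vol (tube Ω ρ ∩ Ω)) +
          ∑ i, eLpNorm (fun x => fderiv ℝ φ x (basisVec i)) 2 (vol (tube Ω ρ ∩ Ω))) := by
  obtain ⟨C, τ₀, hτ₀, hC⟩ := trace_ineq hΩ hρ
  -- The segment length is τ = B / k, which is at most τ₀ for every k ≥ k₀. Multiplying by k² / B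
  -- then leaves the k-independent factors 1 / B and B in front of (k‖φ‖)² and ‖∇φ‖².
  set B := τ₀ * k₀ with hB
  have hBpos : 0 < B := by positivity
  set C' : ℝ≥0 := C * (Real.toNNReal (1 / B) + Real.toNNReal B) with hC'
  refine ⟨NNReal.sqrt C', fun k hk φ hφ => ?_⟩
  have hkpos : 0 < k := hk₀.trans_le hk
  refine le_trans ?_ (mul_le_mul_right (add_le_add_right (eLpNorm_fderiv_le_sum hφ _) _) _)
  set D := tube Ω ρ ∩ Ω
  have h := hC (B / k) (by positivity) (by
    rw [div_le_iff₀ hkpos, hB]; gcongr) φ hφ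
  have hφm : Measurable fun y => ‖φ y‖ₑ ^ 2 := hφ.continuous.enorm.measurable.pow_const 2
  have hdm : Measurable fun y => ‖fderiv ℝ φ y‖ₑ ^ 2 :=
    (hφ.continuous_fderiv (by simp)).enorm.measurable.pow_const 2
  rw [lintegral_add_left hφm, lintegral_const_mul _ hdm, ← eLpNorm_two_sq, ← eLpNorm_two_sq,
    ← eLpNorm_two_sq] at h
  rw [← ENNReal.pow_le_pow_left_iff (n := 2) (by norm_num)]
  set g := eLpNorm φ 2 (surf Ω)
  set a := eLpNorm φ 2 (vol D)
  set b := eLpNorm (fderiv ℝ φ) 2 (vol D)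
  have e1 : ENNReal.ofReal k = ENNReal.ofReal (k ^ 2 / B) * ENNReal.ofReal (B / k) := by
    rw [← ENNReal.ofReal_mul (by positivity)]
    congr 1
    field_simp
  have e2 : ENNReal.ofReal (k ^ 2 / B) = ENNReal.ofReal (1 / B) * ENNReal.ofReal k ^ 2 := by
    rw [← ENNReal.ofReal_pow hkpos.le, ← ENNReal.ofReal_mul (by positivity)]
    congr 1
    ring
  have e3 : ENNReal.ofReal (k ^ 2 / B) * ENNReal.ofReal ((B / k) ^ 2) = ENNReal.ofReal B := by
    rw [← ENNReal.ofReal_mul (by positivity)]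
    congr 1
    field_simp
  have e4 : ((C' : ℝ≥0) : ℝ≥0∞) = C * (ENNReal.ofReal (1 / B) + ENNReal.ofReal B) := by
    rw [hC']; push_cast; rfl
  calc (ENNReal.ofReal √k * g) ^ 2 = ENNReal.ofReal k * g ^ 2 := by
        rw [mul_pow, ← ENNReal.ofReal_pow (Real.sqrt_nonneg k), Real.sq_sqrt hkpos.le]
    _ = ENNReal.ofReal (k ^ 2 / B) * (ENNReal.ofReal (B / k) * g ^ 2) := by rw [e1, mul_assoc]
    _ ≤ ENNReal.ofReal (k ^ 2 / B) * (C * (a ^ 2 + ENNReal.ofReal ((B / k) ^ 2) * b ^ 2)) := by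
        gcongr
    _ = C * (ENNReal.ofReal (k ^ 2 / B) * a ^ 2
          + (ENNReal.ofReal (k ^ 2 / B) * ENNReal.ofReal ((B / k) ^ 2)) * b ^ 2) := by ring
    _ = C * (ENNReal.ofReal (1 / B) * (ENNReal.ofReal k * a) ^ 2 + ENNReal.ofReal B * b ^ 2) := by
        rw [e3, e2]; ring
    _ ≤ C * (ENNReal.ofReal (1 / B) * (ENNReal.ofReal k * a + b) ^ 2
          + ENNReal.ofReal B * (ENNReal.ofReal k * a + b) ^ 2) := by
        gcongr
        · exact le_self_add
        · exact le_add_self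
    _ = ((NNReal.sqrt C' : ℝ≥0∞) * (ENNReal.ofReal k * a + b)) ^ 2 := by
        rw [mul_pow, ← ENNReal.coe_pow, NNReal.sq_sqrt, e4]
        ring

/-- `L²` norms pass to the limit from above. -/
lemma eLpNorm_le_of_approx {α : Type*} [MeasurableSpace α] {μ : Measure α} {F G : α → ℂ}
    (hF : AEStronglyMeasurable F μ) (hG : AEStronglyMeasurable G μ) :
    eLpNorm F 2 μ ≤ eLpNorm G 2 μ + eLpNorm (F - G) 2 μ := by
  calc eLpNorm F 2 μ = eLpNorm (G + (F - G)) 2 μ := by rw [add_sub_cancel]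
    _ ≤ _ := eLpNorm_add_le hG (hF.sub hG) (by norm_num)

/-- The wavenumber-weighted trace inequality. -/
lemma trace_ineq_weighted {Ω : Set (E d)} (hΩ : IsLipschitzDomain Ω) {ρ : ℝ} (hρ : 0 < ρ)
    {k₀ : ℝ} (hk₀ : 0 < k₀) :
    ∃ C : ℝ≥0, ∀ k, k₀ ≤ k → ∀ (U : Set (E d)), tube Ω ρ ∩ Ω ⊆ U →
      ∀ (u g : E d → ℂ) (w : Fin d → E d → ℂ), MemLp u 2 (vol U) → (∀ i, MemLp (w i) 2 (vol U)) →
      AEStronglyMeasurable g (surf Ω) → IsTraceWith Ω U u w g →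
      ENNReal.ofReal (√k) * eLpNorm g 2 (surf Ω) ≤
        C * (ENNReal.ofReal k * eLpNorm u 2 (vol U) + ∑ i, eLpNorm (w i) 2 (vol U)) := by
  obtain ⟨C, hC⟩ := trace_ineq_smooth hΩ hρ hk₀
  refine ⟨C, fun k hk U hU u g w hu hw hg htr => ?_⟩
  obtain ⟨φ, sφ, a1, a2, a3⟩ := htr
  have hmono : vol (tube Ω ρ ∩ Ω) ≤ vol U := Measure.restrict_mono hU le_rfl
  -- The smooth inequality is used for `φ n`; the approximation errors stay explicit until the limit
  -- is taken.
  have hstep : ∀ n, ENNReal.ofReal (√k) * eLpNorm g 2 (surf Ω) ≤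
      ENNReal.ofReal (√k) * eLpNorm (φ n - g) 2 (surf Ω) +
      C * (ENNReal.ofReal k * (eLpNorm u 2 (vol U) + eLpNorm (φ n - u) 2 (vol U)) +
        ∑ i, (eLpNorm (w i) 2 (vol U)
          + eLpNorm (fun x => fderiv ℝ (φ n) x (basisVec i) - w i x) 2 (vol U))) := by
    intro n
    have h1 : eLpNorm g 2 (surf Ω) ≤ eLpNorm (φ n) 2 (surf Ω) + eLpNorm (φ n - g) 2 (surf Ω) := by
      rw [eLpNorm_sub_comm]
      exact eLpNorm_le_of_approx hg (sφ n).continuous.aestronglyMeasurable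
    have h2 : eLpNorm (φ n) 2 (vol (tube Ω ρ ∩ Ω)) ≤
        eLpNorm u 2 (vol U) + eLpNorm (φ n - u) 2 (vol U) :=
      (eLpNorm_mono_measure _ hmono).trans
        (eLpNorm_le_of_approx (sφ n).continuous.aestronglyMeasurable hu.1)
    have h3 : ∀ i, eLpNorm (fun x => fderiv ℝ (φ n) x (basisVec i)) 2 (vol (tube Ω ρ ∩ Ω)) ≤
        eLpNorm (w i) 2 (vol U)
          + eLpNorm (fun x => fderiv ℝ (φ n) x (basisVec i) - w i x) 2 (vol U) := fun i =>
      (eLpNorm_mono_measure _ hmono).trans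
        (eLpNorm_le_of_approx (continuous_partial (sφ n) i).aestronglyMeasurable (hw i).1)
    calc _ ≤ ENNReal.ofReal (√k) * (eLpNorm (φ n) 2 (surf Ω) + eLpNorm (φ n - g) 2 (surf Ω)) := by
          gcongr
      _ = ENNReal.ofReal (√k) * eLpNorm (φ n - g) 2 (surf Ω)
          + ENNReal.ofReal (√k) * eLpNorm (φ n) 2 (surf Ω) := by ring
      _ ≤ _ := by
          refine add_le_add_right ((hC k hk (φ n) (sφ n)).trans ?_) _
          gcongr with i
          exact h3 i
  refine ge_of_tendsto' (x := atTop) ?_ hstep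
  have t1 := ENNReal.Tendsto.const_mul (a := ENNReal.ofReal √k) a3 (Or.inr ENNReal.ofReal_ne_top)
  have t2 := ENNReal.Tendsto.const_mul (a := ENNReal.ofReal k)
    (a1.const_add (eLpNorm u 2 (vol U))) (Or.inr ENNReal.ofReal_ne_top)
  have t3 := tendsto_finsetSum Finset.univ
    (fun i _ => (a2 i).const_add (eLpNorm (w i) 2 (vol U)))
  have t4 := ENNReal.Tendsto.const_mul (a := (C : ℝ≥0∞)) (t2.add t3) (Or.inr ENNReal.coe_ne_top)
  simpa using t1.add t4

/-! ### Weak derivatives -/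

/-- By Hölder's inequality, `L²` convergence becomes `L¹` convergence after multiplication by a test
function. -/
lemma tendsto_integral_test {U : Set (E d)} {ψ : E d → ℝ} (hψ : Continuous ψ)
    (hc : HasCompactSupport ψ) {u : E d → ℂ} (hu : MemLp u 2 (vol U)) {F : ℕ → E d → ℂ}
    (hF : ∀ n, Continuous (F n)) (h : Tendsto (fun n => eLpNorm (F n - u) 2 (vol U)) atTop (𝓝 0)) :
    Tendsto (fun n => ∫ x in U, ψ x • F n x) atTop (𝓝 (∫ x in U, ψ x • u x)) := by
  have hψm : MemLp ψ 2 (vol U) := (hψ.memLp_of_hasCompactSupport hc).restrict U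
  refine tendsto_integral_of_L1' _ (memLp_smul_test hψ hc hu).1
    (Eventually.of_forall fun n => ?_) ?_
  · exact ((hψ.smul (hF n)).integrable_of_hasCompactSupport hc.smul_right).restrict
  · have ht : Tendsto (fun n => eLpNorm ψ 2 (vol U) * eLpNorm (F n - u) 2 (vol U)) atTop (𝓝 0) := by
      simpa using ENNReal.Tendsto.const_mul h (Or.inr hψm.2.ne)
    refine tendsto_of_tendsto_of_tendsto_of_le_of_le tendsto_const_nhds ht (fun n => zero_le)
      fun n => ?_
    have e : ((fun x => ψ x • F n x) - fun x => ψ x • u x) = ψ • (F n - u) := by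
      ext x
      simp [smul_sub]
    dsimp only
    rw [e]
    exact eLpNorm_smul_le_mul_eLpNorm ((hF n).aestronglyMeasurable.sub hu.1) hψm.1

/-- Integration by parts holds for the smooth approximations, as the test function is supported in
`U` and the integrals extend to the whole space; both sides pass to the limit. This ties the
gradient in the notion of trace to the one in the Sobolev norms. -/
lemma IsTraceWith.isWeakDeriv {Ω U : Set (E d)} {u g : E d → ℂ} {w : Fin d → E d → ℂ}
    (h : IsTraceWith Ω U u w g) (hu : MemLp u 2 (vol U)) (hw : ∀ i, MemLp (w i) 2 (vol U))
    (i : Fin d) : IsWeakDeriv U ![i] u (w i) := by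
  obtain ⟨φ, sφ, a1, a2, -⟩ := h
  intro χ hχ hc hs
  have hdc : Continuous fun x => fderiv ℝ χ x (basisVec i) :=
    (hχ.continuous_fderiv (by simp)).clm_apply continuous_const
  have hds : HasCompactSupport fun x => fderiv ℝ χ x (basisVec i) :=
    hc.fderiv_apply (𝕜 := ℝ) (basisVec i)
  have hparts : ∀ n, ∫ x in U, fderiv ℝ χ x (basisVec i) • φ n x
      = -∫ x in U, χ x • fderiv ℝ (φ n) x (basisVec i) := by
    intro n
    rw [setIntegral_eq_integral_of_forall_compl_eq_zero,
      setIntegral_eq_integral_of_forall_compl_eq_zero]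
    · rw [integral_smul_fderiv_eq_neg_fderiv_smul_of_integrable (𝕜 := ℝ), neg_neg]
      · exact (hdc.smul (sφ n).continuous).integrable_of_hasCompactSupport hds.smul_right
      · exact (hχ.continuous.smul (continuous_partial (sφ n) i)).integrable_of_hasCompactSupport
          hc.smul_right
      · exact (hχ.continuous.smul (sφ n).continuous).integrable_of_hasCompactSupport hc.smul_right
      · exact fun x _ => (hχ.differentiable (by simp)).differentiableAt
      · exact fun x _ => ((sφ n).differentiable (by simp)).differentiableAt
    · intro x hx
      rw [image_eq_zero_of_notMem_tsupport fun h => hx (hs h), zero_smul]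
    · intro x hx
      rw [image_eq_zero_of_notMem_tsupport (f := fun x => fderiv ℝ χ x (basisVec i))
        fun h => hx (hs (tsupport_fderiv_apply_subset ℝ (basisVec i) h)), zero_smul]
  have t1 := tendsto_integral_test hdc hds hu (fun n => (sφ n).continuous) a1
  have t2 := tendsto_integral_test hχ.continuous hc (hw i)
    (fun n => continuous_partial (sφ n) i) (a2 i)
  have := tendsto_nhds_unique t1 (t2.neg.congr fun n => (hparts n).symm)
  simpa [iteratedFDeriv_one_apply] using this

/-- This is the fundamental lemma of the calculus of variations. It makes the infimum in `gradNorm`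
the value at any single jet. -/
lemma IsWeakDeriv.ae_unique {U : Set (E d)} (hU : IsOpen U) {n : ℕ} {α : Fin n → Fin d}
    {u w w' : E d → ℂ} (hw : MemLp w 2 (vol U)) (hw' : MemLp w' 2 (vol U))
    (h : IsWeakDeriv U α u w) (h' : IsWeakDeriv U α u w') : w =ᵐ[vol U] w' := by
  have hloc : ∀ {v : E d → ℂ}, MemLp v 2 (vol U) → LocallyIntegrableOn v U volume := fun hv =>
    (locallyIntegrableOn_of_locallyIntegrable_restrict (hv.locallyIntegrable (by norm_num)))
  have key := hU.ae_eq_zero_of_integral_contDiff_smul_eq_zero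
    ((hloc hw).sub (hloc hw')) (μ := volume) (fun χ hχ hc hs => ?_)
  · rw [EventuallyEq, ae_restrict_iff' hU.measurableSet]
    filter_upwards [key] with x hx hxU
    exact sub_eq_zero.1 (hx hxU)
  · rw [← setIntegral_eq_integral_of_forall_compl_eq_zero (s := U)]
    · have e1 := h χ hχ hc hs
      have e2 := h' χ hχ hc hs
      rw [e1] at e2
      have e3 := mul_left_cancel₀ (by simp) e2
      simp_rw [Pi.sub_apply, smul_sub]
      rw [integral_sub (memLp_smul_test hχ.continuous hc hw)
        (memLp_smul_test hχ.continuous hc hw'), e3, sub_self]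
    · intro x hx
      rw [image_eq_zero_of_notMem_tsupport fun h => hx (hs h), zero_smul]

lemma IsWeakDeriv.mono {U V : Set (E d)} (hUV : U ⊆ V) {n : ℕ} {α : Fin n → Fin d}
    {u w : E d → ℂ} (h : IsWeakDeriv V α u w) : IsWeakDeriv U α u w := by
  intro χ hχ hc hs
  have h1 := h χ hχ hc (hs.trans hUV)
  have hout : ∀ x ∉ tsupport χ, (iteratedFDeriv ℝ n χ x fun j => basisVec (α j)) = 0 := by
    intro x hx
    rw [image_eq_zero_of_notMem_tsupport fun h => hx (tsupport_iteratedFDeriv_subset n h)]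
    rfl
  have key : ∀ W : Set (E d), tsupport χ ⊆ W →
      (∫ x in W, (iteratedFDeriv ℝ n χ x fun j => basisVec (α j)) • u x
        = ∫ x, (iteratedFDeriv ℝ n χ x fun j => basisVec (α j)) • u x) ∧
      ∫ x in W, χ x • w x = ∫ x, χ x • w x := fun W hW => by
    constructor <;> refine setIntegral_eq_integral_of_forall_compl_eq_zero fun x hx => ?_
    · rw [hout x fun h => hx (hW h), zero_smul]
    · rw [image_eq_zero_of_notMem_tsupport fun h => hx (hW h), zero_smul]
  rw [(key U hs).1, (key U hs).2, ← (key V (hs.trans hUV)).1, h1, (key V (hs.trans hUV)).2]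

lemma isWeakDeriv_order_zero (U : Set (E d)) (α : Fin 0 → Fin d) (u : E d → ℂ) :
    IsWeakDeriv U α u u := by
  intro χ _ _ _
  simp

lemma IsWeakJet.gradNorm_eq {U : Set (E d)} (hU : IsOpen U) {n : ℕ} {u : E d → ℂ}
    {w : (Fin n → Fin d) → E d → ℂ} (h : IsWeakJet U n u w) :
    gradNorm U n u = (∑ α, eLpNorm (w α) 2 (vol U) ^ 2) ^ (1 / 2 : ℝ) := by
  refine le_antisymm (iInf₂_le w h) (le_iInf₂ fun w' h' => le_of_eq ?_)
  congr 2
  funext α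
  rw [eLpNorm_congr_ae ((h α).2.ae_unique hU (h α).1 (h' α).1 (h' α).2)]

lemma gradNorm_zero_eq {U : Set (E d)} (hU : IsOpen U) {u : E d → ℂ} (hu : MemLp u 2 (vol U)) :
    gradNorm U 0 u = eLpNorm u 2 (vol U) := by
  have h : IsWeakJet U 0 u fun _ => u := fun α => ⟨hu, isWeakDeriv_order_zero U α u⟩
  rw [h.gradNorm_eq hU]
  simp only [Finset.univ_unique, Finset.sum_singleton, sq_rpow_half]

lemma gradNorm_one_sq {U : Set (E d)} (hU : IsOpen U) {u : E d → ℂ} {w : Fin d → E d → ℂ}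
    (hw : ∀ i, MemLp (w i) 2 (vol U)) (h : ∀ i, IsWeakDeriv U ![i] u (w i)) :
    gradNorm U 1 u ^ 2 = ∑ i, eLpNorm (w i) 2 (vol U) ^ 2 := by
  have hj : IsWeakJet U 1 u fun α => w (α 0) := fun α => by
    refine ⟨hw _, ?_⟩
    have : α = ![α 0] := by ext j; fin_cases j; rfl
    rw [this]
    exact h _
  rw [hj.gradNorm_eq hU, rpow_half_sq]
  exact Fintype.sum_equiv (Equiv.funUnique (Fin 1) (Fin d)) _ _ fun α => rfl

/-- A jet scales with the function. If there is no jet, a ≠ 0 keeps the right side infinite. -/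
lemma gradNorm_lin {U : Set (E d)} (hU : IsOpen U) {n : ℕ} {a : ℂ} (ha : a ≠ 0) {u u' : E d → ℂ}
    (hu : MemLp u 2 (vol U)) (hu' : u' =ᵐ[vol U] fun x => a * u x) :
    gradNorm U n u' ≤ ‖a‖ₑ * gradNorm U n u := by
  by_cases h : ∃ w, IsWeakJet U n u w
  · obtain ⟨w, hw⟩ := h
    have hj : IsWeakJet U n u' fun α x => a * w α x := fun α =>
      ⟨(hw α).1.const_mul a, (hw α).2.lin a hu MemLp.zero (hw α).1 MemLp.zero
        (isWeakDeriv_zero ae_eq_rfl ae_eq_rfl) (by simpa using hu') (by simp)⟩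
    rw [hw.gradNorm_eq hU, hj.gradNorm_eq hU]
    have e : ∀ α, eLpNorm (fun x => a * w α x) 2 (vol U) ^ 2
        = ‖a‖ₑ ^ 2 * eLpNorm (w α) 2 (vol U) ^ 2 := fun α => by
      rw [← mul_pow, ← eLpNorm_const_smul]
      rfl
    simp_rw [e]
    rw [← Finset.mul_sum, ENNReal.mul_rpow_of_nonneg _ _ (by norm_num), sq_rpow_half]
  · have : gradNorm U n u = ⊤ := iInf₂_eq_top.2 fun w hw => absurd ⟨w, hw⟩ h
    rw [this, ENNReal.mul_top (by simpa using ha)]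
    exact le_top

lemma gradNorm_mono {U V : Set (E d)} (hUV : U ⊆ V) (n : ℕ) (u : E d → ℂ) :
    gradNorm U n u ≤ gradNorm V n u := by
  refine le_iInf₂ fun w hw => ?_
  have hμ : vol U ≤ vol V := Measure.restrict_mono hUV le_rfl
  refine (iInf₂_le w fun α => ⟨(hw α).1.mono_measure hμ, (hw α).2.mono hUV⟩).trans ?_
  gcongr

end

section

variable {d : ℕ}

/-! ### Sobolev norms of orders zero and one -/

lemma sobolevNorm_zero_sq (U : Set (E d)) (u : E d → ℂ) :
    sobolevNorm 0 U u ^ 2 = gradNorm U 0 u ^ 2 := by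
  rw [sobolevNorm, rpow_half_sq]
  simp

lemma sobolevNorm_one_sq (U : Set (E d)) (u : E d → ℂ) :
    sobolevNorm 1 U u ^ 2 = gradNorm U 0 u ^ 2 + gradNorm U 1 u ^ 2 := by
  rw [sobolevNorm, rpow_half_sq]
  simp [Finset.sum_range_succ]

/-- The pieces are disjoint and fill `Ω` up to a null set; this is what makes broken norms of low
order global. -/
lemma IsLipschitzPartition.tsum_lintegral {Ω : Set (E d)} {Pc : Set (Set (E d))}
    (hPc : IsLipschitzPartition Ω Pc) (F : E d → ℝ≥0∞) :
    ∑' P : Pc, ∫⁻ x in (P : Set (E d)), F x = ∫⁻ x in Ω, F x := by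
  rw [← lintegral_biUnion hPc.countable (s := fun P => P)
    (fun P hP => (hPc.lipschitz P hP).isOpen.measurableSet) hPc.disjoint]
  refine setLIntegral_congr (Filter.EventuallyLE.antisymm ?_ ?_)
  · exact (iUnion₂_subset hPc.subset).eventuallyLE
  · exact ae_le_set.2 hPc.volume_diff

lemma IsLipschitzPartition.memLp {Ω : Set (E d)} {Pc : Set (Set (E d))}
    (hPc : IsLipschitzPartition Ω Pc) {P : Set (E d)} (hP : P ∈ Pc) (f : L2 Ω) :
    MemLp f 2 (vol P) :=
  (Lp.memLp f).mono_measure (Measure.restrict_mono (hPc.subset P hP) le_rfl)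

lemma brokenNorm_zero_eq {Ω : Set (E d)} {Pc : Set (Set (E d))}
    (hPc : IsLipschitzPartition Ω Pc) (f : L2 Ω) : brokenNorm 0 Pc f = ‖f‖ₑ := by
  have h : ∀ P : Pc, sobolevNorm 0 (P : Set (E d)) f ^ 2 = ∫⁻ x in (P : Set (E d)), ‖f x‖ₑ ^ 2 :=
    fun P => by
      rw [sobolevNorm_zero_sq, gradNorm_zero_eq (hPc.lipschitz P P.2).isOpen (hPc.memLp P.2 f),
        eLpNorm_two_sq]
  rw [brokenNorm, tsum_congr h, hPc.tsum_lintegral, ← eLpNorm_two_sq, sq_rpow_half, Lp.enorm_def]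

/-- The extended `H¹(Ω)` norm. -/
def hOneNorm {Ω : Set (E d)} {t : ℝ} (u : Energy Ω t) : ℝ≥0∞ :=
  (‖fn u‖ₑ ^ 2 + ∑ i, ‖grad u i‖ₑ ^ 2) ^ (1 / 2 : ℝ)

/-- The weak gradient on `Ω` restricts to the weak gradient on every piece, so the squared norms add
up. -/
lemma brokenNorm_one_eq {Ω : Set (E d)} {Pc : Set (Set (E d))} {t : ℝ}
    (hPc : IsLipschitzPartition Ω Pc) (u : Energy Ω t) : brokenNorm 1 Pc (fn u) = hOneNorm u := by
  have hm : ∀ f : L2 Ω, AEMeasurable (fun x => ‖f x‖ₑ ^ 2) (vol Ω) := fun f =>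
    (Lp.aestronglyMeasurable f).enorm.pow_const 2
  have h : ∀ P : Pc, sobolevNorm 1 (P : Set (E d)) (fn u) ^ 2
      = ∫⁻ x in (P : Set (E d)), (‖fn u x‖ₑ ^ 2 + ∑ i, ‖grad u i x‖ₑ ^ 2) := fun P => by
    have hU := (hPc.lipschitz P P.2).isOpen
    have hμ : vol (P : Set (E d)) ≤ vol Ω := Measure.restrict_mono (hPc.subset P P.2) le_rfl
    rw [sobolevNorm_one_sq, gradNorm_zero_eq hU (hPc.memLp P.2 _),
      gradNorm_one_sq (u := fn u) hU (fun i => hPc.memLp P.2 (grad u i))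
        (fun i => (u.2.1 i).mono (hPc.subset P P.2)),
      lintegral_add_left' ((hm _).mono_measure hμ),
      lintegral_finsetSum' _ fun i _ => (hm _).mono_measure hμ]
    simp_rw [eLpNorm_two_sq]
  rw [brokenNorm, tsum_congr h, hPc.tsum_lintegral, lintegral_add_left' (hm _),
    lintegral_finsetSum' _ fun i _ => hm _, hOneNorm]
  simp_rw [Lp.enorm_def, eLpNorm_two_sq]

lemma IsTrace.sobolevNorm_one_sq {Ω : Set (E d)} (hΩ : IsOpen Ω) {u g : E d → ℂ}
    (hu : MemLp u 2 (vol Ω)) {w : Fin d → E d → ℂ} (hw : ∀ i, MemLp (w i) 2 (vol Ω))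
    (h : IsTraceWith Ω Ω u w g) :
    sobolevNorm 1 Ω u ^ 2 = eLpNorm u 2 (vol Ω) ^ 2 + ∑ i, eLpNorm (w i) 2 (vol Ω) ^ 2 := by
  rw [Helmholtz.sobolevNorm_one_sq, gradNorm_zero_eq hΩ hu,
    gradNorm_one_sq hΩ hw fun i => h.isWeakDeriv hu hw i]

/-! ### Norms on the boundary -/

lemma bdryNorm_zero_eq {Ω : Set (E d)} (g : L2Bdry Ω) : bdryNorm Ω 0 g = ‖g‖ₑ := by
  rw [bdryNorm, if_pos rfl, Lp.enorm_def]

lemma bdryNorm_half (Ω : Set (E d)) (g : E d → ℂ) :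
    bdryNorm Ω (1 / 2) g = ⨅ (u : E d → ℂ) (_ : IsTrace Ω Ω u g), sobolevNorm 1 Ω u := by
  rw [bdryNorm, if_neg (by norm_num), if_neg (by norm_num)]
  norm_num

lemma bdryNorm_half_tr_le {Ω : Set (E d)} (hΩ : IsOpen Ω) {t : ℝ} (u : Energy Ω t) :
    bdryNorm Ω (1 / 2) (tr u : L2Bdry Ω) ≤ hOneNorm u := by
  have hw : ∀ i, MemLp (grad u i) 2 (vol Ω) := fun i => Lp.memLp _
  have ht : IsTraceWith Ω Ω (fn u) (fun i => grad u i) (tr u : L2Bdry Ω) := u.2.2.1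
  rw [bdryNorm_half]
  refine (iInf₂_le (fn u : E d → ℂ) ⟨Lp.memLp _, _, hw, ht⟩).trans (le_of_eq ?_)
  rw [← sq_rpow_half (sobolevNorm 1 Ω (fn u)), IsTrace.sobolevNorm_one_sq hΩ (Lp.memLp _) hw ht,
    hOneNorm]
  simp_rw [Lp.enorm_def]

/-- The trace inequality bounds ‖g‖ by the `H¹` norm of every extension, hence by the quotient norm.
This handles boundary data of size zero in `etaF`. -/
lemma eq_zero_of_bdryNorm_half {Ω : Set (E d)} (hΩ : IsLipschitzDomain Ω) {g : L2Bdry Ω}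
    (hg : bdryNorm Ω (1 / 2) g = 0) : g = 0 := by
  obtain ⟨C, hC⟩ := trace_ineq_weighted hΩ one_pos one_pos
  have hle : ‖g‖ₑ ≤ (C * (1 + d)) * bdryNorm Ω (1 / 2) g := by
    rw [bdryNorm_half]
    have hC' : (C * (1 + d) : ℝ≥0∞) ≠ ⊤ := by finiteness
    -- A factor moves into an infimum over a possibly empty family only if it is nonzero. If C = 0,
    -- the trace inequality gives g = 0 at once, an extension existing because the infimum is
    -- finite.
    rcases eq_or_ne (C * (1 + d) : ℝ≥0∞) 0 with h0 | h0
    · have hC0 : (C : ℝ≥0∞) = 0 := by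
        rcases mul_eq_zero.1 h0 with h | h
        · exact h
        · simp at h
      by_cases hex : ∃ u, IsTrace Ω Ω u g
      · obtain ⟨u, hu, w, hw, h⟩ := hex
        have h1 := hC 1 le_rfl Ω inter_subset_right u g w hu hw (Lp.aestronglyMeasurable g) h
        rw [hC0, zero_mul, Real.sqrt_one, ENNReal.ofReal_one, one_mul, ← Lp.enorm_def] at h1
        exact h1.trans zero_le
      · rw [bdryNorm_half, iInf₂_eq_top.2 fun u hu => absurd ⟨u, hu⟩ hex] at hg
        exact absurd hg ENNReal.top_ne_zero
    simp_rw [ENNReal.mul_iInf_of_ne h0 hC']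
    refine le_iInf₂ fun u hu => ?_
    obtain ⟨hu, w, hw, h⟩ := hu
    have h1 := hC 1 le_rfl Ω inter_subset_right u g w hu hw (Lp.aestronglyMeasurable g) h
    rw [Real.sqrt_one, ENNReal.ofReal_one, one_mul, one_mul, ← Lp.enorm_def] at h1
    refine h1.trans ?_
    rw [mul_assoc]
    refine mul_le_mul_right ?_ _
    have hsq := IsTrace.sobolevNorm_one_sq hΩ.isOpen hu hw h
    have hS : ∀ x : ℝ≥0∞, x ^ 2 ≤ sobolevNorm 1 Ω u ^ 2 → x ≤ sobolevNorm 1 Ω u := fun x =>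
      (ENNReal.pow_le_pow_left_iff (by norm_num)).1
    have h2 : ∑ i, eLpNorm (w i) 2 (vol Ω) ≤ ∑ _i : Fin d, sobolevNorm 1 Ω u :=
      Finset.sum_le_sum fun i _ => hS _ (hsq ▸ le_add_of_le_right
        (Finset.single_le_sum (f := fun i => eLpNorm (w i) 2 (vol Ω) ^ 2)
          (fun _ _ => zero_le) (Finset.mem_univ i)))
    calc _ ≤ sobolevNorm 1 Ω u + ∑ _i : Fin d, sobolevNorm 1 Ω u :=
          add_le_add (hS _ (hsq ▸ le_self_add)) h2
      _ = _ := by simp [add_mul]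
  rw [hg, mul_zero, nonpos_iff_eq_zero, enorm_eq_zero] at hle
  exact hle

lemma IsTraceWith.const_mul {Ω U : Set (E d)} (a : ℂ) {u g g' : E d → ℂ} {w : Fin d → E d → ℂ}
    (h : IsTraceWith Ω U u w g) (hu : MemLp u 2 (vol U)) (hw : ∀ i, MemLp (w i) 2 (vol U))
    (hg : AEStronglyMeasurable g (surf Ω)) (hg' : g' =ᵐ[surf Ω] fun x => a * g x) :
    IsTraceWith Ω U (fun x => a * u x) (fun i x => a * w i x) g' :=
  h.lin a (v := 0) (z := fun _ => 0) (h := 0)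
    (isTraceWith_zero ae_eq_rfl (fun _ => ae_eq_rfl) ae_eq_rfl) hu.1 aestronglyMeasurable_zero
    (fun i => (hw i).1) (fun _ => aestronglyMeasurable_zero) hg aestronglyMeasurable_zero
    (by simp) (fun i => by simp) (by simpa using hg')

lemma IsTrace.const_mul {Ω U : Set (E d)} (a : ℂ) {u g g' : E d → ℂ} (h : IsTrace Ω U u g)
    (hg : AEStronglyMeasurable g (surf Ω)) (hg' : g' =ᵐ[surf Ω] fun x => a * g x) :
    IsTrace Ω U (fun x => a * u x) g' := by
  obtain ⟨hu, w, hw, h⟩ := h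
  exact ⟨hu.const_mul a, _, fun i => (hw i).const_mul a, h.const_mul a hu hw hg hg'⟩

lemma coeFn_smul_mul {α : Type*} [MeasurableSpace α] {μ : Measure α} (a : ℂ) (f : Lp ℂ 2 μ) :
    ⇑(a • f) =ᵐ[μ] fun x => a * f x := by
  filter_upwards [Lp.coeFn_smul a f] with x hx
  simp [hx]

lemma enorm_ne_zero_of_ne {a : ℂ} (ha : a ≠ 0) : ‖a‖ₑ ≠ 0 := by simpa using ha

lemma bdryNorm_half_smul_le {Ω : Set (E d)} (hΩ : IsOpen Ω) {a : ℂ} (ha : a ≠ 0) (g : L2Bdry Ω) :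
    bdryNorm Ω (1 / 2) (a • g : L2Bdry Ω) ≤ ‖a‖ₑ * bdryNorm Ω (1 / 2) g := by
  rw [bdryNorm_half, bdryNorm_half]
  simp_rw [ENNReal.mul_iInf_of_ne (enorm_ne_zero_of_ne ha) enorm_ne_top]
  refine le_iInf₂ fun u hu => ?_
  have htr : IsTrace Ω Ω (fun x => a * u x) (a • g : L2Bdry Ω) :=
    IsTrace.const_mul a hu (Lp.aestronglyMeasurable g) (coeFn_smul_mul a g)
  refine iInf₂_le_of_le _ htr ?_
  rw [← ENNReal.pow_le_pow_left_iff (n := 2) (by norm_num), mul_pow, sobolevNorm_one_sq,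
    sobolevNorm_one_sq, mul_add, ← mul_pow, ← mul_pow]
  gcongr <;> exact gradNorm_lin hΩ ha hu.1 ae_eq_rfl

lemma slobodeckij_const_mul {ν : Measure (E d)} {m θ : ℝ} (a : ℂ) {g g' : E d → ℂ}
    (hg : g' =ᵐ[ν] fun x => a * g x) : slobodeckij ν m θ g' = ‖a‖ₑ * slobodeckij ν m θ g := by
  have e1 := (Measure.quasiMeasurePreserving_fst (μ := ν) (ν := ν)).ae_eq_comp hg
  have e2 := (Measure.quasiMeasurePreserving_snd (μ := ν) (ν := ν)).ae_eq_comp hg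
  rw [slobodeckij, slobodeckij, ← eLpNorm_const_smul]
  refine eLpNorm_congr_ae ?_
  filter_upwards [e1, e2] with p h1 h2
  simp only [Function.comp] at h1 h2
  simp only [h1, h2, Pi.smul_apply, Complex.real_smul, smul_eq_mul]
  ring

lemma bdrySeminorm_smul_le {Ω : Set (E d)} {t : ℝ} {a : ℂ} (ha : a ≠ 0) (g : L2Bdry Ω) :
    bdrySeminorm Ω t (a • g : L2Bdry Ω) ≤ ‖a‖ₑ * bdrySeminorm Ω t g := by
  have hg := coeFn_smul_mul a g
  have hsc : ∀ v : E d → ℂ, eLpNorm (fun x => a * v x) 2 (surf Ω) = ‖a‖ₑ * eLpNorm v 2 (surf Ω) :=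
    fun v => by rw [← eLpNorm_const_smul]; rfl
  unfold bdrySeminorm
  split_ifs with h0 h1
  · rw [eLpNorm_congr_ae hg, hsc]
  · rw [slobodeckij_const_mul a hg]
  · simp_rw [ENNReal.mul_iInf_of_ne (enorm_ne_zero_of_ne ha) enorm_ne_top]
    refine le_iInf₂ fun w hw => ?_
    have hz : IsTangGrad Ω (0 : E d → ℂ) fun _ _ => 0 := by
      have e : ∀ i, tangDeriv Ω (0 : E d → ℂ) i = 0 := fun i => funext fun x => by
        simp [tangDeriv]
      have e' : (fun _ : E d => (0 : ℂ)) = 0 := rfl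
      refine ⟨fun i => MemLp.zero, fun _ => 0, fun n => contDiff_const, fun n i => ?_, ?_,
        fun i => ?_⟩
      · rw [e]; exact aestronglyMeasurable_zero
      · simp
      · simp [e, e']
    refine (iInf₂_le _ (hw.lin a hz (Lp.aestronglyMeasurable g) aestronglyMeasurable_zero
      (by simpa using hg))).trans (le_of_eq ?_)
    simp only [add_zero, hsc, mul_pow]
    rw [← Finset.mul_sum, ENNReal.mul_rpow_of_nonneg _ _ (by norm_num), sq_rpow_half]

lemma bdrySeminorm_conj_le {Ω : Set (E d)} {t : ℝ} {g g' : E d → ℂ}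
    (hg : g' =ᵐ[surf Ω] fun x => star (g x)) : bdrySeminorm Ω t g' ≤ bdrySeminorm Ω t g := by
  unfold bdrySeminorm
  split_ifs with h0 h1
  · rw [eLpNorm_star _ _ _ hg]
  · rw [slobodeckij_conj hg]
  · refine le_iInf₂ fun w hw => (iInf₂_le _ (hw.conj hg)).trans (le_of_eq ?_)
    simp_rw [fun i => eLpNorm_star (surf Ω) (w i) (fun x => star (w i x)) ae_eq_rfl]

/-! ### The energy norm -/

variable {Ω : Set (E d)} {t k : ℝ}

lemma energyNorm_nonneg (u : Energy Ω t) : 0 ≤ energyNorm k u := Real.sqrt_nonneg _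

lemma conj_conj (u : Energy Ω t) : conj (conj u) = u := by
  apply Subtype.ext
  simp [conj]

lemma Lp_star_sub {α : Type*} [MeasurableSpace α] {μ : Measure α} (f g : Lp ℂ 2 μ) :
    star (f - g) = star f - star g := by
  refine Lp.ext ?_
  filter_upwards [Lp.coeFn_star (f - g), Lp.coeFn_sub f g, Lp.coeFn_sub (star f) (star g),
    Lp.coeFn_star f, Lp.coeFn_star g] with x h1 h2 h3 h4 h5
  rw [h1, h3, Pi.star_apply, h2, Pi.sub_apply, Pi.sub_apply, h4, h5, Pi.star_apply,
    Pi.star_apply, star_sub]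

lemma Lp_norm_star {α : Type*} [MeasurableSpace α] {μ : Measure α} (f : Lp ℂ 2 μ) :
    ‖star f‖ = ‖f‖ := by
  rw [Lp.norm_def, Lp.norm_def, eLpNorm_star μ f _ (Lp.coeFn_star f)]

lemma conj_sub (u v : Energy Ω t) : conj (u - v) = conj u - conj v := by
  apply Subtype.ext
  refine Prod.ext (Lp_star_sub _ _) (Prod.ext (funext fun i => Lp_star_sub _ _) (Lp_star_sub _ _))

/-- Common source of homogeneity (a = |scalar|) and conjugation invariance (a = 1). -/
lemma energyNorm_le_of (hk : 0 ≤ k) {u v : Energy Ω t} {a : ℝ} (ha : 0 ≤ a)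
    (h0 : ‖fn u‖ ≤ a * ‖fn v‖)
    (h1 : (bdrySeminorm Ω t (tr u : L2Bdry Ω)).toReal
      ≤ a * (bdrySeminorm Ω t (tr v : L2Bdry Ω)).toReal)
    (h2 : ∀ i, ‖grad u i‖ ≤ a * ‖grad v i‖) : energyNorm k u ≤ a * energyNorm k v := by
  have hsq : ∀ {x y : ℝ}, 0 ≤ x → x ≤ a * y → x ^ 2 ≤ a ^ 2 * y ^ 2 := fun hx hxy => by
    rw [← mul_pow]; exact pow_le_pow_left₀ hx hxy 2
  rw [energyNorm, energyNorm, ← Real.sqrt_sq ha, ← Real.sqrt_mul (sq_nonneg a)]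
  refine Real.sqrt_le_sqrt ?_
  rw [mul_add, mul_add, Finset.mul_sum]
  have hkt : 0 ≤ k ^ (1 - 2 * t) := Real.rpow_nonneg hk _
  refine add_le_add (add_le_add ?_ ?_) (Finset.sum_le_sum fun i _ => hsq (norm_nonneg _) (h2 i))
  · rw [mul_left_comm]
    exact mul_le_mul_of_nonneg_left (hsq (norm_nonneg _) h0) (sq_nonneg k)
  · rw [mul_left_comm]
    exact mul_le_mul_of_nonneg_left (hsq ENNReal.toReal_nonneg h1) hkt

lemma energyNorm_smul_le (hk : 0 ≤ k) {a : ℂ} (ha : a ≠ 0) (u : Energy Ω t) :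
    energyNorm k (a • u) ≤ ‖a‖ * energyNorm k u := by
  refine energyNorm_le_of hk (norm_nonneg a) (norm_smul a (fn u)).le ?_
    fun i => (norm_smul a (grad u i)).le
  have hfin : bdrySeminorm Ω t (tr u : L2Bdry Ω) ≠ ⊤ := (tr u).2.ne
  have h := ENNReal.toReal_mono (ENNReal.mul_ne_top enorm_ne_top hfin)
    (bdrySeminorm_smul_le (t := t) ha (tr u : L2Bdry Ω))
  rwa [ENNReal.toReal_mul, toReal_enorm] at h

lemma energyNorm_neg (hk : 0 ≤ k) (u : Energy Ω t) : energyNorm k (-u) = energyNorm k u := by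
  have h : ∀ v : Energy Ω t, energyNorm k (-v) ≤ energyNorm k v := fun v => by
    have h := energyNorm_smul_le hk (a := -1) (by norm_num) v
    have e : (-1 : ℂ) • v = -v := Subtype.ext (neg_one_smul ℂ v.1)
    rwa [e, norm_neg, norm_one, one_mul] at h
  exact le_antisymm (h u) (by simpa using h (-u))

lemma energyNorm_conj (hk : 0 ≤ k) (u : Energy Ω t) : energyNorm k (conj u) = energyNorm k u := by
  have h : ∀ v : Energy Ω t, energyNorm k (conj v) ≤ energyNorm k v := fun v => by
    have := energyNorm_le_of hk (u := conj v) (v := v) zero_le_one ?_ ?_ fun i => ?_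
    · simpa using this
    · rw [one_mul]; exact (Lp_norm_star (fn v)).le
    · rw [one_mul]
      exact ENNReal.toReal_mono (tr v).2.ne (bdrySeminorm_conj_le (Lp.coeFn_star _))
    · rw [one_mul]; exact (Lp_norm_star (grad v i)).le
  exact le_antisymm (h u) (by simpa [conj_conj] using h (conj u))

lemma energyNorm_zero (hk : 0 ≤ k) : energyNorm k (0 : Energy Ω t) = 0 := by
  -- The scaling bound needs a nonzero factor; factor 1/2 bounds the norm of zero by half of itself.
  have h := energyNorm_smul_le hk (a := (2⁻¹ : ℂ)) (by norm_num) (0 : Energy Ω t)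
  rw [smul_zero] at h
  have := energyNorm_nonneg (k := k) (0 : Energy Ω t)
  norm_num at h
  linarith

lemma energyNorm_sq (hk : 0 ≤ k) (u : Energy Ω t) : energyNorm k u ^ 2 = k ^ 2 * ‖fn u‖ ^ 2
    + k ^ (1 - 2 * t) * (bdrySeminorm Ω t (tr u : L2Bdry Ω)).toReal ^ 2
    + ∑ i, ‖grad u i‖ ^ 2 := by
  have hkt : 0 ≤ k ^ (1 - 2 * t) := Real.rpow_nonneg hk _
  exact Real.sq_sqrt (by positivity)

lemma mul_norm_fn_le (hk : 0 ≤ k) (u : Energy Ω t) : k * ‖fn u‖ ≤ energyNorm k u := by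
  have hkt : 0 ≤ k ^ (1 - 2 * t) := Real.rpow_nonneg hk _
  refine Real.le_sqrt_of_sq_le ?_
  rw [mul_pow, add_assoc]
  exact le_add_of_nonneg_right (by positivity)

lemma sum_norm_grad_sq_le (hk : 0 ≤ k) (u : Energy Ω t) :
    ∑ i, ‖grad u i‖ ^ 2 ≤ energyNorm k u ^ 2 := by
  have hkt : 0 ≤ k ^ (1 - 2 * t) := Real.rpow_nonneg hk _
  rw [energyNorm_sq hk]
  exact le_add_of_nonneg_left (by positivity)

lemma norm_grad_le (hk : 0 ≤ k) (u : Energy Ω t) (i : Fin d) : ‖grad u i‖ ≤ energyNorm k u := by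
  refine (pow_le_pow_iff_left₀ (norm_nonneg _) (energyNorm_nonneg u) two_ne_zero).1 ?_
  exact (Finset.single_le_sum (f := fun i => ‖grad u i‖ ^ 2) (fun _ _ => sq_nonneg _)
    (Finset.mem_univ i)).trans (sum_norm_grad_sq_le hk u)

lemma hOneNorm_le {k₀ : ℝ} (hk₀ : 0 < k₀) (hk : k₀ ≤ k) (u : Energy Ω t) :
    hOneNorm u ≤ ENNReal.ofReal ((1 / k₀ + 1) * energyNorm k u) := by
  have hkpos : 0 < k := hk₀.trans_le hk
  have hE := energyNorm_nonneg (k := k) u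
  rw [← ENNReal.pow_le_pow_left_iff (n := 2) (by norm_num), hOneNorm, rpow_half_sq,
    ← ENNReal.ofReal_pow (by positivity)]
  simp_rw [← ofReal_norm, ← ENNReal.ofReal_pow (norm_nonneg _)]
  rw [← ENNReal.ofReal_sum_of_nonneg fun i _ => sq_nonneg _,
    ← ENNReal.ofReal_add (sq_nonneg _) (Finset.sum_nonneg fun i _ => sq_nonneg _)]
  refine ENNReal.ofReal_le_ofReal ?_
  have h1 : ‖fn u‖ ≤ 1 / k₀ * energyNorm k u := by
    rw [one_div, ← div_eq_inv_mul, le_div_iff₀ hk₀, mul_comm]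
    exact (mul_le_mul_of_nonneg_right hk (norm_nonneg _)).trans (mul_norm_fn_le hkpos.le u)
  have h2 := sum_norm_grad_sq_le hkpos.le u
  have h3 : ‖fn u‖ ^ 2 ≤ (1 / k₀ * energyNorm k u) ^ 2 := pow_le_pow_left₀ (norm_nonneg _) h1 2
  -- The cross term in the square of 1 / k₀ + 1, which may be dropped.
  have h4 : 0 ≤ 1 / k₀ * energyNorm k u ^ 2 := by positivity
  nlinarith

/-- The trace inequality in terms of the energy norm. -/
lemma exists_sqrt_mul_norm_tr_le (hΩ : IsLipschitzDomain Ω) {k₀ : ℝ} (hk₀ : 0 < k₀) (t : ℝ) :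
    ∃ C : ℝ, 0 ≤ C ∧ ∀ k, k₀ ≤ k → ∀ u : Energy Ω t,
      √k * ‖(tr u : L2Bdry Ω)‖ ≤ C * energyNorm k u := by
  obtain ⟨C, hC⟩ := trace_ineq_weighted hΩ one_pos hk₀
  refine ⟨C * (1 + d), by positivity, fun k hk u => ?_⟩
  have hkpos : 0 < k := hk₀.trans_le hk
  have h := hC k hk Ω inter_subset_right (fn u) (tr u : L2Bdry Ω) (fun i => grad u i)
    (Lp.memLp _) (fun i => Lp.memLp _) (Lp.aestronglyMeasurable _) u.2.2.1
  simp_rw [← Lp.enorm_def, ← ofReal_norm] at h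
  rw [← ENNReal.ofReal_mul (Real.sqrt_nonneg k), ← ENNReal.ofReal_mul hkpos.le,
    ← ENNReal.ofReal_sum_of_nonneg fun i _ => norm_nonneg _,
    ← ENNReal.ofReal_add (by positivity) (Finset.sum_nonneg fun i _ => norm_nonneg _),
    ← ENNReal.ofReal_coe_nnreal, ← ENNReal.ofReal_mul C.coe_nonneg,
    ENNReal.ofReal_le_ofReal_iff (mul_nonneg C.coe_nonneg (add_nonneg (by positivity)
      (Finset.sum_nonneg fun i _ => norm_nonneg _)))] at h
  refine h.trans ?_
  rw [mul_assoc]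
  refine mul_le_mul_of_nonneg_left ?_ C.coe_nonneg
  have h1 : ∑ i, ‖grad u i‖ ≤ ∑ _i : Fin d, energyNorm k u :=
    Finset.sum_le_sum fun i _ => norm_grad_le hkpos.le u i
  have h2 := mul_norm_fn_le hkpos.le u
  simp only [Finset.sum_const, Finset.card_univ, Fintype.card_fin, nsmul_eq_mul] at h1
  linarith

end

section

variable {d : ℕ}

/-! ### Analyticity classes: monotonicity and scaling -/

lemma AnaBound.mono {k M M' γ γ' : ℝ} {U V : Set (E d)} {v : E d → ℂ} (h : AnaBound k M γ V v)
    (hk : 0 ≤ k) (hM : 0 ≤ M) (hMM : M ≤ M') (hγ : 0 ≤ γ) (hγγ : γ ≤ γ') (hUV : U ⊆ V) :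
    AnaBound k M' γ' U v := by
  refine ⟨h.1.mono_measure (Measure.restrict_mono hUV le_rfl), fun n => ?_⟩
  refine (gradNorm_mono hUV n v).trans ((h.2 n).trans (ENNReal.ofReal_le_ofReal ?_))
  have : 0 ≤ max (n : ℝ) k := le_max_of_le_right hk
  have hM' := hM.trans hMM
  gcongr

lemma AnaBound.const_mul {k M γ : ℝ} {U : Set (E d)} (hU : IsOpen U) {a : ℂ} (ha : a ≠ 0)
    {v v' : E d → ℂ} (h : AnaBound k M γ U v) (hv' : v' =ᵐ[vol U] fun x => a * v x) :
    AnaBound k (‖a‖ * M) γ U v' := by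
  refine ⟨(memLp_congr_ae hv').2 (h.1.const_mul a), fun n => ?_⟩
  refine (gradNorm_lin hU ha h.1 hv').trans ?_
  rw [mul_assoc, mul_assoc, ENNReal.ofReal_mul (norm_nonneg a), ofReal_norm, ← mul_assoc M]
  exact mul_le_mul_right (h.2 n) _

lemma AnaBound.ae_eq_zero {k γ : ℝ} {U : Set (E d)} (hU : IsOpen U) {v : E d → ℂ}
    (h : AnaBound k 0 γ U v) : v =ᵐ[vol U] 0 := by
  have h0 := h.2 0
  rw [gradNorm_zero_eq hU h.1, zero_mul, zero_mul, ENNReal.ofReal_zero,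
    nonpos_iff_eq_zero] at h0
  exact (eLpNorm_eq_zero_iff h.1.1 (by norm_num)).1 h0

lemma AnaPiecewise.mono {k M M' γ γ' : ℝ} {Pc : Set (Set (E d))} {v : E d → ℂ}
    (h : AnaPiecewise k M γ Pc v) (hk : 0 ≤ k) (hM : 0 ≤ M) (hMM : M ≤ M') (hγ : 0 ≤ γ)
    (hγγ : γ ≤ γ') : AnaPiecewise k M' γ' Pc v :=
  fun P hP => (h P hP).mono hk hM hMM hγ hγγ subset_rfl

lemma AnaPiecewise.smul {Ω : Set (E d)} {Pc : Set (Set (E d))} (hPc : IsLipschitzPartition Ω Pc)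
    {k M γ : ℝ} {a : ℂ} (ha : a ≠ 0) {f : L2 Ω} (h : AnaPiecewise k M γ Pc f) :
    AnaPiecewise k (‖a‖ * M) γ Pc (a • f : L2 Ω) := fun P hP =>
  (h P hP).const_mul (hPc.lipschitz P hP).isOpen ha
    (ae_restrict_of_ae_restrict_of_subset (hPc.subset P hP) (coeFn_smul_mul a f))

lemma AnaPiecewise.eq_zero {Ω : Set (E d)} {Pc : Set (Set (E d))}
    (hPc : IsLipschitzPartition Ω Pc) {k γ : ℝ} {f : L2 Ω} (h : AnaPiecewise k 0 γ Pc f) :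
    f = 0 := by
  rw [← enorm_eq_zero, ← brokenNorm_zero_eq hPc, brokenNorm]
  have h0 : ∀ P : Pc, sobolevNorm 0 (P : Set (E d)) f ^ 2 = 0 := fun P => by
    have hP := h P P.2
    have hU := (hPc.lipschitz P P.2).isOpen
    rw [sobolevNorm_zero_sq, gradNorm_zero_eq hU hP.1, eLpNorm_congr_ae (hP.ae_eq_zero hU)]
    simp
  simp [h0]

lemma isOpen_tube_inter {Ω : Set (E d)} (hΩ : IsOpen Ω) (δ : ℝ) : IsOpen (tube Ω δ ∩ Ω) :=
  Metric.isOpen_thickening.inter hΩ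

lemma IsTrace.mono {Ω U V : Set (E d)} (hUV : U ⊆ V) {u g : E d → ℂ} (h : IsTrace Ω V u g) :
    IsTrace Ω U u g := by
  have hμ : vol U ≤ vol V := Measure.restrict_mono hUV le_rfl
  obtain ⟨hu, w, hw, φ, sφ, a1, a2, a3⟩ := h
  refine ⟨hu.mono_measure hμ, w, fun i => (hw i).mono_measure hμ, φ, sφ, ?_, fun i => ?_, a3⟩
  · exact tendsto_of_tendsto_of_tendsto_of_le_of_le tendsto_const_nhds a1 (fun n => zero_le)
      fun n => eLpNorm_mono_measure _ hμ
  · exact tendsto_of_tendsto_of_tendsto_of_le_of_le tendsto_const_nhds (a2 i) (fun n => zero_le)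
      fun n => eLpNorm_mono_measure _ hμ

lemma AnaBdry.mono {Ω : Set (E d)} {k M M' γ γ' δ δ' : ℝ} {g : E d → ℂ}
    (h : AnaBdry k M γ Ω δ g) (hk : 0 ≤ k) (hM : 0 ≤ M) (hMM : M ≤ M') (hγ : 0 ≤ γ)
    (hγγ : γ ≤ γ') (hδ : δ' ≤ δ) : AnaBdry k M' γ' Ω δ' g := by
  obtain ⟨V, hV, ρ, hρ, htr⟩ := h
  have hsub : tube Ω δ' ∩ Ω ⊆ tube Ω δ ∩ Ω :=
    inter_subset_inter_left _ (Metric.thickening_mono hδ _)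
  exact ⟨V, hV.mono hk hM hMM hγ hγγ hsub, ρ, hρ, htr.mono (inter_subset_inter_right _ hsub)⟩

lemma AnaBdry.smul {Ω : Set (E d)} (hΩ : IsOpen Ω) {k M γ δ : ℝ} {a : ℂ} (ha : a ≠ 0)
    {g : L2Bdry Ω} (h : AnaBdry k M γ Ω δ g) : AnaBdry k (‖a‖ * M) γ Ω δ (a • g : L2Bdry Ω) := by
  obtain ⟨V, hV, ρ, hρ, htr⟩ := h
  exact ⟨_, hV.const_mul (isOpen_tube_inter hΩ δ) ha ae_eq_rfl, ρ, hρ,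
    IsTrace.const_mul a htr (Lp.aestronglyMeasurable g) (coeFn_smul_mul a g)⟩

/-- With M = 0 the extension vanishes, hence so does its gradient, and the trace inequality on a
thin tube forces the trace to vanish. The extension lives only near the boundary, which is why the
trace inequality is localized to tubes. -/
lemma AnaBdry.eq_zero {Ω : Set (E d)} (hΩ : IsLipschitzDomain Ω) {k γ δ : ℝ} (hδ : 0 < δ)
    {g : L2Bdry Ω} (h : AnaBdry k 0 γ Ω δ g) : g = 0 := by
  obtain ⟨V, hV, ρ, hρ, hu, w, hw, htr⟩ := h
  set U := tube Ω ρ ∩ (tube Ω δ ∩ Ω) with hU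
  have hUo : IsOpen U := Metric.isOpen_thickening.inter (isOpen_tube_inter hΩ.isOpen δ)
  have hV0 : V =ᵐ[vol U] 0 := ae_restrict_of_ae_restrict_of_subset inter_subset_right
    (hV.ae_eq_zero (isOpen_tube_inter hΩ.isOpen δ))
  have hw0 : ∀ i, w i =ᵐ[vol U] 0 := fun i =>
    IsWeakDeriv.ae_unique hUo (hw i) MemLp.zero (htr.isWeakDeriv hu hw i)
      (isWeakDeriv_zero hV0 ae_eq_rfl)
  obtain ⟨C, hC⟩ := trace_ineq_weighted hΩ (lt_min hρ hδ) one_pos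
  have hsub : tube Ω (min ρ δ) ∩ Ω ⊆ U := fun x hx =>
    ⟨Metric.thickening_mono (min_le_left _ _) _ hx.1,
      Metric.thickening_mono (min_le_right _ _) _ hx.1, hx.2⟩
  have h1 := hC 1 le_rfl U hsub V g w hu hw (Lp.aestronglyMeasurable g) htr
  simp only [fun i => eLpNorm_congr_ae (p := 2) (hw0 i), eLpNorm_congr_ae (p := 2) hV0] at h1
  rw [Real.sqrt_one, ENNReal.ofReal_one, one_mul, ← Lp.enorm_def] at h1
  simpa using h1

/-! ### Linearity of the problems -/

variable {Ω : Set (E d)} {t k : ℝ}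

namespace Problem

variable (p : Problem Ω t) (k)

/-- The form `b_k^-` as a sesquilinear map. -/
def formM : AntidualOp (Energy Ω t) :=
  p.a k - p.TvolM k -
    { toFun := fun u => (p.TbdryM k (tr u)).comp tr
      map_add' := fun u v => by ext; simp
      map_smul' := fun a u => by ext; simp }

lemma formM_apply (u v : Energy Ω t) : p.formM k u v = p.bM k u v := rfl

variable {p k}

lemma IsSolM.smul {f : L2 Ω} {g : L2Bdry Ω} {u : Energy Ω t} (h : p.IsSolM k f g u) (a : ℂ) :
    p.IsSolM k (a • f) (a • g) (a • u) := fun v => by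
  have h1 := h v
  rw [← formM_apply] at h1 ⊢
  rw [map_smul, LinearMap.smul_apply, h1, inner_smul_right, inner_smul_right, smul_eq_mul, mul_add]

lemma isSolM_zero : p.IsSolM k 0 0 0 := fun v => by
  rw [← formM_apply]
  simp

end Problem

/-! ### Best approximation and approximation factors -/

lemma bestApprox_le (Vh : Submodule ℂ (Energy Ω t)) (u : Energy Ω t) {v : Energy Ω t}
    (hv : v ∈ Vh) : bestApprox k Vh u ≤ energyNorm k (u - v) :=
  ciInf_le ⟨0, by rintro _ ⟨v, rfl⟩; exact energyNorm_nonneg _⟩ (⟨v, hv⟩ : Vh)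

lemma bestApprox_nonneg (Vh : Submodule ℂ (Energy Ω t)) (u : Energy Ω t) :
    0 ≤ bestApprox k Vh u :=
  Real.iInf_nonneg fun _ => energyNorm_nonneg _

lemma bestApprox_zero (hk : 0 ≤ k) (Vh : Submodule ℂ (Energy Ω t)) : bestApprox k Vh 0 = 0 := by
  refine le_antisymm ?_ (bestApprox_nonneg Vh 0)
  simpa [energyNorm_zero hk] using bestApprox_le (k := k) Vh 0 Vh.zero_mem

lemma bestApprox_smul_le (hk : 0 ≤ k) (Vh : Submodule ℂ (Energy Ω t)) {a : ℂ} (ha : a ≠ 0)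
    (u : Energy Ω t) : bestApprox k Vh (a • u) ≤ ‖a‖ * bestApprox k Vh u := by
  rw [bestApprox.eq_1 k Vh u, Real.mul_iInf_of_nonneg (norm_nonneg a)]
  refine le_ciInf fun v => (bestApprox_le Vh _ (Vh.smul_mem a v.2)).trans ?_
  have e : a • u - a • (v : Energy Ω t) = a • (u - v) :=
    Subtype.ext (smul_sub a u.1 (v : Energy Ω t).1).symm
  rw [e]
  exact energyNorm_smul_le hk ha _

/-- An inequality against all elements of `V_h` holds with the best approximation. -/
lemma le_mul_bestApprox {Vh : Submodule ℂ (Energy Ω t)} {u : Energy Ω t} {x c : ℝ} (hc : 0 ≤ c)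
    (h : ∀ v ∈ Vh, x ≤ c * energyNorm k (u - v)) : x ≤ c * bestApprox k Vh u := by
  rw [bestApprox, Real.mul_iInf_of_nonneg hc]
  exact le_ciInf fun v => h v v.2

/-- Homogeneity argument common to the two approximation factors. -/
lemma ofReal_bestApprox_le_of_scaled (hk : 0 ≤ k) (Vh : Submodule ℂ (Energy Ω t))
    (u : Energy Ω t) {c : ℝ} (hc : 0 < c) {η : ℝ≥0∞}
    (h : ENNReal.ofReal (bestApprox k Vh (((c⁻¹ : ℝ) : ℂ) • u)) ≤ η) :
    ENNReal.ofReal (bestApprox k Vh u) ≤ ENNReal.ofReal c * η := by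
  have hc' : (c : ℂ) ≠ 0 := by exact_mod_cast hc.ne'
  have e : u = (c : ℂ) • (((c⁻¹ : ℝ) : ℂ) • u) := by
    rw [smul_smul, Complex.ofReal_inv, mul_inv_cancel₀ hc', one_smul]
  have h1 := bestApprox_smul_le hk Vh hc' (((c⁻¹ : ℝ) : ℂ) • u)
  rw [← e, Complex.norm_of_nonneg hc.le] at h1
  calc _ ≤ ENNReal.ofReal (c * bestApprox k Vh (((c⁻¹ : ℝ) : ℂ) • u)) :=
        ENNReal.ofReal_le_ofReal h1
    _ = ENNReal.ofReal c * ENNReal.ofReal (bestApprox k Vh (((c⁻¹ : ℝ) : ℂ) • u)) :=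
        ENNReal.ofReal_mul hc.le
    _ ≤ _ := mul_le_mul_right h _

lemma bdryNorm_half_smul (hΩ : IsOpen Ω) {a : ℂ} (ha : a ≠ 0) (g : L2Bdry Ω) :
    bdryNorm Ω (1 / 2) (a • g : L2Bdry Ω) = ‖a‖ₑ * bdryNorm Ω (1 / 2) g := by
  refine le_antisymm (bdryNorm_half_smul_le hΩ ha g) ?_
  have h := bdryNorm_half_smul_le hΩ (inv_ne_zero ha) (a • g)
  rw [smul_smul, inv_mul_cancel₀ ha, one_smul, enorm_inv ha] at h
  calc _ ≤ ‖a‖ₑ * (‖a‖ₑ⁻¹ * bdryNorm Ω (1 / 2) (a • g : L2Bdry Ω)) := mul_le_mul_right h _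
    _ = _ := by rw [← mul_assoc, ENNReal.mul_inv_cancel (enorm_ne_zero_of_ne ha) enorm_ne_top,
      one_mul]

/-- Data of positive size are normalized to size 1 and the solution scales along. Data of size zero
vanish, and then uniqueness makes the solution zero. -/
lemma ofReal_bestApprox_le_etaF (hΩ : IsLipschitzDomain Ω) {Pc : Set (Set (E d))}
    (hPc : IsLipschitzPartition Ω Pc) {p : Problem Ω t} (hk : 0 ≤ k)
    (huniq : ∀ u, p.IsSolM k 0 0 u → u = 0) (Vh : Submodule ℂ (Energy Ω t))
    {f : L2 Ω} {g : L2Bdry Ω} {u : Energy Ω t} (hu : p.IsSolM k f g u)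
    (hfin : brokenNorm 0 Pc f + bdryNorm Ω (1 / 2) g ≠ ⊤) :
    ENNReal.ofReal (bestApprox k Vh u) ≤
      (brokenNorm 0 Pc f + bdryNorm Ω (1 / 2) g) * etaF Pc p k Vh 1 := by
  set N := brokenNorm 0 Pc f + bdryNorm Ω (1 / 2) g with hN
  rcases eq_or_ne N 0 with h0 | h0
  · obtain ⟨hf, hg⟩ := add_eq_zero.1 h0
    rw [brokenNorm_zero_eq hPc, enorm_eq_zero] at hf
    have hg := eq_zero_of_bdryNorm_half hΩ hg
    subst hf hg
    rw [huniq u hu, bestApprox_zero hk]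
    simp
  · have hc : 0 < N.toReal := ENNReal.toReal_pos h0 hfin
    have ha : ((N.toReal⁻¹ : ℝ) : ℂ) ≠ 0 := by exact_mod_cast (inv_pos.2 hc).ne'
    have hae : ‖((N.toReal⁻¹ : ℝ) : ℂ)‖ₑ = N⁻¹ := by
      rw [← ofReal_norm, Complex.norm_of_nonneg (inv_pos.2 hc).le, ENNReal.ofReal_inv_of_pos hc,
        ENNReal.ofReal_toReal hfin]
    have key := ofReal_bestApprox_le_of_scaled hk Vh u hc (η := etaF Pc p k Vh 1) ?_
    · rwa [ENNReal.ofReal_toReal hfin] at key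
    · refine le_iSup_of_le (((N.toReal⁻¹ : ℝ) : ℂ) • f) <|
        le_iSup_of_le (((N.toReal⁻¹ : ℝ) : ℂ) • g) <|
        le_iSup_of_le (((N.toReal⁻¹ : ℝ) : ℂ) • u) <| le_iSup_of_le ?_ <|
        le_iSup_of_le (hu.smul _) le_rfl
      have e : (1 : ℝ) - 1 / 2 = 1 / 2 := by norm_num
      rw [sub_self, e, brokenNorm_zero_eq hPc, bdryNorm_half_smul hΩ.isOpen ha, enorm_smul,
        ← brokenNorm_zero_eq hPc, ← mul_add, hae, ← hN, ENNReal.inv_mul_cancel h0 hfin]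

/-- The same normalization, now of the constants `Mf` and `Mg`; if both are zero the data vanish by
analyticity with bound zero. -/
lemma ofReal_bestApprox_le_etaA (hΩ : IsLipschitzDomain Ω) {Pc : Set (Set (E d))}
    (hPc : IsLipschitzPartition Ω Pc) {p : Problem Ω t} (hk : 0 < k)
    (huniq : ∀ u, p.IsSolM k 0 0 u → u = 0) (Vh : Submodule ℂ (Energy Ω t)) {δ : ℝ} (hδ : 0 < δ)
    {γ Mf Mg : ℝ} (hMf : 0 ≤ Mf) (hMg : 0 ≤ Mg)
    {f : L2 Ω} {g : L2Bdry Ω} {u : Energy Ω t} (hu : p.IsSolM k f g u)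
    (hf : AnaPiecewise k Mf γ Pc f) (hg : AnaBdry k Mg γ Ω δ g) :
    ENNReal.ofReal (bestApprox k Vh u) ≤
      ENNReal.ofReal (Mf + k * Mg) * etaA Pc p k Vh δ γ := by
  have hkM : 0 ≤ k * Mg := by positivity
  rcases (add_nonneg hMf hkM).eq_or_lt with h0 | h0
  · have hMf0 : Mf = 0 := by linarith
    have hMg0 : Mg = 0 := by
      have : k * Mg = 0 := by linarith
      simpa [hk.ne'] using this
    subst hMf0 hMg0
    have hf0 := hf.eq_zero hPc
    have hg0 := hg.eq_zero hΩ hδ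
    subst hf0 hg0
    rw [huniq u hu, bestApprox_zero hk.le]
    simp
  · set c := Mf + k * Mg with hc
    have hci : 0 < c⁻¹ := inv_pos.2 h0
    have ha : ((c⁻¹ : ℝ) : ℂ) ≠ 0 := by exact_mod_cast hci.ne'
    have hn : ‖((c⁻¹ : ℝ) : ℂ)‖ = c⁻¹ := Complex.norm_of_nonneg hci.le
    refine ofReal_bestApprox_le_of_scaled hk.le Vh u h0 ?_
    refine le_iSup_of_le (((c⁻¹ : ℝ) : ℂ) • f) <| le_iSup_of_le (((c⁻¹ : ℝ) : ℂ) • g) <|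
      le_iSup_of_le (((c⁻¹ : ℝ) : ℂ) • u) <| le_iSup_of_le (c⁻¹ * Mf) <|
      le_iSup_of_le (c⁻¹ * Mg) <| le_iSup_of_le ⟨by positivity, by positivity, ?_⟩ <|
      le_iSup_of_le ⟨?_, ?_⟩ <| le_iSup_of_le (hu.smul _) le_rfl
    · rw [mul_left_comm, ← mul_add, ← hc, inv_mul_cancel₀ h0.ne']
    · have h := hf.smul hPc ha
      rwa [hn] at h
    · have h := hg.smul hΩ.isOpen ha
      rwa [hn] at h

end

section

variable {d : ℕ} {Ω : Set (E d)} {t k : ℝ}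

/-! ### The duality argument -/

/-- If `b_k^-(·, w)` vanishes on `V_h`, then it is controlled by the best approximation. -/
lemma norm_bM_le_bestApprox {p : Problem Ω t} {Vh : Submodule ℂ (Energy Ω t)} {w : Energy Ω t}
    (horth : ∀ v ∈ Vh, p.bM k v w = 0) {B : ℝ} (hB : 0 ≤ B)
    (hb : ∀ u, ‖p.bM k u w‖ ≤ B * energyNorm k u) (u : Energy Ω t) :
    ‖p.bM k u w‖ ≤ B * bestApprox k Vh u := by
  refine le_mul_bestApprox hB fun v hv => ?_
  have e : p.bM k (u - v) w = p.bM k u w := by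
    have h := horth v hv
    simp only [← Problem.formM_apply] at h ⊢
    rw [map_sub, LinearMap.sub_apply, h, sub_zero]
  rw [← e]
  exact hb _

section

variable {Pc : Set (Set (E d))} {k₀ : ℝ} {p : Problem Ω t} {c : Consts}

lemma WP.eq_zero_of_isSolM_zero (hWP : WP Pc k₀ p c) (hk : k₀ ≤ k) {u : Energy Ω t}
    (hu : p.IsSolM k 0 0 u) : u = 0 :=
  (hWP.wellPosed k hk 0 0).unique hu Problem.isSolM_zero

/-- Definiteness comes from well-posedness: by continuity of the form, an element of norm zero
solves the homogeneous problem. -/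
lemma WP.eq_zero_of_energyNorm (hWP : WP Pc k₀ p c) (hk : k₀ ≤ k) {u : Energy Ω t}
    (hu : energyNorm k u = 0) : u = 0 := by
  refine hWP.eq_zero_of_isSolM_zero hk fun v => ?_
  have h := hWP.continuous k hk u v
  rw [hu, mul_zero, zero_mul, norm_le_zero_iff] at h
  simp [h]

/-- The best approximation of the solution for analytic data controlled by `u`. -/
lemma WP.ofReal_bestApprox_le (hWP : WP Pc k₀ p c) (hk₀ : 0 < k₀) (hΩ : IsLipschitzDomain Ω)
    (hPc : IsLipschitzPartition Ω Pc) (hk : k₀ ≤ k) (Vh : Submodule ℂ (Energy Ω t)) {δ δ' : ℝ}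
    (hδ : 0 < δ) (hδδ : δ ≤ δ') {γ : ℝ} (hγ : c.γ₀ δ ≤ γ) {A : ℝ} (u : Energy Ω t)
    {f : L2 Ω} {g : L2Bdry Ω} {Mu Mv : ℝ} (hMu : 0 ≤ Mu) (hMv : 0 ≤ Mv)
    (hf : AnaPiecewise k Mu γ Pc f) (hg : AnaBdry k Mv γ Ω δ' g)
    (hfu : Mu ≤ A * energyNorm k u) (hgu : k * Mv ≤ A * energyNorm k u) {ψ : Energy Ω t}
    (hψ : p.IsSolM k f g ψ) :
    ENNReal.ofReal (bestApprox k Vh ψ) ≤ 2 * ENNReal.ofReal (energyNorm k u) *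
      (ENNReal.ofReal A * etaA Pc p k Vh δ (c.shift δ γ)) := by
  have hkpos : 0 < k := hk₀.trans_le hk
  have hγ0 : 0 ≤ γ := (hWP.γ₀_nonneg δ hδ).trans hγ
  -- The data are analytic with parameter γ, while the factor is taken at ϑ(γ) ≥ γ.
  have hγγ := hWP.le_shift δ hδ γ hγ
  have h := ofReal_bestApprox_le_etaA hΩ hPc hkpos (fun u => hWP.eq_zero_of_isSolM_zero hk) Vh hδ
    hMu hMv hψ (hf.mono hkpos.le hMu le_rfl hγ0 hγγ)
    (hg.mono hkpos.le hMv le_rfl hγ0 hγγ hδδ)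
  -- The factor 2 arises because `Mu` and `k * Mv` are each bounded by A‖u‖.
  have e : ENNReal.ofReal (Mu + k * Mv)
      ≤ 2 * ENNReal.ofReal (energyNorm k u) * ENNReal.ofReal A := by
    calc _ ≤ ENNReal.ofReal (2 * (A * energyNorm k u)) :=
          ENNReal.ofReal_le_ofReal (by linarith)
      _ = _ := by
          rw [ENNReal.ofReal_mul (by norm_num), ENNReal.ofReal_mul' (energyNorm_nonneg u),
            ENNReal.ofReal_ofNat]
          ring
  refine h.trans ((mul_le_mul_left e _).trans (le_of_eq ?_))
  ring

/-- On the orthogonal complement of `V_h` the form `b_k^-` is bounded uniformly in `k`. -/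
lemma WP.exists_bM_bound (hWP : WP Pc k₀ p c) (hk₀ : 0 < k₀) (hΩ : IsLipschitzDomain Ω)
    (hPc : IsLipschitzPartition Ω Pc) {δ : ℝ} (hδ : 0 < δ) (hδM : δ ≤ c.δM)
    (hγM : c.γ₀ δ ≤ c.γM) :
    ∃ C : ℝ, 0 < C ∧ ∀ k, k₀ ≤ k → ∀ Vh : Submodule ℂ (Energy Ω t),
      ENNReal.ofReal (c.cont k) * ENNReal.ofReal (c.AM k)
        * etaA Pc p k Vh δ (c.shift δ c.γM) ≤ 1 →
      ∀ w, (∀ v ∈ Vh, p.bM k v w = 0) →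
        ∀ u, ‖p.bM k u w‖ ≤ C * energyNorm k w * energyNorm k u := by
  obtain ⟨CR, hR⟩ := hWP.splitting
  obtain ⟨Ca, ha⟩ := hWP.a_continuous
  -- The three summands come from a, R⁻ and the analytic part; the given constants carry no sign,
  -- hence the absolute values.
  refine ⟨|Ca| + |CR| + 2, by positivity, fun k hk Vh hη w horth u => ?_⟩
  have hEu := energyNorm_nonneg (k := k) u
  have hEw := energyNorm_nonneg (k := k) w
  obtain ⟨Rvol, Avol, Rbdry, Abdry, e1, e2, hRb, hA⟩ := hR k hk
  obtain ⟨f, g, Mu, Mv, hf, hg, hMu, hMv, af, ag, bu, bv⟩ := hA u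
  obtain ⟨ψ, hψ, -⟩ := hWP.wellPosed k hk f g
  -- The analytic part pairs with `w` as `L²` data, so it equals b⁻(ψ, w), to which orthogonality
  -- applies.
  have hsplit : p.bM k u w
      = p.a k u w - (Rvol u w + Rbdry (tr u) (tr w)) - p.bM k ψ w := by
    rw [hψ w, ← hf w, ← hg (tr w), Problem.bM, e1, e2]
    simp only [LinearMap.add_apply]
    ring
  have hψw : ‖p.bM k ψ w‖ ≤ (c.cont k * energyNorm k w) * bestApprox k Vh ψ :=
    norm_bM_le_bestApprox horth (mul_nonneg (hWP.cont_nonneg k hk) hEw)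
      (fun v => (hWP.continuous k hk v w).trans (le_of_eq (by ring))) ψ
  have hbest : c.cont k * bestApprox k Vh ψ ≤ 2 * energyNorm k u := by
    rw [← ENNReal.ofReal_le_ofReal_iff (by positivity),
      ENNReal.ofReal_mul (hWP.cont_nonneg k hk)]
    have h := hWP.ofReal_bestApprox_le hk₀ hΩ hPc hk Vh hδ hδM hγM u hMu hMv af ag bu bv hψ
    calc _ ≤ ENNReal.ofReal (c.cont k) * (2 * ENNReal.ofReal (energyNorm k u) *
            (ENNReal.ofReal (c.AM k) * etaA Pc p k Vh δ (c.shift δ c.γM))) := mul_le_mul_right h _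
      _ = 2 * ENNReal.ofReal (energyNorm k u) * (ENNReal.ofReal (c.cont k) *
            ENNReal.ofReal (c.AM k) * etaA Pc p k Vh δ (c.shift δ c.γM)) := by ring
      _ ≤ 2 * ENNReal.ofReal (energyNorm k u) * 1 := mul_le_mul_right hη _
      _ = _ := by rw [mul_one, ENNReal.ofReal_mul (by norm_num), ENNReal.ofReal_ofNat]
  have h1 : ‖p.a k u w‖ ≤ |Ca| * energyNorm k u * energyNorm k w :=
    (ha k hk u w).trans (by gcongr; exact le_abs_self Ca)
  have h2 : ‖Rvol u w + Rbdry (tr u) (tr w)‖ ≤ |CR| * energyNorm k u * energyNorm k w :=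
    (norm_add_le _ _).trans ((hRb u w).trans (by gcongr; exact le_abs_self CR))
  have h3 : ‖p.bM k ψ w‖ ≤ 2 * energyNorm k u * energyNorm k w :=
    hψw.trans ((by ring : _ = c.cont k * bestApprox k Vh ψ * energyNorm k w).trans_le
      (mul_le_mul_of_nonneg_right hbest hEw))
  rw [hsplit]
  refine (norm_sub_le _ _).trans ((add_le_add (norm_sub_le _ _) le_rfl).trans ?_)
  linarith

/-- The remainder `R_k^Δ` maps the energy space into the data space of `η_F(1)`. -/
lemma exists_remainder_bound (hk₀ : 0 < k₀) (hΩ : IsLipschitzDomain Ω)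
    (hPc : IsLipschitzPartition Ω Pc) (C₀ : ℝ) :
    ∃ C : ℝ, 0 < C ∧ ∀ k, k₀ ≤ k → ∀ (u : Energy Ω t) (f : L2 Ω) (g : L2Bdry Ω),
      brokenNorm 0 Pc f ≤ ENNReal.ofReal C₀ *
        (ENNReal.ofReal (k ^ 2) * brokenNorm 0 Pc (fn u)
          + ENNReal.ofReal k * brokenNorm 1 Pc (fn u)) →
      bdryNorm Ω (1 / 2) g ≤ ENNReal.ofReal C₀ *
        (ENNReal.ofReal (k ^ (3 / 2 : ℝ)) * bdryNorm Ω 0 (tr u : L2Bdry Ω)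
          + ENNReal.ofReal k * bdryNorm Ω (1 / 2) (tr u : L2Bdry Ω)) →
      brokenNorm 0 Pc f + bdryNorm Ω (1 / 2) g ≤ ENNReal.ofReal (C * (k * energyNorm k u)) := by
  obtain ⟨Ct, hCt, htr⟩ := exists_sqrt_mul_norm_tr_le (t := t) hΩ hk₀
  set D := 1 / k₀ + 1 with hD
  have hDpos : 0 < D := by positivity
  -- The four terms contribute 1 and `D` in the volume, `Ct` and `D` on the boundary; the maximum
  -- makes the constant positive.
  refine ⟨max C₀ 1 * (1 + Ct + 2 * D), by positivity, fun k hk u f g hf hg => ?_⟩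
  have hkpos : 0 < k := hk₀.trans_le hk
  have hE := energyNorm_nonneg (k := k) u
  have hC₀ : ENNReal.ofReal C₀ ≤ ENNReal.ofReal (max C₀ 1) :=
    ENNReal.ofReal_le_ofReal (le_max_left _ _)
  have h1 : ENNReal.ofReal (k ^ 2) * brokenNorm 0 Pc (fn u)
      ≤ ENNReal.ofReal (k * energyNorm k u) := by
    rw [brokenNorm_zero_eq hPc, ← ofReal_norm, ← ENNReal.ofReal_mul (by positivity)]
    refine ENNReal.ofReal_le_ofReal ?_
    rw [pow_two, mul_assoc]
    exact mul_le_mul_of_nonneg_left (mul_norm_fn_le hkpos.le u) hkpos.le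
  have h2 : ENNReal.ofReal k * hOneNorm u ≤ ENNReal.ofReal (D * (k * energyNorm k u)) := by
    refine (mul_le_mul_right (hOneNorm_le hk₀ hk u) _).trans (le_of_eq ?_)
    rw [← ENNReal.ofReal_mul hkpos.le]
    congr 1
    ring
  have h3 : ENNReal.ofReal (k ^ (3 / 2 : ℝ)) * bdryNorm Ω 0 (tr u : L2Bdry Ω)
      ≤ ENNReal.ofReal (Ct * (k * energyNorm k u)) := by
    rw [bdryNorm_zero_eq, ← ofReal_norm, ← ENNReal.ofReal_mul (by positivity)]
    refine ENNReal.ofReal_le_ofReal ?_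
    -- The half power of k beyond the first is exactly what the weighted trace inequality pays for.
    have e : k ^ (3 / 2 : ℝ) = k * √k := by
      rw [Real.sqrt_eq_rpow, show (3 / 2 : ℝ) = 1 + 1 / 2 by norm_num, Real.rpow_add hkpos,
        Real.rpow_one]
    rw [e, mul_assoc, mul_left_comm Ct]
    exact mul_le_mul_of_nonneg_left (htr k hk u) hkpos.le
  have h4 : ENNReal.ofReal k * bdryNorm Ω (1 / 2) (tr u : L2Bdry Ω)
      ≤ ENNReal.ofReal (D * (k * energyNorm k u)) :=
    (mul_le_mul_right (bdryNorm_half_tr_le hΩ.isOpen u) _).trans h2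
  rw [brokenNorm_one_eq hPc] at hf
  calc _ ≤ ENNReal.ofReal (max C₀ 1) * (ENNReal.ofReal (k * energyNorm k u)
          + ENNReal.ofReal (D * (k * energyNorm k u)))
        + ENNReal.ofReal (max C₀ 1) * (ENNReal.ofReal (Ct * (k * energyNorm k u))
          + ENNReal.ofReal (D * (k * energyNorm k u))) :=
        add_le_add (hf.trans (mul_le_mul' hC₀ (add_le_add h1 h2)))
          (hg.trans (mul_le_mul' hC₀ (add_le_add h3 h4)))
    _ = _ := by
        rw [← ENNReal.ofReal_add (by positivity) (by positivity),
          ← ENNReal.ofReal_add (by positivity) (by positivity),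
          ← ENNReal.ofReal_mul (by positivity), ← ENNReal.ofReal_mul (by positivity),
          ← ENNReal.ofReal_add (by positivity) (by positivity)]
        congr 1
        ring

/-- Symmetry moves the error from the first slot to the second at the price of conjugating both
arguments. -/
lemma IsSymm.orthogonal (hsymm : IsSymm k₀ p) (hk : k₀ ≤ k) {Vh : Submodule ℂ (Energy Ω t)}
    (hconj : ∀ v ∈ Vh, conj v ∈ Vh) {e : Energy Ω t} (he : ∀ v ∈ Vh, p.bM k e v = 0) :
    ∀ v ∈ Vh, p.bM k v (conj e) = 0 := fun v hv => by
  rw [(hsymm k hk (conj e) v).1, conj_conj]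
  exact he _ (hconj v hv)

lemma Problem.galerkin_orthogonality {Vh : Submodule ℂ (Energy Ω t)} {f : L2 Ω} {g : L2Bdry Ω}
    {u uh : Energy Ω t} (hu : p.IsSolM k f g u) (huh : p.IsGalerkin k Vh f g uh) :
    ∀ v ∈ Vh, p.bM k (u - uh) v = 0 := fun v hv => by
  have h1 := hu v
  have h2 := huh.2 v hv
  rw [← Problem.formM_apply] at h1 h2 ⊢
  rw [map_sub, LinearMap.sub_apply, h1, h2, sub_self]

/-- Subtracting `conj v - conj uh`, an element of `Vh`, from the conjugate error leaves the
conjugate of `u - v`. -/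
lemma bestApprox_conj_error_le (hk : 0 ≤ k) {Vh : Submodule ℂ (Energy Ω t)}
    (hconj : ∀ v ∈ Vh, conj v ∈ Vh) {u uh : Energy Ω t} (huh : uh ∈ Vh) :
    bestApprox k Vh (conj (u - uh)) ≤ bestApprox k Vh u := by
  rw [← one_mul (bestApprox k Vh u)]
  refine le_mul_bestApprox zero_le_one fun v hv => ?_
  refine (bestApprox_le Vh _ (Vh.sub_mem (hconj v hv) (hconj uh huh))).trans (le_of_eq ?_)
  rw [one_mul, ← energyNorm_conj hk (u - v), conj_sub, conj_sub, sub_sub_sub_cancel_right]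

/-- Quasi-optimality of Galerkin solutions. -/
lemma quasiOptimality (hWP : WP Pc k₀ p c) (hk₀ : 0 < k₀) (hΩ : IsLipschitzDomain Ω)
    (hPc : IsLipschitzPartition Ω Pc) {smax : ℕ} (hAP : AP Pc k₀ p c smax)
    (hsymm : IsSymm k₀ p) {δ : ℝ} (hδ : 0 < δ) (hδM : δ ≤ c.δM) (hδD : δ ≤ c.δD)
    (hγM : c.γ₀ δ ≤ c.γM) (hγD : c.γ₀ δ ≤ c.γD) :
    ∃ μ : ℝ, 0 < μ ∧ ∃ C : ℝ, 0 < C ∧ ∀ k, k₀ ≤ k → ∀ Vh : Submodule ℂ (Energy Ω t),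
      (∀ v ∈ Vh, conj v ∈ Vh) →
      ENNReal.ofReal k * etaF Pc p k Vh 1
        + ENNReal.ofReal (c.AD k) * etaA Pc p k Vh δ (c.shift δ c.γD) ≤ ENNReal.ofReal (μ / 2) →
      ENNReal.ofReal (c.cont k) * ENNReal.ofReal (c.AM k)
        * etaA Pc p k Vh δ (c.shift δ c.γM) ≤ 1 →
      ∀ f g u uh, p.IsSolM k f g u → p.IsGalerkin k Vh f g uh →
        energyNorm k (u - uh) ≤ C * bestApprox k Vh u := by
  obtain ⟨Cb, hCb, hb⟩ := hWP.exists_bM_bound hk₀ hΩ hPc hδ hδM hγM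
  obtain ⟨Cc, hCc, hcoer⟩ := hAP.coercive
  obtain ⟨C₀, hΔ⟩ := hAP.splitting
  obtain ⟨Cr, hCr, hrem⟩ := exists_remainder_bound (t := t) hk₀ hΩ hPc (C₀ 0)
  -- This μ makes the absorbed term exactly half of the coercivity term; the other half gives the
  -- constant 2 Cb / Cc.
  refine ⟨Cc / (Cb * (Cr + 2)), by positivity, 2 * Cb / Cc, by positivity,
    fun k hk Vh hconj hη hη' f g u uh hu huh => ?_⟩
  have hkpos : 0 < k := hk₀.trans_le hk
  set μ := Cc / (Cb * (Cr + 2)) with hμ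
  have horth := hsymm.orthogonal hk hconj (Problem.galerkin_orthogonality hu huh)
  rw [← energyNorm_conj hkpos.le]
  set w := conj (u - uh) with hw
  set N := energyNorm k w with hN
  have hN0 : 0 ≤ N := energyNorm_nonneg w
  have hbw := fun v => norm_bM_le_bestApprox horth (mul_nonneg hCb.le hN0) (hb k hk Vh hη' w horth) v
  obtain ⟨Rvol, Avol, Rbdry, Abdry, e1, e2, hRv, hRb, hA⟩ := hΔ k hk
  have hs : (0 : ℝ) ≤ smax := Nat.cast_nonneg smax
  -- The estimates for R^Δ enter at s = 0, where membership in `H¹` provides the required finiteness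
  -- in the volume and on the boundary.
  have hone : hOneNorm w < ⊤ := (hOneNorm_le hk₀ hk w).trans_lt ENNReal.ofReal_lt_top
  have z1 : (0 : ℝ) + 1 = 1 := zero_add 1
  have z2 : (0 : ℝ) + 1 / 2 = 1 / 2 := zero_add _
  obtain ⟨f₁, hf₁, nf₁⟩ := hRv 0 le_rfl hs w (by rwa [z1, brokenNorm_one_eq hPc])
  obtain ⟨g₁, hg₁, ng₁⟩ := hRb 0 le_rfl hs (tr w)
    (by rw [z2]; exact (bdryNorm_half_tr_le hΩ.isOpen w).trans_lt hone)
  rw [z1] at nf₁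
  rw [z2] at ng₁
  obtain ⟨f₂, g₂, Mu, Mv, hf₂, hg₂, hMu, hMv, af, ag, bu, bv⟩ := hA w
  obtain ⟨ψ₁, hψ₁, -⟩ := hWP.wellPosed k hk f₁ g₁
  obtain ⟨ψ₂, hψ₂, -⟩ := hWP.wellPosed k hk f₂ g₂
  -- The difference of the two forms is T^Δ; its parts act as `L²` data, whose pairings with `w` are
  -- values of b⁻(·, w).
  have hsplit : p.bP k w w = p.bM k w w + p.bM k ψ₁ w + p.bM k ψ₂ w := by
    have d1 : p.TvolP k w w = p.TvolM k w w - (Rvol w w + Avol w w) := by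
      rw [← LinearMap.add_apply, ← LinearMap.add_apply, ← e1]
      simp
    have d2 : p.TbdryP k (tr w) (tr w) = p.TbdryM k (tr w) (tr w)
        - (Rbdry (tr w) (tr w) + Abdry (tr w) (tr w)) := by
      rw [← LinearMap.add_apply, ← LinearMap.add_apply, ← e2]
      simp
    rw [hψ₁ w, hψ₂ w, ← hf₁ w, ← hg₁ (tr w), ← hf₂ w, ← hg₂ (tr w), Problem.bP, Problem.bM,
      d1, d2]
    ring
  obtain ⟨σ, hσ, hco⟩ := hcoer k hk
  have hlow : Cc * N ^ 2 ≤ ‖p.bM k w w‖ + ‖p.bM k ψ₁ w‖ + ‖p.bM k ψ₂ w‖ := by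
    calc Cc * N ^ 2 ≤ (σ * p.bP k w w).re := hco w
      _ ≤ ‖σ * p.bP k w w‖ := Complex.re_le_norm _
      _ = ‖p.bM k w w + p.bM k ψ₁ w + p.bM k ψ₂ w‖ := by rw [norm_mul, hσ, one_mul, hsplit]
      _ ≤ _ := norm_add₃_le
  -- The first smallness condition bounds each of its two summands by μ / 2: ψ₁ costs `Cr` times the
  -- first, ψ₂ twice the second.
  have hbest : bestApprox k Vh ψ₁ + bestApprox k Vh ψ₂ ≤ (Cr + 2) * N * (μ / 2) := by
    have hn := hrem k hk w f₁ g₁ nf₁ ng₁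
    have h1 := ofReal_bestApprox_le_etaF hΩ hPc hkpos.le
      (fun u => hWP.eq_zero_of_isSolM_zero hk) Vh hψ₁ (ne_top_of_le_ne_top ENNReal.ofReal_ne_top hn)
    have h2 := hWP.ofReal_bestApprox_le hk₀ hΩ hPc hk Vh hδ hδD hγD w hMu hMv af ag bu bv hψ₂
    rw [← ENNReal.ofReal_le_ofReal_iff (by positivity),
      ENNReal.ofReal_add (bestApprox_nonneg Vh _) (bestApprox_nonneg Vh _)]
    set ηF := etaF Pc p k Vh 1
    set ηA := etaA Pc p k Vh δ (c.shift δ c.γD)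
    calc _ ≤ ENNReal.ofReal (Cr * (k * N)) * ηF
            + 2 * ENNReal.ofReal N * (ENNReal.ofReal (c.AD k) * ηA) :=
          add_le_add (h1.trans (mul_le_mul_left hn _)) h2
      _ = ENNReal.ofReal N * (ENNReal.ofReal Cr * (ENNReal.ofReal k * ηF)
            + 2 * (ENNReal.ofReal (c.AD k) * ηA)) := by
          rw [ENNReal.ofReal_mul hCr.le, ENNReal.ofReal_mul hkpos.le]
          ring
      _ ≤ ENNReal.ofReal N * (ENNReal.ofReal Cr * ENNReal.ofReal (μ / 2)
            + 2 * ENNReal.ofReal (μ / 2)) := by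
          gcongr
          · exact le_self_add.trans hη
          · exact le_add_self.trans hη
      _ = _ := by
          rw [← add_mul, ← ENNReal.ofReal_ofNat, ← ENNReal.ofReal_add hCr.le (by norm_num),
            ← ENNReal.ofReal_mul (by positivity), ← ENNReal.ofReal_mul hN0]
          congr 1
          ring
  have hwbest := bestApprox_conj_error_le hkpos.le hconj (u := u) huh.1
  have hup : Cc * N ^ 2 ≤ Cb * N * (bestApprox k Vh u + (Cr + 2) * N * (μ / 2)) := by
    refine hlow.trans ((add_le_add (add_le_add (hbw w) (hbw ψ₁)) (hbw ψ₂)).trans ?_)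
    rw [← mul_add, ← mul_add, add_assoc]
    exact mul_le_mul_of_nonneg_left (add_le_add hwbest hbest) (by positivity)
  have e3 : Cb * N * ((Cr + 2) * N * (μ / 2)) = Cc / 2 * N ^ 2 := by
    rw [hμ]
    field_simp
  rw [mul_add, e3] at hup
  -- Half of the coercivity term remains, and one factor `N` must be cancelled.
  rcases hN0.eq_or_lt with h0 | h0
  · rw [← h0]
    exact mul_nonneg (by positivity) (bestApprox_nonneg Vh u)
  · rw [div_mul_eq_mul_div, le_div_iff₀ hCc]
    have : N * (N * Cc) ≤ N * (2 * Cb * bestApprox k Vh u) := by linarith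
    exact le_of_mul_le_mul_left this h0

/-! ### Solvability of the Galerkin equations -/

/-- In finite dimension, a nondegenerate sesquilinear form represents every functional. -/
lemma exists_eq_of_injective {V : Type*} [AddCommGroup V] [Module ℂ V] [FiniteDimensional ℂ V]
    (B : AntidualOp V) (hB : ∀ u, B u = 0 → u = 0) (ℓ : V →ₗ⋆[ℂ] ℂ) : ∃ u, B u = ℓ := by
  let b := Module.finBasis ℂ V
  -- Testing against a basis turns the form into a linear map between spaces of equal dimension,
  -- where injectivity gives surjectivity.
  let T : V →ₗ[ℂ] (Fin (Module.finrank ℂ V) → ℂ) := LinearMap.pi fun i => B.flip (b i)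
  have hinj : Function.Injective T := by
    rw [injective_iff_map_eq_zero]
    exact fun u hu => hB u (b.ext fun i => congrFun hu i)
  have hsurj : Function.Surjective T :=
    (LinearMap.injective_iff_surjective_of_finrank_eq_finrank (by simp)).1 hinj
  obtain ⟨u, hu⟩ := hsurj fun i => ℓ (b i)
  exact ⟨u, b.ext fun i => congrFun hu i⟩

/-- In finite dimension, uniqueness of the Galerkin solution implies existence. -/
lemma Problem.exists_isGalerkin {Vh : Submodule ℂ (Energy Ω t)} (hfin : FiniteDimensional ℂ Vh)
    (huniq : ∀ v, p.IsGalerkin k Vh 0 0 v → v = 0) (f : L2 Ω) (g : L2Bdry Ω) :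
    ∃ uh, p.IsGalerkin k Vh f g uh := by
  let B : AntidualOp Vh :=
    { toFun := fun u => (p.formM k (u : Energy Ω t)).comp Vh.subtype
      map_add' := fun u v => by ext; simp
      map_smul' := fun a u => by ext; simp }
  let ℓ : Vh →ₗ⋆[ℂ] ℂ :=
    { toFun := fun v => inner ℂ (fn (v : Energy Ω t)) f + inner ℂ (tr (v : Energy Ω t) : L2Bdry Ω) g
      map_add' := fun v v' => by
        have e1 : fn ((v + v' : Vh) : Energy Ω t) = fn (v : Energy Ω t) + fn (v' : Energy Ω t) := rfl
        have e2 : (tr ((v + v' : Vh) : Energy Ω t) : L2Bdry Ω)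
          = (tr (v : Energy Ω t) : L2Bdry Ω) + (tr (v' : Energy Ω t) : L2Bdry Ω) := rfl
        rw [e1, e2, inner_add_left, inner_add_left]
        ring
      map_smul' := fun a v => by
        have e1 : fn ((a • v : Vh) : Energy Ω t) = a • fn (v : Energy Ω t) := rfl
        have e2 : (tr ((a • v : Vh) : Energy Ω t) : L2Bdry Ω)
          = a • (tr (v : Energy Ω t) : L2Bdry Ω) := rfl
        rw [e1, e2, inner_smul_left, inner_smul_left, smul_eq_mul]
        ring }
  obtain ⟨u, hu⟩ := exists_eq_of_injective B (fun u hu => Subtype.ext (huniq u ⟨u.2, fun v hv => by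
    have h : p.bM k u v = 0 := congrArg (fun L => L ⟨v, hv⟩) hu
    simp [h]⟩)) ℓ
  exact ⟨u, u.2, fun v hv => congrArg (fun L => L ⟨v, hv⟩) hu⟩

end

end

end Helmholtz

end

theorem mainTheorem3 {d : ℕ} (hd : d = 2 ∨ d = 3)
    {Ω : Set (Helmholtz.E d)} (hΩ : Helmholtz.IsLipschitzDomain Ω)
    {Pc : Set (Set (Helmholtz.E d))} (hPc : Helmholtz.IsLipschitzPartition Ω Pc)
    {t : ℝ} (ht₀ : 0 ≤ t) (ht₁ : t ≤ 1) {k₀ : ℝ} (hk₀ : 0 < k₀)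
    (p : Helmholtz.Problem Ω t) (c : Helmholtz.Consts) (smax : ℕ)
    (hWP : Helmholtz.WP Pc k₀ p c) (hAP : Helmholtz.AP Pc k₀ p c smax)
    (hsymm : Helmholtz.IsSymm k₀ p)
    (hγM : c.γ₀ (min c.δM c.δD) ≤ c.γM) (hγD : c.γ₀ (min c.δM c.δD) ≤ c.γD) :
    ∃ μ : ℝ, 0 < μ ∧ ∃ C : ℝ, 0 < C ∧ ∀ k : ℝ, k₀ ≤ k →
      ∀ Vh : Submodule ℂ (Helmholtz.Energy Ω t), FiniteDimensional ℂ Vh →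
        (∀ v ∈ Vh, Helmholtz.conj v ∈ Vh) →
        ENNReal.ofReal k * Helmholtz.etaF Pc p k Vh 1
          + ENNReal.ofReal (c.AD k) * Helmholtz.etaA Pc p k Vh (min c.δM c.δD)
              (c.shift (min c.δM c.δD) c.γD) ≤ ENNReal.ofReal (μ / 2) →
        ENNReal.ofReal (c.cont k) * ENNReal.ofReal (c.AM k)
          * Helmholtz.etaA Pc p k Vh (min c.δM c.δD)
              (c.shift (min c.δM c.δD) c.γM) ≤ 1 →
        ∀ s : ℝ, 0 ≤ s → s ≤ smax →
          ∀ (f : Helmholtz.L2 Ω) (g : Helmholtz.L2Bdry Ω),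
            Helmholtz.brokenNorm s Pc f < ⊤ → Helmholtz.bdryNorm Ω (s + 1 / 2) g < ⊤ →
            (∃! uh, p.IsGalerkin k Vh f g uh) ∧
            ∀ u uh, p.IsSolM k f g u → p.IsGalerkin k Vh f g uh →
              Helmholtz.energyNorm k (u - uh) ≤ C * Helmholtz.bestApprox k Vh u := by
  obtain ⟨μ, hμ, C, hC, key⟩ := Helmholtz.quasiOptimality hWP hk₀ hΩ hPc hAP hsymm
    (lt_min hWP.δM_pos hAP.δD_pos) (min_le_left _ _) (min_le_right _ _) hγM hγD
  refine ⟨μ, hμ, C, hC, fun k hk Vh hfin hconj hη hη' s _ _ f g _ _ => ?_⟩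
  have hk0 : 0 ≤ k := (hk₀.trans_le hk).le
  have hopt := key k hk Vh hconj hη hη'
  -- For zero data the exact solution is 0, with best approximation error 0, so quasi-optimality
  -- forces every discrete solution to have norm zero.
  have huniq : ∀ v, p.IsGalerkin k Vh 0 0 v → v = 0 := fun v hv => by
    have h := hopt 0 0 0 v Helmholtz.Problem.isSolM_zero hv
    rw [zero_sub, Helmholtz.energyNorm_neg hk0, Helmholtz.bestApprox_zero hk0, mul_zero] at h
    exact hWP.eq_zero_of_energyNorm hk (le_antisymm h (Helmholtz.energyNorm_nonneg v))
  refine ⟨?_, hopt f g⟩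
  obtain ⟨uh, huh⟩ := Helmholtz.Problem.exists_isGalerkin hfin huniq f g
  refine ⟨uh, huh, fun v hv => sub_eq_zero.1 (huniq _ ⟨Vh.sub_mem hv.1 huh.1, fun z hz => ?_⟩)⟩
  have h1 := hv.2 z hz
  have h2 := huh.2 z hz
  rw [← Helmholtz.Problem.formM_apply] at h1 h2 ⊢
  rw [map_sub, LinearMap.sub_apply, h1, h2, sub_self, inner_zero_right, inner_zero_right, add_zero]
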